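/- **Theorem 1.2.** Let $\eta>0$, $p>3$, $0\le q<p$, and let $\Phi:\mathbb R\to\mathbb R$ be of the form $\Phi(\xi)=-|\xi|^p+\Phi_1(\xi)$ with $\Phi_1$ real valued, measurable and $|\Phi_1(\xi)|\le C(1+|\xi|^q)$ for all $\xi$. Let $L$ be defined by $\widehat{Lf}(\xi)=-\Phi(\xi)\widehat f(\xi)$, and consider $$u_t+u_{xxx}+\eta Lu+(u_x)^2=0,\qquad u(x,0)=u_0(x),\qquad x\in\mathbb R,\ t\ge 0. \tag{1}$$ Functions are allowed to be complex valued, and $H^s(\mathbb R)$ is the space of tempered distributions with $\|f\|_{H^s}^2=\int(1+\xi^2)^s|\widehat f(\xi)|^2\,d\xi<\infty$ (unitary normalization of the Fourier transform). A solution of (1) in $C([0,T];H^s)$ is a function $u\in C([0,T];H^s(\mathbb R))$ with $u(0)=u_0$ such that $u_x\in L^2((a,T);L^2(\mathbb R))$ for every $0<a<T$ (so that $(u_x)^2$ is defined), and such that, for all $0<a\le b\le T$, the equation integrated over $[a,b]$ holds in the sense of tempered distributions in $x$. For $0<T\le1$ put $$\|f\|_{Y_T^s}=\sup_{t\in[0,T]}\Big\{\|f(t)\|_{H^s}+t^{\frac{1+|s|}{p}}\|\partial_xf(t)\|_{L^2}\Big\}$$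 (the second term is $0$ at $t=0$). Let $s>1-\frac p2$. Then for every $R>0$ there is a time $T\in(0,1]$, depending only on $R$ (and on $\eta,\Phi,p,s$), such that for every $u_0\in H^s(\mathbb R)$ with $\|u_0\|_{H^s}<R$ the problem (1) has a unique solution $u$ in $C([0,T];H^s(\mathbb R))$. Moreover $u\in Y_T^s$, the map $u_0\mapsto u$ is smooth ($C^\infty$ in the sense of Fréchet, over $\mathbb C$) from the ball $\{\|u_0\|_{H^s}<R\}$ to $C([0,T];H^s(\mathbb R))\cap Y_T^s$, and $u\in C((0,T];H^r(\mathbb R))$ for every $r\in\mathbb R$, i.e. $u\in C((0,T];H^\infty(\mathbb R))$. If $\Phi$ is even and $u_0$ is real valued, then $u(t)$ is real valued for all $t\in[0,T]$. -/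

import Mathlib

open MeasureTheory Set
open scoped SchwartzMap FourierTransform ContDiff

noncomputable section

namespace DissipativeKdV

/-- The weight `⟨ξ⟩ ^ r = (1 + ξ ^ 2) ^ (r / 2)` at the angular frequency `ξ = 2 π ζ`, where `ζ` is
the variable of Mathlib's Fourier transform `∫ exp (-2 π i x ζ) f x dx`. -/
def weight (r : ℝ) (ζ : ℝ) : ℝ := (1 + ‖2 * Real.pi * ζ‖ ^ 2) ^ (r / 2)

theorem weight_hasTemperateGrowth (r : ℝ) :
    (fun ζ : ℝ => (weight r ζ : ℂ)).HasTemperateGrowth := by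
  have h : (fun x : ℝ => (1 + ‖x‖ ^ 2) ^ (r / 2)).HasTemperateGrowth :=
    Function.hasTemperateGrowth_one_add_norm_sq_rpow ℝ (r / 2)
  have h2 : (fun ζ : ℝ => 2 * Real.pi * ζ).HasTemperateGrowth := by fun_prop
  have h3 : (fun ζ : ℝ => weight r ζ).HasTemperateGrowth := h.comp h2
  fun_prop

theorem weight_pos (r ζ : ℝ) : 0 < weight r ζ := by unfold weight; positivity

theorem weight_mul_neg (r ζ : ℝ) : weight r ζ * weight (-r) ζ = 1 := by
  unfold weight
  rw [← Real.rpow_add (by positivity)]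
  simp [← add_div]

/-- The product of the Fourier transform of `f` with the weight `⟨ξ⟩ ^ s`. -/
def weightedFourier (s : ℝ) (f : 𝓢'(ℝ, ℂ)) : 𝓢'(ℝ, ℂ) :=
  TemperedDistribution.smulLeftCLM ℂ (fun ζ : ℝ => (weight s ζ : ℂ)) (𝓕 f)

theorem weightedFourier_add (s : ℝ) (f g : 𝓢'(ℝ, ℂ)) :
    weightedFourier s (f + g) = weightedFourier s f + weightedFourier s g := by
  simp [weightedFourier, FourierTransform.fourier_add]

theorem weightedFourier_smul (s : ℝ) (c : ℂ) (f : 𝓢'(ℝ, ℂ)) :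
    weightedFourier s (c • f) = c • weightedFourier s f := by
  simp [weightedFourier, FourierTransform.fourier_smul]

theorem weightedFourier_eq_zero {s : ℝ} {f : 𝓢'(ℝ, ℂ)} (h : weightedFourier s f = 0) : f = 0 := by
  have h1 : weightedFourier s f = 0 → 𝓕 f = 0 := by
    intro h
    have := congrArg
      (TemperedDistribution.smulLeftCLM ℂ (fun ζ : ℝ => (weight (-s) ζ : ℂ))) h
    rw [weightedFourier, TemperedDistribution.smulLeftCLM_smulLeftCLM_apply
      (weight_hasTemperateGrowth _) (weight_hasTemperateGrowth _)] at this
    have h2 : ((fun ζ : ℝ => (weight s ζ : ℂ)) * fun ζ : ℝ => (weight (-s) ζ : ℂ))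
        = fun _ => (1 : ℂ) := by
      ext ζ
      simp only [Pi.mul_apply]
      exact_mod_cast weight_mul_neg s ζ
    have h3 : ((fun ζ : ℝ => (weight (-s) ζ : ℂ)) * fun ζ : ℝ => (weight s ζ : ℂ))
        = fun _ => (1 : ℂ) := by rw [mul_comm, h2]
    simpa [h2, h3] using this
  have h2 := h1 h
  have := congrArg (fun g : 𝓢'(ℝ, ℂ) => 𝓕⁻ g) h2
  simpa using this

theorem toTemperedDistribution_injective {f g : Lp ℂ 2 (volume : Measure ℝ)}
    (h : (f : 𝓢'(ℝ, ℂ)) = g) : f = g := by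
  have hk := Lp.ker_toTemperedDistributionCLM_eq_bot (F := ℂ) (μ := (volume : Measure ℝ)) (p := 2)
  rw [LinearMap.ker_eq_bot] at hk
  exact hk h

theorem toTemperedDistribution_add (f g : Lp ℂ 2 (volume : Measure ℝ)) :
    ((f + g : Lp ℂ 2 (volume : Measure ℝ)) : 𝓢'(ℝ, ℂ)) = (f : 𝓢'(ℝ, ℂ)) + (g : 𝓢'(ℝ, ℂ)) :=
  map_add (Lp.toTemperedDistributionCLM ℂ (volume : Measure ℝ) 2) f g

theorem toTemperedDistribution_smul (c : ℂ) (f : Lp ℂ 2 (volume : Measure ℝ)) :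
    ((c • f : Lp ℂ 2 (volume : Measure ℝ)) : 𝓢'(ℝ, ℂ)) = c • (f : 𝓢'(ℝ, ℂ)) :=
  map_smul (Lp.toTemperedDistributionCLM ℂ (volume : Measure ℝ) 2) c f

theorem toTemperedDistribution_zero :
    ((0 : Lp ℂ 2 (volume : Measure ℝ)) : 𝓢'(ℝ, ℂ)) = 0 :=
  map_zero (Lp.toTemperedDistributionCLM ℂ (volume : Measure ℝ) 2)

/-- The tempered distributions `f` for which `⟨ξ⟩ ^ s` times the Fourier transform of `f` is a
square integrable function. -/
def sobolevSubmodule (s : ℝ) : Submodule ℂ 𝓢'(ℝ, ℂ) where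
  carrier := {f | ∃ g : Lp ℂ 2 (volume : Measure ℝ), weightedFourier s f = (g : 𝓢'(ℝ, ℂ))}
  add_mem' := by
    rintro f₁ f₂ ⟨g₁, h₁⟩ ⟨g₂, h₂⟩
    exact ⟨g₁ + g₂, by rw [weightedFourier_add, h₁, h₂, toTemperedDistribution_add]⟩
  zero_mem' := ⟨0, by
    rw [toTemperedDistribution_zero]
    simp [weightedFourier, FourierTransform.fourier_zero]⟩
  smul_mem' := by
    rintro c f ⟨g, h⟩
    exact ⟨c • g, by rw [weightedFourier_smul, h, toTemperedDistribution_smul]⟩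

/-- The (complex valued) Sobolev space `H ^ s (ℝ)`. -/
def Sobolev (s : ℝ) : Type := ↥(sobolevSubmodule s)

namespace Sobolev

variable {s : ℝ}

instance : AddCommGroup (Sobolev s) := inferInstanceAs (AddCommGroup ↥(sobolevSubmodule s))

instance : Module ℂ (Sobolev s) := inferInstanceAs (Module ℂ ↥(sobolevSubmodule s))

/-- The inclusion of `H ^ s (ℝ)` in the tempered distributions. -/
def toDistr : Sobolev s →ₗ[ℂ] 𝓢'(ℝ, ℂ) := (sobolevSubmodule s).subtype

theorem toDistr_injective : Function.Injective (toDistr (s := s)) :=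
  (sobolevSubmodule s).injective_subtype

/-- The square integrable function `⟨ξ⟩ ^ s * (𝓕 f)`. -/
def toL2Fun (f : Sobolev s) : Lp ℂ 2 (volume : Measure ℝ) := Classical.choose f.2

theorem toL2Fun_spec (f : Sobolev s) :
    weightedFourier s (toDistr f) = (toL2Fun f : 𝓢'(ℝ, ℂ)) := Classical.choose_spec f.2

/-- The map `f ↦ ⟨ξ⟩ ^ s * (𝓕 f)` from `H ^ s (ℝ)` to `L ^ 2 (ℝ)`. -/
def toL2 : Sobolev s →ₗ[ℂ] Lp ℂ 2 (volume : Measure ℝ) where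
  toFun := toL2Fun
  map_add' f g := by
    apply toTemperedDistribution_injective
    rw [toTemperedDistribution_add, ← toL2Fun_spec, ← toL2Fun_spec, ← toL2Fun_spec, map_add,
      weightedFourier_add]
  map_smul' c f := by
    apply toTemperedDistribution_injective
    rw [RingHom.id_apply, toTemperedDistribution_smul, ← toL2Fun_spec, ← toL2Fun_spec, map_smul,
      weightedFourier_smul]

theorem toL2_spec (f : Sobolev s) :
    weightedFourier s (toDistr f) = (toL2 f : 𝓢'(ℝ, ℂ)) := toL2Fun_spec f

theorem toL2_injective : Function.Injective (toL2 (s := s)) := by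
  rw [injective_iff_map_eq_zero]
  intro f hf
  apply toDistr_injective
  rw [map_zero]
  apply weightedFourier_eq_zero (s := s)
  rw [toL2_spec, hf, toTemperedDistribution_zero]

/-- The norm `‖f‖_{H ^ s}` is the `L ^ 2` norm of `⟨ξ⟩ ^ s * (𝓕 f)`. -/
instance : NormedAddCommGroup (Sobolev s) :=
  NormedAddCommGroup.induced (Sobolev s) (Lp ℂ 2 (volume : Measure ℝ)) toL2 toL2_injective

instance : NormedSpace ℂ (Sobolev s) :=
  NormedSpace.induced ℂ (Sobolev s) (Lp ℂ 2 (volume : Measure ℝ)) toL2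

theorem norm_def (f : Sobolev s) : ‖f‖ = ‖toL2 f‖ := rfl

/-- The Fourier transform of `f ∈ H ^ s (ℝ)`, which is a function. -/
def fourierFun (f : Sobolev s) (ζ : ℝ) : ℂ := (weight (-s) ζ : ℂ) * toL2 f ζ

end Sobolev

/-- The distribution `f` is (given by) a square integrable function. -/
def IsL2 (f : 𝓢'(ℝ, ℂ)) : Prop := ∃ g : Lp ℂ 2 (volume : Measure ℝ), f = (g : 𝓢'(ℝ, ℂ))

open Classical in
/-- The `L ^ 2` norm of a distribution that is a square integrable function (and `0` for the
others). -/
def l2norm (f : 𝓢'(ℝ, ℂ)) : ℝ := if h : IsL2 f then ‖h.choose‖ else 0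

theorem l2norm_coe (g : Lp ℂ 2 (volume : Measure ℝ)) : l2norm (g : 𝓢'(ℝ, ℂ)) = ‖g‖ := by
  have h : IsL2 (g : 𝓢'(ℝ, ℂ)) := ⟨g, rfl⟩
  rw [l2norm, dif_pos h, ← toTemperedDistribution_injective h.choose_spec]

theorem l2norm_nonneg (f : 𝓢'(ℝ, ℂ)) : 0 ≤ l2norm f := by
  unfold l2norm; split <;> positivity

theorem IsL2.add {f g : 𝓢'(ℝ, ℂ)} (hf : IsL2 f) (hg : IsL2 g) : IsL2 (f + g) := by
  obtain ⟨a, rfl⟩ := hf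
  obtain ⟨b, rfl⟩ := hg
  exact ⟨a + b, (toTemperedDistribution_add a b).symm⟩

theorem IsL2.smul {f : 𝓢'(ℝ, ℂ)} (c : ℂ) (hf : IsL2 f) : IsL2 (c • f) := by
  obtain ⟨a, rfl⟩ := hf
  exact ⟨c • a, (toTemperedDistribution_smul c a).symm⟩

theorem l2norm_add_le {f g : 𝓢'(ℝ, ℂ)} (hf : IsL2 f) (hg : IsL2 g) :
    l2norm (f + g) ≤ l2norm f + l2norm g := by
  obtain ⟨a, rfl⟩ := hf
  obtain ⟨b, rfl⟩ := hg
  rw [← toTemperedDistribution_add, l2norm_coe, l2norm_coe, l2norm_coe]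
  exact norm_add_le a b

theorem l2norm_smul {f : 𝓢'(ℝ, ℂ)} (c : ℂ) (hf : IsL2 f) : l2norm (c • f) = ‖c‖ * l2norm f := by
  obtain ⟨a, rfl⟩ := hf
  rw [← toTemperedDistribution_smul, l2norm_coe, l2norm_coe, norm_smul]

theorem IsL2.zero : IsL2 0 := ⟨0, toTemperedDistribution_zero.symm⟩

theorem l2norm_zero : l2norm 0 = 0 := by
  rw [← toTemperedDistribution_zero, l2norm_coe, norm_zero]

/-- The spatial derivative of an element of `H ^ s (ℝ)`, a tempered distribution. -/
def dx {s : ℝ} : Sobolev s →ₗ[ℂ] 𝓢'(ℝ, ℂ) :=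
  (TemperedDistribution.derivCLM ℂ : 𝓢'(ℝ, ℂ) →L[ℂ] 𝓢'(ℝ, ℂ)).toLinearMap ∘ₗ Sobolev.toDistr

open Classical in
/-- The quantity `‖f(t)‖_{H ^ s} + t ^ ((1 + |s|) / p) * ‖∂ₓ f(t)‖_{L ^ 2}`; because of the factor
`t ^ ((1 + |s|) / p)` the second term is `0` at `t = 0`. -/
def yTerm (p s T : ℝ) (f : C(Icc (0 : ℝ) T, Sobolev s)) (t : Icc (0 : ℝ) T) : ℝ :=
  ‖f t‖ + if 0 < (t : ℝ) then (t : ℝ) ^ ((1 + |s|) / p) * l2norm (dx (f t)) else 0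

theorem norm_le_yTerm (p s T : ℝ) (f : C(Icc (0 : ℝ) T, Sobolev s)) (t : Icc (0 : ℝ) T) :
    ‖f t‖ ≤ yTerm p s T f t := by
  refine le_add_of_nonneg_right ?_
  split
  · exact mul_nonneg (Real.rpow_nonneg t.2.1 _) (l2norm_nonneg _)
  · exact le_rfl

theorem yTerm_nonneg (p s T : ℝ) (f : C(Icc (0 : ℝ) T, Sobolev s)) (t : Icc (0 : ℝ) T) :
    0 ≤ yTerm p s T f t :=
  (norm_nonneg _).trans (norm_le_yTerm p s T f t)

theorem yTerm_add_le {p s T : ℝ} {f g : C(Icc (0 : ℝ) T, Sobolev s)}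
    (hf : ∀ t : Icc (0 : ℝ) T, 0 < (t : ℝ) → IsL2 (dx (f t)))
    (hg : ∀ t : Icc (0 : ℝ) T, 0 < (t : ℝ) → IsL2 (dx (g t))) (t : Icc (0 : ℝ) T) :
    yTerm p s T (f + g) t ≤ yTerm p s T f t + yTerm p s T g t := by
  unfold yTerm
  rw [ContinuousMap.add_apply, map_add]
  have h1 := norm_add_le (f t) (g t)
  split
  · rename_i ht
    have h2 := mul_le_mul_of_nonneg_left (l2norm_add_le (hf t ht) (hg t ht))
      (Real.rpow_nonneg t.2.1 ((1 + |s|) / p))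
    linarith
  · linarith

theorem yTerm_smul {p s T : ℝ} (c : ℂ) {f : C(Icc (0 : ℝ) T, Sobolev s)}
    (hf : ∀ t : Icc (0 : ℝ) T, 0 < (t : ℝ) → IsL2 (dx (f t))) (t : Icc (0 : ℝ) T) :
    yTerm p s T (c • f) t = ‖c‖ * yTerm p s T f t := by
  unfold yTerm
  rw [ContinuousMap.smul_apply, map_smul, norm_smul]
  split
  · rename_i ht
    rw [l2norm_smul c (hf t ht)]
    ring
  · ring

/-- The functions `f ∈ C([0, T]; H ^ s)` with `∂ₓ f(t) ∈ L ^ 2` for `0 < t ≤ T` and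
`sup_{t ∈ [0, T]} (‖f(t)‖_{H ^ s} + t ^ ((1 + |s|) / p) * ‖∂ₓ f(t)‖_{L ^ 2}) < ∞`. -/
def ySubmodule (p s T : ℝ) : Submodule ℂ C(Icc (0 : ℝ) T, Sobolev s) where
  carrier := {f | (∀ t : Icc (0 : ℝ) T, 0 < (t : ℝ) → IsL2 (dx (f t))) ∧
    BddAbove (range (yTerm p s T f))}
  add_mem' := by
    rintro f g ⟨hf, A, hA⟩ ⟨hg, B, hB⟩
    refine ⟨fun t ht => ?_, A + B, ?_⟩
    · rw [ContinuousMap.add_apply, map_add]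
      exact (hf t ht).add (hg t ht)
    · rintro _ ⟨t, rfl⟩
      exact (yTerm_add_le hf hg t).trans (add_le_add (hA ⟨t, rfl⟩) (hB ⟨t, rfl⟩))
  zero_mem' := by
    refine ⟨fun t _ => ?_, 0, ?_⟩
    · rw [ContinuousMap.zero_apply, map_zero]
      exact IsL2.zero
    · rintro _ ⟨t, rfl⟩
      simp [yTerm, l2norm_zero]
  smul_mem' := by
    rintro c f ⟨hf, A, hA⟩
    refine ⟨fun t ht => ?_, ‖c‖ * A, ?_⟩
    · rw [ContinuousMap.smul_apply, map_smul]
      exact (hf t ht).smul c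
    · rintro _ ⟨t, rfl⟩
      rw [yTerm_smul c hf t]
      exact mul_le_mul_of_nonneg_left (hA ⟨t, rfl⟩) (norm_nonneg c)

/-- The space `C([0, T]; H ^ s) ∩ Y_T ^ s`. -/
def YSpace (p s T : ℝ) : Type := ↥(ySubmodule p s T)

namespace YSpace

variable {p s T : ℝ}

instance : AddCommGroup (YSpace p s T) := inferInstanceAs (AddCommGroup ↥(ySubmodule p s T))

instance : Module ℂ (YSpace p s T) := inferInstanceAs (Module ℂ ↥(ySubmodule p s T))

/-- The inclusion in `C([0, T]; H ^ s)`. -/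
def toC : YSpace p s T →ₗ[ℂ] C(Icc (0 : ℝ) T, Sobolev s) := (ySubmodule p s T).subtype

theorem toC_injective : Function.Injective (toC (p := p) (s := s) (T := T)) :=
  (ySubmodule p s T).injective_subtype

theorem toC_isL2 (f : YSpace p s T) (t : Icc (0 : ℝ) T) (ht : 0 < (t : ℝ)) :
    IsL2 (dx (toC f t)) := f.2.1 t ht

theorem toC_bddAbove (f : YSpace p s T) : BddAbove (range (yTerm p s T (toC f))) := f.2.2

/-- The norm
`‖f‖_{Y_T ^ s} = sup_{t ∈ [0, T]} (‖f(t)‖_{H ^ s} + t ^ ((1 + |s|) / p) * ‖∂ₓ f(t)‖_{L ^ 2})`. -/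
instance : Norm (YSpace p s T) := ⟨fun f => ⨆ t : Icc (0 : ℝ) T, yTerm p s T (toC f) t⟩

theorem norm_def (f : YSpace p s T) :
    ‖f‖ = ⨆ t : Icc (0 : ℝ) T, yTerm p s T (toC f) t := rfl

theorem yTerm_le_norm (f : YSpace p s T) (t : Icc (0 : ℝ) T) : yTerm p s T (toC f) t ≤ ‖f‖ :=
  le_ciSup (toC_bddAbove f) t

theorem core : NormedSpace.Core ℂ (YSpace p s T) where
  norm_nonneg f := Real.iSup_nonneg fun t => yTerm_nonneg p s T _ t
  norm_smul c f := by
    rw [norm_def, norm_def, Real.mul_iSup_of_nonneg (norm_nonneg c)]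
    congr 1
    ext t
    rw [map_smul]
    exact yTerm_smul c (toC_isL2 f) t
  norm_triangle f g := by
    have h0 : ∀ f : YSpace p s T, 0 ≤ ‖f‖ := fun f =>
      Real.iSup_nonneg fun t => yTerm_nonneg p s T _ t
    rw [norm_def (f + g)]
    refine Real.iSup_le (fun t => ?_) (add_nonneg (h0 f) (h0 g))
    rw [map_add]
    exact (yTerm_add_le (toC_isL2 f) (toC_isL2 g) t).trans
      (add_le_add (yTerm_le_norm f t) (yTerm_le_norm g t))
  norm_eq_zero_iff f := by
    constructor
    · intro h
      apply toC_injective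
      ext1 t
      have h1 := yTerm_le_norm f t
      rw [h] at h1
      have h3 : ‖toC f t‖ ≤ 0 := (norm_le_yTerm p s T _ t).trans h1
      rw [map_zero]
      exact norm_le_zero_iff.mp h3
    · rintro rfl
      rw [norm_def]
      simp [yTerm, l2norm_zero]

instance : NormedAddCommGroup (YSpace p s T) := NormedAddCommGroup.ofCore core

instance : NormedSpace ℂ (YSpace p s T) := NormedSpace.ofCore core

open Classical in
/-- An element of `C([0, T]; H ^ s) ∩ Y_T ^ s` as a function of `t ∈ ℝ`, set to `0` outside
`[0, T]`. -/
def toFun (f : YSpace p s T) (t : ℝ) : Sobolev s :=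
  if ht : t ∈ Icc (0 : ℝ) T then toC f ⟨t, ht⟩ else 0

end YSpace

/-- The action on the Schwartz function `φ` of the tempered distribution `L f`, `f ∈ H ^ s (ℝ)`,
where `L` is the Fourier multiplier given by `(L f)^(ξ) = -Φ(ξ) * f^(ξ)`. It is the integral of
`𝓕 (L f)` against `𝓕⁻ φ`, and `ξ = 2 π ζ`. -/
def opL (Φ : ℝ → ℝ) {s : ℝ} (f : Sobolev s) (φ : 𝓢(ℝ, ℂ)) : ℂ :=
  ∫ ζ : ℝ, -(Φ (2 * Real.pi * ζ) : ℂ) * f.fourierFun ζ * (𝓕⁻ φ) ζ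

/-- `u` is a solution on the time interval `[0, T]` of
`u_t + u_xxx + η L u + (u_x) ^ 2 = 0`, `u(0) = u₀`, in the space `C([0, T]; H ^ s)`:
`u` is continuous on `[0, T]` with values in `H ^ s`, takes the value `u₀` at `0`, the derivative
`u_x` belongs to `L ^ 2 (a, T; L ^ 2 (ℝ))` for every `0 < a < T` (so that `(u_x) ^ 2` is defined),
and the equation, integrated over any `[a, b] ⊆ (0, T]`, holds in the sense of tempered
distributions. -/
def IsSolution (Φ : ℝ → ℝ) (η T : ℝ) {s : ℝ} (u₀ : Sobolev s) (u : ℝ → Sobolev s) : Prop :=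
  ContinuousOn u (Icc 0 T) ∧ u 0 = u₀ ∧
  ∃ w : ℝ → Lp ℂ 2 (volume : Measure ℝ),
    (∀ a ∈ Ioo 0 T, MemLp w 2 (volume.restrict (Ioc a T))) ∧
    (∀ᵐ t ∂volume.restrict (Ioc 0 T), dx (u t) = (w t : 𝓢'(ℝ, ℂ))) ∧
    ∀ φ : 𝓢(ℝ, ℂ), ∀ a b : ℝ, 0 < a → a ≤ b → b ≤ T →
      (u b).toDistr φ - (u a).toDistr φ
        + ∫ t in a..b, ((TemperedDistribution.derivCLM ℂ (TemperedDistribution.derivCLM ℂ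
            (dx (u t)))) φ + (η : ℂ) * opL Φ (u t) φ + ∫ x : ℝ, (w t x) ^ 2 * φ x) = 0

/-- `u ∈ C((0, T]; H ^ ∞ (ℝ))`: for every `r`, `u` is a continuous function on `(0, T]` with values
in `H ^ r`. -/
def ContinuousIntoHInfty (T : ℝ) {s : ℝ} (u : ℝ → Sobolev s) : Prop :=
  ∀ r : ℝ, ∃ w : ℝ → Sobolev r, ContinuousOn w (Ioc 0 T) ∧
    ∀ t ∈ Ioc 0 T, (w t).toDistr = (u t).toDistr

/-- `f` is a real valued distribution: it takes real values on real valued test functions. -/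
def IsReal {s : ℝ} (f : Sobolev s) : Prop :=
  ∀ φ : 𝓢(ℝ, ℂ), (∀ x, (φ x).im = 0) → (f.toDistr φ).im = 0

end DissipativeKdV

end

/-! The proof works on the Fourier side, with `m(ξ) = i ξ ^ 3 + η Φ(ξ)` and `w = u_x`, where the
equation is equivalent, frequency by frequency, to the Duhamel formula
`𝓕 u(t) = exp (t m) 𝓕 u₀ - ∫₀ᵗ exp ((t - τ) m) 𝓕 (w(τ) ^ 2) dτ`.

The real part of `m` is at most `B - c ⟨ξ⟩ ^ p`, because `Φ₁` has lower order and `i ξ ^ 3` is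
imaginary. Hence `|exp (t m)| ≤ K t ^ (-κ) ⟨ξ⟩ ^ (-κ p)` for `0 ≤ κ ≤ 1` and `0 < t ≤ 1`
(`exists_isDissipative`): every power `t ^ κ` of time is worth `κ p` derivatives.

*Existence and smooth dependence.* Let `σ = max s 1` and `β = (σ - s) / p`, so that the condition
`s > 1 - p / 2` (with `p > 3`) says that `2 β < 1`. The linear evolution of `u₀ ∈ H ^ s` has size
`t ^ (-β)` in `H ^ σ`. If `u(τ)` has this size, then `𝓕 (u_x ^ 2)` is a convolution of two `L ^ 2`
functions, and is bounded by `τ ^ (-2 β) ⟨ξ⟩ ^ (1 - σ)`, by Peetre's inequality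
(`norm_weight_mul_fourierMul_le`). Since the singularity `τ ^ (-2 β)` is integrable and
`3 / (2 p) < 1 / 2`, some `κ < 1 / 2` gives enough derivatives to put the Duhamel integral back in
`H ^ σ`, with a positive power of `T` to spare. So `y = t ^ β ⟨ξ⟩ ^ σ 𝓕 u`, as a bounded continuous
function on `(0, T]` with values in `L ^ 2`, solves a quadratic equation `y = a - B(y, y)` with `B`
small. It is solved by a contraction, and the solution is a smooth function of `a` by the inverse
function theorem (`exists_contDiffOn_quadratic`). As `a` is linear in `u₀`, and `u` is recovered
from `u₀` and `(y, y)` by bounded linear maps into `C([0, T]; H ^ s) ∩ Y_T ^ s`, the solution map is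
smooth (`exists_solutionMap`). The exponent of the norm of `Y_T ^ s` satisfies
`β ≤ (1 + |s|) / p`.

*Weak solutions.* The equation tested against Schwartz functions holds if and only if the equation
integrated in time holds at almost every frequency
(`TemperedIntegrableOn.forall_schwartz_iff`), where it is a scalar linear differential equation,
solved by the Duhamel formula (`IsMild.isSolution`, `IsSolution.exists_isMild`). The Fourier
transforms are only defined almost everywhere, so that a representative is needed that is
measurable in time and frequency; it is the limit of the local averages (`stronglyMeasurable_rep`).

*Uniqueness.* For the Duhamel formula with `w ∈ L ^ 2 (0, T; L ^ 2)`, the difference of two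
solutions satisfies a Volterra inequality with an integrable kernel (`IsMild.unique`). For a
solution `v` in the sense of the theorem, the derivative is in `L ^ 2` only away from `t = 0`. But
`v` restarted at a time `a > 0` satisfies the Duhamel formula, hence is the solution with the initial
value `v(a)`, which is in the ball if `a` is small. The solution map is continuous and `v(a) → u₀` as
`a → 0`, so `v` is the solution with the initial value `u₀` (`eq_of_isSolution`).

*Regularity and real values.* Restarted at a positive time, the Duhamel formula gains one derivative
at each application (`HasRegularity.succ`). If `Φ` is even, then `m(-ξ)` is the conjugate of `m(ξ)`,
the conjugate of a solution is a solution, and uniqueness applies (`IsMild.isReal`).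
-/

open MeasureTheory Set Filter Topology
open scoped SchwartzMap FourierTransform ContDiff ENNReal NNReal
open scoped BoundedContinuousFunction ComplexConjugate

noncomputable section

namespace DissipativeKdV

/-! ### Square integrable functions and weights -/

/-- The space `L ^ 2 (ℝ)` of complex valued functions. -/
abbrev L2 : Type := Lp ℂ 2 (volume : Measure ℝ)

open Classical in
/-- The class in `L ^ 2` of a function, set to `0` if the function is not square integrable. -/
def mkL2 (f : ℝ → ℂ) : L2 := if h : MemLp f 2 volume then h.toLp f else 0

theorem coeFn_mkL2 {f : ℝ → ℂ} (hf : MemLp f 2 volume) : mkL2 f =ᵐ[volume] f := by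
  rw [mkL2, dif_pos hf]
  exact hf.coeFn_toLp

theorem mkL2_congr {f g : ℝ → ℂ} (h : f =ᵐ[volume] g) : mkL2 f = mkL2 g := by
  by_cases hf : MemLp f 2 volume
  · have hg := (memLp_congr_ae h).1 hf
    apply Lp.ext
    exact (coeFn_mkL2 hf).trans (h.trans (coeFn_mkL2 hg).symm)
  · have hg : ¬ MemLp g 2 volume := fun hg => hf ((memLp_congr_ae h).2 hg)
    rw [mkL2, mkL2, dif_neg hf, dif_neg hg]

theorem mkL2_coeFn (f : L2) : mkL2 f = f := Lp.ext (coeFn_mkL2 (Lp.memLp f))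

theorem mkL2_eq_of_ae {f : ℝ → ℂ} {g : L2} (h : f =ᵐ[volume] g) : mkL2 f = g := by
  rw [mkL2_congr h, mkL2_coeFn]

theorem mkL2_add {f g : ℝ → ℂ} (hf : MemLp f 2 volume) (hg : MemLp g 2 volume) :
    mkL2 (f + g) = mkL2 f + mkL2 g := by
  apply Lp.ext
  filter_upwards [coeFn_mkL2 hf, coeFn_mkL2 hg, coeFn_mkL2 (hf.add hg),
    Lp.coeFn_add (mkL2 f) (mkL2 g)] with x h1 h2 h3 h4
  rw [h3, h4, Pi.add_apply, Pi.add_apply, h1, h2]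

theorem mkL2_sub {f g : ℝ → ℂ} (hf : MemLp f 2 volume) (hg : MemLp g 2 volume) :
    mkL2 (f - g) = mkL2 f - mkL2 g := by
  apply Lp.ext
  filter_upwards [coeFn_mkL2 hf, coeFn_mkL2 hg, coeFn_mkL2 (hf.sub hg),
    Lp.coeFn_sub (mkL2 f) (mkL2 g)] with x h1 h2 h3 h4
  rw [h3, h4, Pi.sub_apply, Pi.sub_apply, h1, h2]

theorem mkL2_smul {f : ℝ → ℂ} (c : ℂ) (hf : MemLp f 2 volume) :
    mkL2 (c • f) = c • mkL2 f := by
  apply Lp.ext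
  filter_upwards [coeFn_mkL2 hf, coeFn_mkL2 (hf.const_smul c),
    Lp.coeFn_smul c (mkL2 f)] with x h1 h2 h3
  rw [h3, h2, Pi.smul_apply, Pi.smul_apply, h1]

theorem norm_mkL2_le_mul {f : ℝ → ℂ} {g : L2} {c : ℝ} (hf : MemLp f 2 volume)
    (h : ∀ᵐ ζ, ‖f ζ‖ ≤ c * ‖g ζ‖) : ‖mkL2 f‖ ≤ c * ‖g‖ := by
  refine Lp.norm_le_mul_norm_of_ae_le_mul ?_
  filter_upwards [coeFn_mkL2 hf, h] with x h1 h3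
  rwa [h1]

theorem memLp_of_norm_le {f : ℝ → ℂ} {g : ℝ → ℝ} (hf : AEStronglyMeasurable f volume)
    (hg : MemLp g 2 volume) (h : ∀ᵐ ζ, ‖f ζ‖ ≤ g ζ) : MemLp f 2 volume :=
  hg.mono hf (by filter_upwards [h] with x hx using hx.trans (le_abs_self _))

theorem memLp_mul_of_norm_le {a : ℝ → ℂ} {c : ℝ} (g : L2) (ha : AEStronglyMeasurable a volume)
    (h : ∀ ζ, ‖a ζ‖ ≤ c) : MemLp (fun ζ => a ζ * g ζ) 2 volume := by
  refine memLp_of_norm_le (g := fun ζ => c * ‖g ζ‖) (ha.mul (Lp.aestronglyMeasurable g))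
    ((Lp.memLp g).norm.const_mul c) (Eventually.of_forall fun ζ => ?_)
  rw [norm_mul]
  gcongr
  exact h ζ

theorem norm_mkL2_sq {f : ℝ → ℂ} (hf : MemLp f 2 volume) :
    ‖mkL2 f‖ ^ 2 = ∫ ζ, ‖f ζ‖ ^ 2 := by
  rw [← Complex.ofReal_inj (z := ‖mkL2 f‖ ^ 2)]
  have h := inner_self_eq_norm_sq_to_K (𝕜 := ℂ) (mkL2 f)
  rw [L2.inner_def] at h
  have h2 : ((∫ ζ, ‖f ζ‖ ^ 2 : ℝ) : ℂ) = ∫ ζ, ((‖f ζ‖ ^ 2 : ℝ) : ℂ) := integral_ofReal.symm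
  rw [h2, Complex.ofReal_pow]
  refine h.symm.trans (integral_congr_ae ?_)
  filter_upwards [coeFn_mkL2 hf] with x hx
  rw [hx, inner_self_eq_norm_sq_to_K]
  simp

/-- Dominated convergence in `L ^ 2`. -/
theorem tendsto_mkL2 {ι : Type*} {l : Filter ι} [l.IsCountablyGenerated] {F : ι → ℝ → ℂ}
    {f : ℝ → ℂ} {g : ℝ → ℝ} (hF : ∀ᶠ i in l, AEStronglyMeasurable (F i) volume)
    (hf : AEStronglyMeasurable f volume) (hg : MemLp g 2 volume)
    (hFg : ∀ᶠ i in l, ∀ᵐ ζ, ‖F i ζ‖ ≤ g ζ) (hfg : ∀ᵐ ζ, ‖f ζ‖ ≤ g ζ)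
    (hlim : ∀ᵐ ζ, Tendsto (fun i => F i ζ) l (𝓝 (f ζ))) :
    Tendsto (fun i => mkL2 (F i)) l (𝓝 (mkL2 f)) := by
  have hf2 := memLp_of_norm_le hf hg hfg
  rw [tendsto_iff_norm_sub_tendsto_zero]
  have h1 : Tendsto (fun i => ∫ ζ, ‖F i ζ - f ζ‖ ^ 2) l (𝓝 (∫ _ : ℝ, (0 : ℝ))) := by
    refine tendsto_integral_filter_of_dominated_convergence (fun ζ => (2 * g ζ) ^ 2) ?_ ?_ ?_ ?_
    · filter_upwards [hF] with i hi using ((hi.sub hf).norm.pow 2)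
    · filter_upwards [hFg] with i hi
      filter_upwards [hi, hfg] with ζ h1 h2
      rw [Real.norm_eq_abs, abs_of_nonneg (by positivity)]
      refine pow_le_pow_left₀ (norm_nonneg _) ?_ 2
      linarith [norm_sub_le (F i ζ) (f ζ)]
    · exact (hg.const_mul 2).integrable_sq
    · filter_upwards [hlim] with ζ hζ
      have := (tendsto_iff_norm_sub_tendsto_zero.1 hζ).pow 2
      simpa using this
  rw [integral_zero] at h1
  have h2 := h1.sqrt
  rw [Real.sqrt_zero] at h2
  refine h2.congr' ?_
  filter_upwards [hF, hFg] with i h3 h4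
  have h5 := memLp_of_norm_le h3 hg h4
  rw [← mkL2_sub h5 hf2, ← Real.sqrt_sq (norm_nonneg (mkL2 (F i - f))), norm_mkL2_sq (h5.sub hf2)]
  rfl

theorem weight_mul (r s ζ : ℝ) : weight r ζ * weight s ζ = weight (r + s) ζ := by
  unfold weight
  rw [← Real.rpow_add (by positivity), ← add_div]

theorem weight_zero (ζ : ℝ) : weight 0 ζ = 1 := by simp [weight]

theorem weight_rpow (r s ζ : ℝ) : weight r ζ ^ s = weight (r * s) ζ := by
  unfold weight
  rw [← Real.rpow_mul (by positivity)]
  ring_nf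

theorem weight_le_weight {r s : ℝ} (h : r ≤ s) (ζ : ℝ) : weight r ζ ≤ weight s ζ := by
  unfold weight
  refine Real.rpow_le_rpow_of_exponent_le ?_ (by linarith)
  nlinarith [sq_nonneg ‖2 * Real.pi * ζ‖]

theorem one_le_weight {r : ℝ} (h : 0 ≤ r) (ζ : ℝ) : 1 ≤ weight r ζ := by
  rw [← weight_zero ζ]; exact weight_le_weight h ζ

theorem weight_le_one {r : ℝ} (h : r ≤ 0) (ζ : ℝ) : weight r ζ ≤ 1 := by
  rw [← weight_zero ζ]; exact weight_le_weight h ζ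

theorem continuous_weight (r : ℝ) : Continuous (weight r) := by
  unfold weight
  refine Continuous.rpow_const (by fun_prop) fun x => Or.inl (by positivity)

theorem continuous_weight_ofReal (r : ℝ) : Continuous (fun ζ => (weight r ζ : ℂ)) :=
  Complex.continuous_ofReal.comp (continuous_weight r)

theorem norm_weight_ofReal (r ζ : ℝ) : ‖(weight r ζ : ℂ)‖ = weight r ζ := by
  rw [Complex.norm_real, Real.norm_eq_abs, abs_of_pos (weight_pos r ζ)]

theorem abs_le_weight_one (ζ : ℝ) : |2 * Real.pi * ζ| ≤ weight 1 ζ := by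
  rw [weight, ← Real.sqrt_eq_rpow]
  refine Real.le_sqrt_of_sq_le ?_
  rw [Real.norm_eq_abs]
  linarith

/-- Peetre's inequality. -/
theorem weight_sub_mul {r : ℝ} (h : 0 ≤ r) (ζ z : ℝ) :
    weight r ζ ≤ 2 ^ (r / 2) * (weight r (ζ - z) * weight r z) := by
  unfold weight
  rw [← Real.mul_rpow (by positivity) (by positivity),
    ← Real.mul_rpow (by positivity) (by positivity)]
  refine Real.rpow_le_rpow (by positivity) ?_ (by positivity)
  simp only [Real.norm_eq_abs, sq_abs]
  have h1 : 2 * Real.pi * ζ = 2 * Real.pi * (ζ - z) + 2 * Real.pi * z := by ring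
  rw [h1]
  nlinarith [sq_nonneg (2 * Real.pi * (ζ - z) - 2 * Real.pi * z),
    mul_nonneg (sq_nonneg (2 * Real.pi * (ζ - z))) (sq_nonneg (2 * Real.pi * z))]

theorem integrable_weight {r : ℝ} (h : r < -1) : Integrable (weight r) volume := by
  have h1 : Integrable (fun x : ℝ => (1 + ‖x‖ ^ 2) ^ (-(-r) / 2)) volume :=
    integrable_rpow_neg_one_add_norm_sq (by simpa using by linarith)
  have h2 := h1.comp_mul_left' (R := 2 * Real.pi) (by positivity)
  exact h2.congr (Eventually.of_forall fun x => by simp [weight])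

theorem memLp_weight {r : ℝ} (h : r < -1 / 2) : MemLp (weight r) 2 volume := by
  rw [memLp_two_iff_integrable_sq (continuous_weight r).aestronglyMeasurable]
  refine (integrable_weight (r := r + r) (by linarith)).congr (Eventually.of_forall fun ζ => ?_)
  show _ = weight r ζ ^ 2
  rw [← weight_mul, sq]

/-! ### Multiplication operators and a jointly measurable choice of representatives -/

/-- Multiplication of `L ^ 2` functions by a bounded measurable function. -/
def mulL2 (a : ℝ → ℂ) (c : ℝ) (ha : AEStronglyMeasurable a volume) (h : ∀ ζ, ‖a ζ‖ ≤ c) :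
    L2 →L[ℂ] L2 :=
  LinearMap.mkContinuous
    { toFun := fun g => mkL2 fun ζ => a ζ * g ζ
      map_add' := fun f g => by
        rw [← mkL2_add (memLp_mul_of_norm_le f ha h) (memLp_mul_of_norm_le g ha h)]
        refine mkL2_congr ?_
        filter_upwards [Lp.coeFn_add f g] with ζ hζ
        rw [hζ, Pi.add_apply, Pi.add_apply, mul_add]
      map_smul' := fun c g => by
        rw [RingHom.id_apply, ← mkL2_smul c (memLp_mul_of_norm_le g ha h)]
        refine mkL2_congr ?_
        filter_upwards [Lp.coeFn_smul c g] with ζ hζ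
        rw [hζ, Pi.smul_apply, Pi.smul_apply, smul_eq_mul, smul_eq_mul]
        ring }
    c fun g => norm_mkL2_le_mul (memLp_mul_of_norm_le g ha h) <| Eventually.of_forall fun ζ => by
      rw [norm_mul]
      exact mul_le_mul_of_nonneg_right (h ζ) (norm_nonneg _)

theorem coeFn_mulL2 {a : ℝ → ℂ} {c : ℝ} (ha : AEStronglyMeasurable a volume)
    (h : ∀ ζ, ‖a ζ‖ ≤ c) (g : L2) : mulL2 a c ha h g =ᵐ[volume] fun ζ => a ζ * g ζ :=
  coeFn_mkL2 (memLp_mul_of_norm_le g ha h)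

theorem intervalIntegrable_L2 (f : L2) (a b : ℝ) : IntervalIntegrable f volume a b :=
  intervalIntegrable_iff.2 <| (((Lp.memLp f).locallyIntegrable (by norm_num)).integrableOn_isCompact
    isCompact_uIcc).mono_set uIoc_subset_uIcc

theorem continuous_intervalIntegral_L2 (a b : ℝ) :
    Continuous fun f : L2 => ∫ z in a..b, f z := by
  have h : ∀ a b : ℝ, Continuous fun f : L2 => ∫ z in Ioc a b, f z := fun a b => by
    have h1 : Continuous fun f : L2 => (ContinuousLinearMap.mul ℂ ℂ).lpPairing volume 2 2 f
        (indicatorConstLp 2 (measurableSet_Ioc (a := a) (b := b)) (by simp) 1) :=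
      (((ContinuousLinearMap.mul ℂ ℂ).lpPairing volume 2 2).flip _).continuous
    refine h1.congr fun f => ?_
    rw [ContinuousLinearMap.lpPairing_eq_integral, ← integral_indicator measurableSet_Ioc]
    refine integral_congr_ae ?_
    filter_upwards [indicatorConstLp_coeFn (p := 2) (μ := volume) (c := (1 : ℂ))
      (hs := measurableSet_Ioc (a := a) (b := b)) (hμs := by simp)] with z hz
    rw [hz]
    by_cases h : z ∈ Ioc a b <;> simp [h]
  simp only [intervalIntegral]
  exact (h a b).sub (h b a)

/-- The average of `f` over `[ζ - (n + 1)⁻¹, ζ + (n + 1)⁻¹]`. -/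
def localAverage (f : L2) (n : ℕ) (ζ : ℝ) : ℂ :=
  ((n + 1 : ℝ) / 2) • ∫ z in (ζ - (n + 1 : ℝ)⁻¹)..(ζ + (n + 1 : ℝ)⁻¹), f z

/-- A representative of `f ∈ L ^ 2`, the limit of its local averages; unlike the choice made by
the coercion to functions, it depends measurably on `f`. -/
def rep (f : L2) (ζ : ℝ) : ℂ := limUnder atTop fun n => localAverage f n ζ

/-- Lebesgue's differentiation theorem. -/
theorem rep_ae_eq (f : L2) : rep f =ᵐ[volume] f := by
  have h := IsUnifLocDoublingMeasure.ae_tendsto_average (volume : Measure ℝ)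
    ((Lp.memLp f).locallyIntegrable (by norm_num)) 1
  filter_upwards [h] with ζ hζ
  refine Tendsto.limUnder_eq ?_
  have h1 : Tendsto (fun n : ℕ => ((n : ℝ) + 1)⁻¹) atTop (𝓝[>] 0) := by
    refine tendsto_nhdsWithin_iff.2 ⟨?_, Eventually.of_forall fun n => ?_⟩
    · simpa using tendsto_one_div_add_atTop_nhds_zero_nat (𝕜 := ℝ)
    · show (0 : ℝ) < ((n : ℝ) + 1)⁻¹
      positivity
  refine (hζ (fun _ => ζ) _ h1 (Eventually.of_forall fun n => ?_)).congr fun n => ?_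
  · rw [one_mul]
    exact Metric.mem_closedBall_self (by positivity)
  · have h2 : (0 : ℝ) < ((n : ℝ) + 1)⁻¹ := by positivity
    rw [setAverage_eq, Real.closedBall_eq_Icc, integral_Icc_eq_integral_Ioc, localAverage,
      intervalIntegral.integral_of_le (by linarith), Measure.real, Real.volume_Icc,
      ENNReal.toReal_ofReal (by linarith)]
    congr 1
    field_simp
    ring

theorem continuous_localAverage (f : L2) (n : ℕ) : Continuous (localAverage f n) := by
  have h2 : Continuous fun b => ∫ z in (0 : ℝ)..b, f z :=
    intervalIntegral.continuous_primitive (intervalIntegrable_L2 f) 0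
  have h3 : localAverage f n = fun ζ => ((n + 1 : ℝ) / 2) •
      ((∫ z in (0 : ℝ)..(ζ + (n + 1 : ℝ)⁻¹), f z) - ∫ z in (0 : ℝ)..(ζ - (n + 1 : ℝ)⁻¹), f z) := by
    funext ζ
    rw [intervalIntegral.integral_interval_sub_left (intervalIntegrable_L2 _ _ _)
      (intervalIntegrable_L2 _ _ _), localAverage]
  rw [h3]
  exact ((h2.comp (continuous_add_const _)).sub
    (h2.comp (continuous_sub_right _))).const_smul ((n + 1 : ℝ) / 2)

/-- The representative is jointly measurable along a continuous path in `L ^ 2`. -/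
theorem stronglyMeasurable_rep {v : ℝ → L2} (hv : Continuous v) :
    StronglyMeasurable fun q : ℝ × ℝ => rep (v q.1) q.2 := by
  have h1 : ∀ n, StronglyMeasurable fun q : ℝ × ℝ => localAverage (v q.1) n q.2 := fun n => by
    have h2 : ∀ ζ, Continuous fun t => localAverage (v t) n ζ := fun ζ => by
      have h3 := ((continuous_intervalIntegral_L2 (ζ - (n + 1 : ℝ)⁻¹) (ζ + (n + 1 : ℝ)⁻¹)).comp
        hv).const_smul ((n + 1 : ℝ) / 2)
      exact h3
    have h : StronglyMeasurable (Function.uncurry fun (ζ t : ℝ) => localAverage (v t) n ζ) :=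
      stronglyMeasurable_uncurry_of_continuous_of_stronglyMeasurable
        (fun t => continuous_localAverage (v t) n) fun ζ => (h2 ζ).stronglyMeasurable
    have h4 : (fun q : ℝ × ℝ => localAverage (v q.1) n q.2)
        = (Function.uncurry fun (ζ t : ℝ) => localAverage (v t) n ζ) ∘ Prod.swap := rfl
    rw [h4]
    exact h.comp_measurable measurable_swap
  exact StronglyMeasurable.limUnder h1

/-! ### The Fourier transform of a product of two square integrable functions -/

/-- The bounded bilinear map sending `f, g ∈ L ^ 2` to the bounded continuous function
`𝓕 (f * g)`. -/
def fourierMul : L2 →L[ℂ] L2 →L[ℂ] BoundedContinuousFunction ℝ ℂ :=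
  ((Real.Lp.fourierTransformCLM ℝ ℂ).postcomp L2) ∘L
    ((ContinuousLinearMap.mul ℂ ℂ).holderL volume 2 2 1)

theorem fourierMul_apply (f g : L2) (ζ : ℝ) :
    fourierMul f g ζ = 𝓕 (fun x => f x * g x) ζ := by
  refine Real.fourier_congr_ae ?_ ζ
  exact ContinuousLinearMap.coeFn_holder (ContinuousLinearMap.mul ℂ ℂ) f g

theorem norm_fourierMul_le (f g : L2) : ‖fourierMul f g‖ ≤ ‖f‖ * ‖g‖ := by
  have h1 := ContinuousLinearMap.norm_holder_apply_apply_le (r := 1)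
    (ContinuousLinearMap.mul ℂ ℂ) f g
  rw [ContinuousLinearMap.opNorm_mul, one_mul] at h1
  refine le_trans ?_ h1
  rw [BoundedContinuousFunction.norm_le (norm_nonneg _)]
  intro ζ
  rw [L1.norm_eq_integral_norm]
  exact VectorFourier.norm_fourierIntegral_le_integral_norm _ _ _ _ _

theorem norm_fourierMul_apply_le (f g : L2) (ζ : ℝ) : ‖fourierMul f g ζ‖ ≤ ‖f‖ * ‖g‖ :=
  (BoundedContinuousFunction.norm_coe_le_norm _ ζ).trans (norm_fourierMul_le f g)

theorem fourierMul_comm (f g : L2) : fourierMul f g = fourierMul g f := by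
  ext ζ
  rw [fourierMul_apply, fourierMul_apply]
  simp only [mul_comm]

theorem integrable_mul_L2 (f g : L2) : Integrable (fun x => f x * g x) volume :=
  (Lp.memLp f).integrable_mul (Lp.memLp g)

theorem measurePreserving_const_sub (ζ : ℝ) :
    MeasurePreserving (fun z : ℝ => ζ - z) volume volume :=
  Measure.measurePreserving_sub_left volume ζ

/-- The Fourier transform exchanges products and convolutions of `L ^ 2` functions. -/
theorem fourierMul_fourierInv (a b : L2) (ζ : ℝ) :
    fourierMul (𝓕⁻ a) (𝓕⁻ b) ζ = ∫ z, a (ζ - z) * b z := by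
  have hR : ∀ a b : L2, fourierMul
      (Lp.compMeasurePreservingₗᵢ ℂ _ (measurePreserving_const_sub ζ) a) b 0
        = ∫ z, a (ζ - z) * b z := fun a b => by
    rw [fourierMul_apply, Real.fourier_eq]
    refine integral_congr_ae ?_
    filter_upwards [Lp.coeFn_compMeasurePreserving a (measurePreserving_const_sub ζ)] with z hz
    have hz' : (Lp.compMeasurePreservingₗᵢ ℂ _ (measurePreserving_const_sub ζ) a : ℝ → ℂ) z
      = a (ζ - z) := hz
    rw [hz']
    simp
  rw [← hR]
  -- both sides are continuous in `(a, b)`, and for Schwartz functions the convolution theorem holds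
  have hcont : ∀ (A : L2 →L[ℂ] L2) (B : L2 →L[ℂ] L2) (x : ℝ),
      Continuous fun q : L2 × L2 => fourierMul (A q.1) (B q.2) x := fun A B x => by
    have h1 : Continuous fun q : L2 × L2 => fourierMul (A q.1) (B q.2) := by fun_prop
    exact (BoundedContinuousFunction.lipschitz_eval_const x).continuous.comp h1
  refine DenseRange.induction_on₂ (p := fun a b => fourierMul (𝓕⁻ a) (𝓕⁻ b) ζ = fourierMul
      (Lp.compMeasurePreservingₗᵢ ℂ _ (measurePreserving_const_sub ζ) a) b 0)
    (SchwartzMap.denseRange_toLpCLM (E := ℝ) (F := ℂ) (p := 2) (μ := volume) (by norm_num))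
    (isClosed_eq ?_ ?_) ?_ a b
  · exact hcont (FourierTransform.fourierInvCLM ℂ L2) (FourierTransform.fourierInvCLM ℂ L2) ζ
  · exact hcont (Lp.compMeasurePreservingₗᵢ ℂ _
      (measurePreserving_const_sub ζ)).toContinuousLinearMap (ContinuousLinearMap.id ℂ L2) 0
  · intro f g
    rw [hR, SchwartzMap.toLpCLM_apply, SchwartzMap.toLpCLM_apply, SchwartzMap.toLp_fourierInv_eq,
      SchwartzMap.toLp_fourierInv_eq, fourierMul_apply]
    set c := SchwartzMap.convolution (ContinuousLinearMap.mul ℂ ℂ) g f with hc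
    have h1 : ∀ x, (𝓕⁻ c) x = (𝓕⁻ f) x * (𝓕⁻ g) x := fun x => by
      simp only [SchwartzMap.fourierInv_coe, Real.fourierInv_eq_fourier_neg]
      rw [← SchwartzMap.fourier_coe, hc, SchwartzMap.fourier_convolution_apply,
        Real.fourier_bilin_convolution_eq _ g.integrable f.integrable]
      exact mul_comm _ _
    have h2 : 𝓕 (fun x => ((𝓕⁻ f).toLp 2 : L2) x * ((𝓕⁻ g).toLp 2 : L2) x) ζ = 𝓕 (𝓕⁻ c) ζ := by
      rw [SchwartzMap.fourier_coe]
      refine Real.fourier_congr_ae ?_ ζ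
      filter_upwards [(𝓕⁻ f).coeFn_toLp 2, (𝓕⁻ g).coeFn_toLp 2] with x hx hy
      rw [hx, hy, h1]
    rw [h2, FourierTransform.fourier_fourierInv_eq, hc, SchwartzMap.convolution_apply]
    rw [MeasureTheory.convolution_def]
    refine integral_congr_ae ?_
    have h3 := (measurePreserving_const_sub ζ).quasiMeasurePreserving.ae_eq_comp (f.coeFn_toLp 2)
    filter_upwards [h3, g.coeFn_toLp 2] with x hx hy
    simp only [Function.comp_apply] at hx
    rw [hx, hy, ContinuousLinearMap.mul_apply', mul_comm]

theorem norm_fourierMul_fourierInv_le (a b : L2) (ζ : ℝ) :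
    ‖fourierMul (𝓕⁻ a) (𝓕⁻ b) ζ‖ ≤ ∫ z, ‖a (ζ - z)‖ * ‖b z‖ := by
  rw [fourierMul_fourierInv]
  exact (norm_integral_le_integral_norm _).trans_eq (by simp)

/-! ### The quadratic term in weighted spaces -/

/-- The symbol `i ξ` of `∂ₓ`, where `ξ = 2 π ζ`. -/
def dsym (ζ : ℝ) : ℂ := Complex.I * ((2 * Real.pi * ζ : ℝ) : ℂ)

theorem continuous_dsym : Continuous dsym := by unfold dsym; fun_prop

theorem norm_dsym (ζ : ℝ) : ‖dsym ζ‖ = |2 * Real.pi * ζ| := by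
  rw [dsym, norm_mul, Complex.norm_I, one_mul, Complex.norm_real, Real.norm_eq_abs]

theorem norm_dsym_le (ζ : ℝ) : ‖dsym ζ‖ ≤ weight 1 ζ := by
  rw [norm_dsym]; exact abs_le_weight_one ζ

theorem norm_dsym_mul_weight_le (r ζ : ℝ) :
    ‖dsym ζ * (weight (-r) ζ : ℂ)‖ ≤ weight (1 - r) ζ := by
  rw [norm_mul, norm_weight_ofReal, sub_eq_add_neg, ← weight_mul]
  exact mul_le_mul_of_nonneg_right (norm_dsym_le ζ) (weight_pos _ _).le

theorem aestronglyMeasurable_dsym_mul_weight (r : ℝ) :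
    AEStronglyMeasurable (fun ζ => dsym ζ * (weight (-r) ζ : ℂ)) volume :=
  (continuous_dsym.mul (continuous_weight_ofReal _)).aestronglyMeasurable

/-- The map `⟨ξ⟩ ^ r * (𝓕 f) ↦ ∂ₓ f`, for `f ∈ H ^ r` and `1 ≤ r`. -/
def velocity (r : ℝ) (hr : 1 ≤ r) : L2 →L[ℂ] L2 :=
  (FourierTransform.fourierInvCLM ℂ L2) ∘L mulL2 (fun ζ => dsym ζ * (weight (-r) ζ : ℂ)) 1
    (aestronglyMeasurable_dsym_mul_weight r)
    fun ζ => (norm_dsym_mul_weight_le r ζ).trans (weight_le_one (by linarith) ζ)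

theorem fourier_velocity {r : ℝ} (hr : 1 ≤ r) (v : L2) :
    (𝓕 (velocity r hr v) : L2) =ᵐ[volume] fun ζ => dsym ζ * (weight (-r) ζ : ℂ) * v ζ := by
  have h : (𝓕 (velocity r hr v) : L2) = mulL2 (fun ζ => dsym ζ * (weight (-r) ζ : ℂ)) 1
    (aestronglyMeasurable_dsym_mul_weight r)
    (fun ζ => (norm_dsym_mul_weight_le r ζ).trans (weight_le_one (by linarith) ζ)) v :=
    FourierTransform.fourier_fourierInv_eq _
  rw [h]
  exact coeFn_mulL2 _ _ v

theorem norm_velocity_le {r : ℝ} (hr : 1 ≤ r) (v : L2) : ‖velocity r hr v‖ ≤ ‖v‖ := by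
  rw [← Lp.norm_fourier_eq]
  refine Lp.norm_le_norm_of_ae_le ?_
  filter_upwards [fourier_velocity hr v] with ζ hζ
  rw [hζ, norm_mul]
  refine mul_le_of_le_one_left (norm_nonneg _) ?_
  exact (norm_dsym_mul_weight_le r ζ).trans (weight_le_one (by linarith) ζ)

theorem integral_norm_convolution_le (f g : L2) (ζ : ℝ) :
    Integrable (fun z => ‖f (ζ - z)‖ * ‖g z‖) volume ∧
      ∫ z, ‖f (ζ - z)‖ * ‖g z‖ ≤ ‖f‖ * ‖g‖ := by
  set R := Lp.compMeasurePreservingₗᵢ ℂ _ (measurePreserving_const_sub ζ) f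
  have hR : R =ᵐ[volume] fun z => f (ζ - z) :=
    Lp.coeFn_compMeasurePreserving f (measurePreserving_const_sub ζ)
  have hRn : ‖R‖ = ‖f‖ := (Lp.compMeasurePreservingₗᵢ ℂ _ (measurePreserving_const_sub ζ)).norm_map f
  have h0 : (fun z => R z * g z) =ᵐ[volume]
      (ContinuousLinearMap.mul ℂ ℂ).holder 1 R g :=
    (ContinuousLinearMap.coeFn_holder (ContinuousLinearMap.mul ℂ ℂ) R g).symm
  have h1 : (fun z => ‖R z * g z‖) =ᵐ[volume] fun z => ‖f (ζ - z)‖ * ‖g z‖ := by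
    filter_upwards [hR] with z hz
    rw [norm_mul, hz]
  refine ⟨(integrable_mul_L2 R g).norm.congr h1, ?_⟩
  have h2 := ContinuousLinearMap.norm_holder_apply_apply_le (r := 1)
    (ContinuousLinearMap.mul ℂ ℂ) R g
  rw [ContinuousLinearMap.opNorm_mul, one_mul, hRn, L1.norm_eq_integral_norm] at h2
  refine le_trans (le_of_eq ?_) h2
  refine integral_congr_ae ?_
  filter_upwards [h0, h1] with z hz hz'
  rw [← hz, hz']

/-- The product estimate: the weight `⟨ξ⟩ ^ (r - 1)` is submultiplicative up to a constant, hence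
is distributed on the two factors of the convolution of the Fourier transforms. -/
theorem norm_weight_mul_fourierMul_le {r : ℝ} (hr : 1 ≤ r) (f g : L2) (ζ : ℝ) :
    weight (r - 1) ζ * ‖fourierMul (velocity r hr f) (velocity r hr g) ζ‖
      ≤ 2 ^ ((r - 1) / 2) * ‖f‖ * ‖g‖ := by
  obtain ⟨hint, hle⟩ := integral_norm_convolution_le f g ζ
  have h1 := norm_fourierMul_fourierInv_le (𝓕 (velocity r hr f)) (𝓕 (velocity r hr g)) ζ
  rw [FourierTransform.fourierInv_fourier_eq, FourierTransform.fourierInv_fourier_eq] at h1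
  calc _ ≤ weight (r - 1) ζ * ∫ z, ‖(𝓕 (velocity r hr f) : L2) (ζ - z)‖ *
          ‖(𝓕 (velocity r hr g) : L2) z‖ :=
        mul_le_mul_of_nonneg_left h1 (weight_pos _ _).le
    _ = ∫ z, weight (r - 1) ζ * (‖(𝓕 (velocity r hr f) : L2) (ζ - z)‖ *
          ‖(𝓕 (velocity r hr g) : L2) z‖) :=
        (integral_const_mul _ _).symm
    _ ≤ ∫ z, 2 ^ ((r - 1) / 2) * (‖f (ζ - z)‖ * ‖g z‖) := by
        refine integral_mono_ae
          ((integral_norm_convolution_le _ _ ζ).1.const_mul _) (hint.const_mul _) ?_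
        have hf := (measurePreserving_const_sub ζ).quasiMeasurePreserving.ae_eq_comp
          (fourier_velocity hr f)
        filter_upwards [hf, fourier_velocity hr g] with z hz hz'
        simp only [Function.comp_apply] at hz
        rw [hz, hz', norm_mul _ (f (ζ - z)), norm_mul _ (g z)]
        have ha := norm_dsym_mul_weight_le r (ζ - z)
        have hb := norm_dsym_mul_weight_le r z
        calc weight (r - 1) ζ * (‖dsym (ζ - z) * (weight (-r) (ζ - z) : ℂ)‖ * ‖f (ζ - z)‖ *
              (‖dsym z * (weight (-r) z : ℂ)‖ * ‖g z‖))
            ≤ (2 ^ ((r - 1) / 2) * (weight (r - 1) (ζ - z) * weight (r - 1) z)) *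
              (weight (1 - r) (ζ - z) * ‖f (ζ - z)‖ * (weight (1 - r) z * ‖g z‖)) := by
              refine mul_le_mul (weight_sub_mul (by linarith) ζ z) ?_ (by positivity) ?_
              · gcongr
                exact mul_nonneg (weight_pos _ _).le (norm_nonneg _)
              · exact mul_nonneg (by positivity)
                  (mul_nonneg (weight_pos _ _).le (weight_pos _ _).le)
          _ = 2 ^ ((r - 1) / 2) * ((weight (r - 1) (ζ - z) * weight (-(r - 1)) (ζ - z)) *
              (weight (r - 1) z * weight (-(r - 1)) z)) * (‖f (ζ - z)‖ * ‖g z‖) := by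
              rw [neg_sub]; ring
          _ = 2 ^ ((r - 1) / 2) * (‖f (ζ - z)‖ * ‖g z‖) := by
              rw [weight_mul_neg, weight_mul_neg]; ring
    _ ≤ 2 ^ ((r - 1) / 2) * ‖f‖ * ‖g‖ := by
        rw [integral_const_mul, mul_assoc]
        gcongr

/-- The bounded continuous function `⟨ξ⟩ ^ (r - 1) * 𝓕 (∂ₓ F * ∂ₓ G)`, where
`f = ⟨ξ⟩ ^ r * (𝓕 F)` and `g = ⟨ξ⟩ ^ r * (𝓕 G)`. -/
def weightedMulFun (r : ℝ) (hr : 1 ≤ r) (f g : L2) : BoundedContinuousFunction ℝ ℂ :=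
  BoundedContinuousFunction.ofNormedAddCommGroup
    (fun ζ => (weight (r - 1) ζ : ℂ) * fourierMul (velocity r hr f) (velocity r hr g) ζ)
    ((continuous_weight_ofReal _).mul (BoundedContinuousFunction.continuous _))
    (2 ^ ((r - 1) / 2) * ‖f‖ * ‖g‖) fun ζ => by
      rw [norm_mul, norm_weight_ofReal]
      exact norm_weight_mul_fourierMul_le hr f g ζ

theorem weightedMulFun_apply {r : ℝ} (hr : 1 ≤ r) (f g : L2) (ζ : ℝ) :
    weightedMulFun r hr f g ζ
      = (weight (r - 1) ζ : ℂ) * fourierMul (velocity r hr f) (velocity r hr g) ζ := rfl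

/-- The bounded bilinear map
`(⟨ξ⟩ ^ r * (𝓕 F), ⟨ξ⟩ ^ r * (𝓕 G)) ↦ ⟨ξ⟩ ^ (r - 1) * 𝓕 (∂ₓ F * ∂ₓ G)`, for `1 ≤ r`. -/
def weightedMul (r : ℝ) (hr : 1 ≤ r) : L2 →L[ℂ] L2 →L[ℂ] BoundedContinuousFunction ℝ ℂ :=
  LinearMap.mkContinuous₂
    (LinearMap.mk₂ ℂ (weightedMulFun r hr)
      (fun f f' g => by ext ζ; simp [weightedMulFun_apply, mul_add])
      (fun c f g => by ext ζ; simp [weightedMulFun_apply]; ring)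
      (fun f g g' => by ext ζ; simp [weightedMulFun_apply, mul_add])
      (fun c f g => by ext ζ; simp [weightedMulFun_apply]; ring))
    (2 ^ ((r - 1) / 2)) fun f g =>
      (BoundedContinuousFunction.norm_le (by positivity)).2 fun ζ => by
        rw [LinearMap.mk₂_apply, weightedMulFun_apply, norm_mul, norm_weight_ofReal]
        exact norm_weight_mul_fourierMul_le hr f g ζ

theorem weightedMul_apply {r : ℝ} (hr : 1 ≤ r) (f g : L2) (ζ : ℝ) :
    weightedMul r hr f g ζ
      = (weight (r - 1) ζ : ℂ) * fourierMul (velocity r hr f) (velocity r hr g) ζ := rfl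

theorem norm_weightedMul_le {r : ℝ} (hr : 1 ≤ r) (f g : L2) :
    ‖weightedMul r hr f g‖ ≤ 2 ^ ((r - 1) / 2) * ‖f‖ * ‖g‖ :=
  (BoundedContinuousFunction.norm_le (by positivity)).2 fun ζ => by
    rw [weightedMul_apply, norm_mul, norm_weight_ofReal]
    exact norm_weight_mul_fourierMul_le hr f g ζ

theorem fourierMul_eq_weightedMul {r : ℝ} (hr : 1 ≤ r) (f g : L2) (ζ : ℝ) :
    fourierMul (velocity r hr f) (velocity r hr g) ζ
      = (weight (1 - r) ζ : ℂ) * weightedMul r hr f g ζ := by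
  rw [weightedMul_apply, ← mul_assoc, ← Complex.ofReal_mul, weight_mul]
  simp [weight_zero]

/-! ### Sobolev spaces and distributions on the Fourier side -/

theorem smulLeftCLM_weight_smulLeftCLM_weight {r s : ℝ} (h : r + s = 0) (f : 𝓢'(ℝ, ℂ)) :
    TemperedDistribution.smulLeftCLM ℂ (fun ζ : ℝ => (weight r ζ : ℂ))
      (TemperedDistribution.smulLeftCLM ℂ (fun ζ : ℝ => (weight s ζ : ℂ)) f) = f := by
  rw [TemperedDistribution.smulLeftCLM_smulLeftCLM_apply
      (weight_hasTemperateGrowth _) (weight_hasTemperateGrowth _)]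
  have h2 : ((fun ζ : ℝ => (weight s ζ : ℂ)) * fun ζ : ℝ => (weight r ζ : ℂ))
      = fun _ => (1 : ℂ) := by
    ext ζ
    rw [Pi.mul_apply, ← Complex.ofReal_mul, weight_mul, add_comm, h, weight_zero,
      Complex.ofReal_one]
  simp [h2]

theorem Sobolev.toL2_surjective (s : ℝ) : Function.Surjective (Sobolev.toL2 (s := s)) := by
  intro g
  set f : 𝓢'(ℝ, ℂ) := 𝓕⁻ (TemperedDistribution.smulLeftCLM ℂ
    (fun ζ : ℝ => (weight (-s) ζ : ℂ)) (g : 𝓢'(ℝ, ℂ))) with hf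
  have h : weightedFourier s f = (g : 𝓢'(ℝ, ℂ)) := by
    rw [weightedFourier, hf, FourierTransform.fourier_fourierInv_eq,
      smulLeftCLM_weight_smulLeftCLM_weight (by ring)]
  let F : Sobolev s := ⟨f, g, h⟩
  exact ⟨F, toTemperedDistribution_injective ((Sobolev.toL2_spec F).symm.trans h)⟩

/-- The isometry `f ↦ ⟨ξ⟩ ^ s * (𝓕 f)` of `H ^ s` with `L ^ 2`. -/
def Sobolev.equivL2 (s : ℝ) : Sobolev s ≃ₗᵢ[ℂ] L2 :=
  LinearIsometryEquiv.ofSurjective ⟨Sobolev.toL2, fun _ => rfl⟩ (Sobolev.toL2_surjective s)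

theorem Sobolev.toL2_equivL2_symm {s : ℝ} (g : L2) :
    Sobolev.toL2 ((Sobolev.equivL2 s).symm g) = g :=
  (Sobolev.equivL2 s).apply_symm_apply g

theorem Sobolev.continuous_toL2 {s : ℝ} : Continuous (Sobolev.toL2 (s := s)) :=
  (Sobolev.equivL2 s).continuous

theorem exists_bound_weight_mul_schwartz (M : ℝ) (ψ : 𝓢(ℝ, ℂ)) :
    ∃ C, ∀ ζ, ‖(weight M ζ : ℂ) * ψ ζ‖ ≤ C := by
  refine ⟨‖(SchwartzMap.smulLeftCLM ℂ (fun ζ : ℝ => (weight M ζ : ℂ))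
    ψ).toBoundedContinuousFunction‖, fun ζ => ?_⟩
  have h := BoundedContinuousFunction.norm_coe_le_norm ((SchwartzMap.smulLeftCLM ℂ
    (fun ζ : ℝ => (weight M ζ : ℂ)) ψ).toBoundedContinuousFunction) ζ
  rwa [SchwartzMap.toBoundedContinuousFunction_apply,
    SchwartzMap.smulLeftCLM_apply_apply (weight_hasTemperateGrowth M), smul_eq_mul] at h

/-- The function `g` is integrable with respect to some weight `⟨ξ⟩ ^ (-M)`, so that it is a
tempered distribution. -/
def TemperedIntegrable (g : ℝ → ℂ) : Prop :=
  ∃ M : ℝ, Integrable (fun ζ => (weight (-M) ζ : ℂ) * g ζ) volume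

theorem TemperedIntegrable.integrable_mul_schwartz {g : ℝ → ℂ} (hg : TemperedIntegrable g)
    (ψ : 𝓢(ℝ, ℂ)) : Integrable (fun ζ => g ζ * ψ ζ) volume := by
  obtain ⟨M, hM⟩ := hg
  obtain ⟨C, hC⟩ := exists_bound_weight_mul_schwartz M ψ
  refine (hM.mul_bdd (c := C) (((continuous_weight_ofReal M).mul
    ψ.continuous).aestronglyMeasurable) (Eventually.of_forall hC)).congr
    (Eventually.of_forall fun ζ => ?_)
  have h : (weight M ζ : ℂ) * (weight (-M) ζ : ℂ) = 1 := by
    exact_mod_cast weight_mul_neg M ζ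
  show (weight (-M) ζ : ℂ) * g ζ * ((weight M ζ : ℂ) * ψ ζ) = g ζ * ψ ζ
  linear_combination (g ζ * ψ ζ) * h

theorem TemperedIntegrable.mono_weight {g : ℝ → ℂ} {M M' : ℝ} (h : M ≤ M')
    (hM : Integrable (fun ζ => (weight (-M) ζ : ℂ) * g ζ) volume) :
    Integrable (fun ζ => (weight (-M') ζ : ℂ) * g ζ) volume := by
  refine (hM.bdd_mul (c := 1) (continuous_weight_ofReal (M - M')).aestronglyMeasurable
    (Eventually.of_forall fun ζ => ?_)).congr (Eventually.of_forall fun ζ => ?_)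
  · rw [norm_weight_ofReal]
    exact weight_le_one (by linarith) ζ
  · show (weight (M - M') ζ : ℂ) * ((weight (-M) ζ : ℂ) * g ζ) = _
    rw [← mul_assoc, ← Complex.ofReal_mul, weight_mul]
    ring_nf

theorem TemperedIntegrable.sub {f g : ℝ → ℂ} (hf : TemperedIntegrable f)
    (hg : TemperedIntegrable g) : TemperedIntegrable fun ζ => f ζ - g ζ := by
  obtain ⟨M, hM⟩ := hf
  obtain ⟨M', hM'⟩ := hg
  refine ⟨max M M', ((TemperedIntegrable.mono_weight (le_max_left M M') hM).sub
    (TemperedIntegrable.mono_weight (le_max_right M M') hM')).congr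
    (Eventually.of_forall fun ζ => ?_)⟩
  simp [mul_sub]

/-- A function dominated by a power of the weight times an `L ^ 2` function. -/
theorem TemperedIntegrable.of_norm_le {g : ℝ → ℂ} {C M : ℝ} (f : L2)
    (hg : AEStronglyMeasurable g volume) (h : ∀ᵐ ζ, ‖g ζ‖ ≤ C * (weight M ζ * ‖f ζ‖)) :
    TemperedIntegrable g := by
  refine ⟨M + 1, Integrable.mono' (g := fun ζ => C * (weight (-1) ζ * ‖f ζ‖)) ?_
    ((continuous_weight_ofReal _).aestronglyMeasurable.mul hg) ?_⟩
  · refine Integrable.const_mul ?_ C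
    exact (memLp_weight (by norm_num)).integrable_mul (Lp.memLp f).norm
  · filter_upwards [h] with ζ hζ
    rw [norm_mul, norm_weight_ofReal]
    refine (mul_le_mul_of_nonneg_left hζ (weight_pos _ _).le).trans_eq ?_
    have : weight (-(M + 1)) ζ * weight M ζ = weight (-1) ζ := by
      rw [weight_mul]; ring_nf
    rw [← this]
    ring

theorem temperedIntegrable_of_bounded {g : ℝ → ℂ} {C : ℝ}
    (hg : AEStronglyMeasurable g volume) (h : ∀ ζ, ‖g ζ‖ ≤ C) : TemperedIntegrable g := by
  refine ⟨2, ((integrable_weight (r := -2) (by norm_num)).ofReal (𝕜 := ℂ)).mul_bdd (c := C) hg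
    (Eventually.of_forall h)⟩

theorem TemperedIntegrable.ae_eq_zero {g : ℝ → ℂ} (hg : TemperedIntegrable g)
    (h : ∀ ψ : 𝓢(ℝ, ℂ), ∫ ζ, g ζ * ψ ζ = 0) : g =ᵐ[volume] 0 := by
  have hloc : LocallyIntegrable g volume := by
    obtain ⟨M, hM⟩ := hg
    refine (locallyIntegrableOn_univ.1 (hM.locallyIntegrable.locallyIntegrableOn
      univ |>.continuousOn_mul (continuous_weight_ofReal M).continuousOn
      isOpen_univ.isLocallyClosed)).congr ?_
    refine Eventually.of_forall fun ζ => ?_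
    show (weight M ζ : ℂ) * ((weight (-M) ζ : ℂ) * g ζ) = g ζ
    rw [← mul_assoc, ← Complex.ofReal_mul, weight_mul_neg, Complex.ofReal_one, one_mul]
  refine ae_eq_zero_of_integral_contDiff_smul_eq_zero hloc fun χ hχ hχc => ?_
  have hc : HasCompactSupport fun x => (χ x : ℂ) := hχc.comp_left (g := ((↑) : ℝ → ℂ)) (by simp)
  have hs : ContDiff ℝ ∞ fun x => (χ x : ℂ) := Complex.ofRealCLM.contDiff.comp hχ
  have := h (hc.toSchwartzMap hs)
  rw [← this]
  refine integral_congr_ae (Eventually.of_forall fun ζ => ?_)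
  show χ ζ • g ζ = g ζ * (χ ζ : ℂ)
  rw [Complex.real_smul, mul_comm]

theorem fourierInv_derivCLM (φ : 𝓢(ℝ, ℂ)) (ζ : ℝ) :
    (𝓕⁻ (SchwartzMap.derivCLM ℂ ℂ φ)) ζ = -(dsym ζ * (𝓕⁻ φ) ζ) := by
  have h1 : SchwartzMap.derivCLM ℂ ℂ φ = LineDeriv.lineDerivOp (1 : ℝ) φ := by
    ext x
    rw [SchwartzMap.derivCLM_apply, SchwartzMap.lineDerivOp_apply,
      φ.differentiableAt.lineDeriv_eq_fderiv, fderiv_apply_one_eq_deriv]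
  rw [h1, SchwartzMap.fourierInv_lineDerivOp_eq, smul_apply,
    SchwartzMap.smulLeftCLM_apply_apply (by fun_prop), dsym]
  simp
  ring

/-- The distribution `f`, as the integral of its Fourier transform. -/
theorem Sobolev.toDistr_apply {s : ℝ} (f : Sobolev s) (φ : 𝓢(ℝ, ℂ)) :
    f.toDistr φ = ∫ ζ, f.fourierFun ζ * (𝓕⁻ φ) ζ := by
  have h1 : 𝓕 f.toDistr = TemperedDistribution.smulLeftCLM ℂ
      (fun ζ : ℝ => (weight (-s) ζ : ℂ)) (f.toL2 : 𝓢'(ℝ, ℂ)) := by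
    rw [← Sobolev.toL2_spec, weightedFourier, smulLeftCLM_weight_smulLeftCLM_weight (by ring)]
  have h2 : f.toDistr φ = (𝓕 f.toDistr) (𝓕⁻ φ) := by
    rw [TemperedDistribution.fourier_apply, FourierTransform.fourier_fourierInv_eq]
  rw [h2, h1, TemperedDistribution.smulLeftCLM_apply_apply, Lp.toTemperedDistribution_apply]
  refine integral_congr_ae (Eventually.of_forall fun ζ => ?_)
  show (SchwartzMap.smulLeftCLM ℂ (fun ζ : ℝ => (weight (-s) ζ : ℂ)) (𝓕⁻ φ)) ζ • f.toL2 ζ = _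
  rw [SchwartzMap.smulLeftCLM_apply_apply (weight_hasTemperateGrowth _), smul_eq_mul, smul_eq_mul]
  show _ = (weight (-s) ζ : ℂ) * f.toL2 ζ * (𝓕⁻ φ) ζ
  ring

theorem L2.toDistr_apply (w : L2) (φ : 𝓢(ℝ, ℂ)) :
    (w : 𝓢'(ℝ, ℂ)) φ = ∫ ζ, (𝓕 w : L2) ζ * (𝓕⁻ φ) ζ := by
  have h2 : (w : 𝓢'(ℝ, ℂ)) φ = (𝓕 (w : 𝓢'(ℝ, ℂ))) (𝓕⁻ φ) := by
    rw [TemperedDistribution.fourier_apply, FourierTransform.fourier_fourierInv_eq]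
  rw [h2, Lp.fourier_toTemperedDistribution_eq, Lp.toTemperedDistribution_apply]
  refine integral_congr_ae (Eventually.of_forall fun ζ => ?_)
  exact mul_comm _ _

theorem dx_apply {s : ℝ} (f : Sobolev s) (φ : 𝓢(ℝ, ℂ)) :
    dx f φ = ∫ ζ, dsym ζ * f.fourierFun ζ * (𝓕⁻ φ) ζ := by
  show f.toDistr (-SchwartzMap.derivCLM ℂ ℂ φ) = _
  rw [map_neg, Sobolev.toDistr_apply, ← integral_neg]
  refine integral_congr_ae (Eventually.of_forall fun ζ => ?_)
  simp only [fourierInv_derivCLM]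
  ring

theorem dxxx_apply {s : ℝ} (f : Sobolev s) (φ : 𝓢(ℝ, ℂ)) :
    TemperedDistribution.derivCLM ℂ (TemperedDistribution.derivCLM ℂ (dx f)) φ
      = ∫ ζ, dsym ζ ^ 3 * f.fourierFun ζ * (𝓕⁻ φ) ζ := by
  rw [TemperedDistribution.derivCLM_apply_apply, TemperedDistribution.derivCLM_apply_apply,
    map_neg, map_neg, map_neg, neg_neg, dx_apply]
  refine integral_congr_ae (Eventually.of_forall fun ζ => ?_)
  simp only [fourierInv_derivCLM]
  ring

theorem Sobolev.aestronglyMeasurable_fourierFun {s : ℝ} (f : Sobolev s) :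
    AEStronglyMeasurable f.fourierFun volume :=
  (continuous_weight_ofReal _).aestronglyMeasurable.mul (Lp.aestronglyMeasurable _)

theorem Sobolev.norm_fourierFun {s : ℝ} (f : Sobolev s) (ζ : ℝ) :
    ‖f.fourierFun ζ‖ = weight (-s) ζ * ‖f.toL2 ζ‖ := by
  rw [Sobolev.fourierFun, norm_mul, norm_weight_ofReal]

/-- The derivative of `f ∈ H ^ s` is the `L ^ 2` function `w` if and only if the Fourier transform
of `w` is `i ξ * (𝓕 f)`. -/
theorem dx_eq_iff {s : ℝ} (f : Sobolev s) (w : L2) :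
    dx f = (w : 𝓢'(ℝ, ℂ)) ↔ (𝓕 w : L2) =ᵐ[volume] fun ζ => dsym ζ * f.fourierFun ζ := by
  have hT : TemperedIntegrable fun ζ => dsym ζ * f.fourierFun ζ :=
    TemperedIntegrable.of_norm_le (C := 1) (M := 1 - s) f.toL2
      (continuous_dsym.aestronglyMeasurable.mul f.aestronglyMeasurable_fourierFun)
      (Eventually.of_forall fun ζ => by
        rw [norm_mul, Sobolev.norm_fourierFun, one_mul, sub_eq_add_neg, ← weight_mul, mul_assoc]
        exact mul_le_mul_of_nonneg_right (norm_dsym_le ζ) (by have := weight_pos (-s) ζ; positivity))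
  have hw : TemperedIntegrable (𝓕 w : L2) :=
    TemperedIntegrable.of_norm_le (C := 1) (M := 0) (𝓕 w : L2)
      (Lp.aestronglyMeasurable _) (Eventually.of_forall fun ζ => by rw [weight_zero]; simp)
  constructor
  · intro h
    have h0 := (hw.sub hT).ae_eq_zero fun ψ => by
      have h1 := dx_apply f (𝓕 ψ)
      rw [h, L2.toDistr_apply, FourierTransform.fourierInv_fourier_eq] at h1
      simp only [sub_mul]
      rw [integral_sub (hw.integrable_mul_schwartz ψ) (hT.integrable_mul_schwartz ψ), h1, sub_self]
    filter_upwards [h0] with ζ hζ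
    exact sub_eq_zero.1 hζ
  · intro h
    ext φ
    rw [dx_apply, L2.toDistr_apply]
    refine integral_congr_ae ?_
    filter_upwards [h] with ζ hζ
    rw [hζ]

/-! ### The dissipative semigroup -/

/-- The Fourier symbol of `-∂ₓ ^ 3 - η L`. -/
def evolutionSymbol (η : ℝ) (Φ : ℝ → ℝ) (ζ : ℝ) : ℂ :=
  -dsym ζ ^ 3 + ((η * Φ (2 * Real.pi * ζ) : ℝ) : ℂ)

/-- The symbol `m` has order `p`, and for `0 < t ≤ 1` the semigroup with symbol `exp (t * m)` gains
any number `κ * p ≤ p` of derivatives, at the price of a factor `t ^ (-κ)`. -/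
structure IsDissipative (m : ℝ → ℂ) (p K : ℝ) : Prop where
  measurable : Measurable m
  one_le : 1 ≤ K
  norm_exp_le : ∀ t ∈ Ioc (0 : ℝ) 1, ∀ κ ∈ Icc (0 : ℝ) 1, ∀ ζ,
    ‖Complex.exp (t * m ζ)‖ ≤ K * t ^ (-κ) * weight (-(κ * p)) ζ
  norm_le : ∀ ζ, ‖m ζ‖ ≤ K * weight p ζ

theorem evolutionSymbol_re (η : ℝ) (Φ : ℝ → ℝ) (ζ : ℝ) :
    (evolutionSymbol η Φ ζ).re = η * Φ (2 * Real.pi * ζ) := by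
  have h : dsym ζ ^ 3 = -(Complex.I * (((2 * Real.pi * ζ) ^ 3 : ℝ) : ℂ)) := by
    rw [dsym, mul_pow, Complex.I_pow_three]
    push_cast
    ring
  rw [evolutionSymbol, h, neg_neg, Complex.add_re, Complex.ofReal_re, Complex.re_mul_ofReal,
    Complex.I_re]
  ring

theorem mul_rpow_le_half_rpow_add {C p q : ℝ} (hC : 0 ≤ C) (hq : 0 ≤ q) (hqp : q < p) :
    ∃ A, 0 ≤ A ∧ ∀ X : ℝ, 0 ≤ X → C * X ^ q ≤ X ^ p / 2 + A := by
  set X₀ := (2 * C + 1) ^ (1 / (p - q)) with hX₀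
  have hX₀0 : 0 < X₀ := by positivity
  refine ⟨C * X₀ ^ q, by positivity, fun X hX => ?_⟩
  rcases le_total X X₀ with h | h
  · have : C * X ^ q ≤ C * X₀ ^ q := by gcongr
    have h2 : 0 ≤ X ^ p := Real.rpow_nonneg hX p
    linarith
  · have hX0 : 0 < X := hX₀0.trans_le h
    have h1 : 2 * C + 1 ≤ X ^ (p - q) := by
      calc 2 * C + 1 = X₀ ^ (p - q) := by
            rw [hX₀, ← Real.rpow_mul (by positivity), one_div_mul_cancel (by linarith),
              Real.rpow_one]
        _ ≤ _ := Real.rpow_le_rpow hX₀0.le h (by linarith)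
    have h2 : X ^ p = X ^ q * X ^ (p - q) := by
      rw [← Real.rpow_add hX0]; ring_nf
    have h3 : 0 ≤ X ^ q := Real.rpow_nonneg hX q
    have h4 : 0 ≤ C * X₀ ^ q := by positivity
    rw [h2]
    nlinarith

theorem weight_le_one_add_rpow {p : ℝ} (hp : 0 ≤ p) (ζ : ℝ) :
    weight p ζ ≤ 2 ^ (p / 2) * (1 + |2 * Real.pi * ζ| ^ p) := by
  set X := |2 * Real.pi * ζ| with hX
  have hX0 : 0 ≤ X := abs_nonneg _
  have h1 : weight p ζ ≤ (2 * (max 1 X) ^ 2) ^ (p / 2) := by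
    rw [weight, Real.norm_eq_abs, ← hX]
    refine Real.rpow_le_rpow (by positivity) ?_ (by positivity)
    have := le_max_left 1 X
    have := le_max_right 1 X
    nlinarith
  have h2 : ((max 1 X) ^ 2) ^ (p / 2) = (max 1 X) ^ p := by
    rw [← Real.rpow_natCast, ← Real.rpow_mul (by positivity)]
    congr 1
    push_cast
    ring
  rw [Real.mul_rpow (by positivity) (by positivity), h2] at h1
  refine h1.trans ?_
  gcongr
  rcases max_choice 1 X with h | h <;> rw [h]
  · rw [Real.one_rpow]
    linarith [Real.rpow_nonneg hX0 p]
  · linarith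

theorem exp_neg_le_rpow {c x κ : ℝ} (hc : 0 < c) (hx : 0 < x) (hκ : κ ∈ Icc (0 : ℝ) 1) :
    Real.exp (-(c * x)) ≤ (1 + 1 / c) * x ^ (-κ) := by
  have h1 : x ^ κ ≤ 1 + x := by
    rcases le_total x 1 with h | h
    · linarith [Real.rpow_le_one hx.le h hκ.1]
    · have := Real.rpow_le_rpow_of_exponent_le h hκ.2
      rw [Real.rpow_one] at this
      linarith
  have h2 : 1 + x ≤ (1 + 1 / c) * Real.exp (c * x) := by
    have h3 := Real.add_one_le_exp (c * x)
    have h4 : x ≤ 1 / c * Real.exp (c * x) := by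
      rw [one_div, ← div_eq_inv_mul, le_div_iff₀ hc]
      linarith
    have h5 : 0 < c * x := by positivity
    nlinarith
  rw [Real.exp_neg, Real.rpow_neg hx.le, ← div_eq_mul_inv, le_div_iff₀ (by positivity),
    ← div_eq_inv_mul, div_le_iff₀ (Real.exp_pos _)]
  exact h1.trans h2

/-- The real part `η Φ(ξ)` of the symbol is at most `B - c ⟨ξ⟩ ^ p`, since the lower order term `Φ₁`
is absorbed by half of `|ξ| ^ p`; the dispersive term `i ξ ^ 3` is imaginary, and `3 < p`. -/
theorem exists_isDissipative {η p q C : ℝ} {Φ Φ₁ : ℝ → ℝ} (hη : 0 < η) (hp : 3 < p)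
    (hq : 0 ≤ q) (hqp : q < p) (hΦ₁_meas : Measurable Φ₁)
    (hΦ₁ : ∀ ξ : ℝ, |Φ₁ ξ| ≤ C * (1 + |ξ| ^ q)) (hΦ : ∀ ξ : ℝ, Φ ξ = -|ξ| ^ p + Φ₁ ξ) :
    ∃ K, IsDissipative (evolutionSymbol η Φ) p K := by
  have hC : 0 ≤ C := by
    have h := (abs_nonneg _).trans (hΦ₁ 0)
    have h2 : (0 : ℝ) < 1 + |0| ^ q := by positivity
    exact nonneg_of_mul_nonneg_left h h2
  obtain ⟨A, hA0, hA⟩ := mul_rpow_le_half_rpow_add hC hq hqp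
  set c : ℝ := η * (2 ^ (p / 2))⁻¹ / 2 with hc
  have hc0 : 0 < c := by positivity
  set B : ℝ := η * (1 / 2 + A + C) with hB
  have hB0 : 0 ≤ B := by positivity
  have hre : ∀ ζ, (evolutionSymbol η Φ ζ).re ≤ B - c * weight p ζ := fun ζ => by
    rw [evolutionSymbol_re, hΦ]
    set X := |2 * Real.pi * ζ|
    have h1 := (le_abs_self _).trans (hΦ₁ (2 * Real.pi * ζ))
    have h2 := hA X (abs_nonneg _)
    have h3 : (2 ^ (p / 2))⁻¹ * weight p ζ ≤ 1 + X ^ p := by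
      rw [inv_mul_le_iff₀ (by positivity)]
      exact weight_le_one_add_rpow (by linarith) ζ
    calc η * (-X ^ p + Φ₁ (2 * Real.pi * ζ))
        ≤ η * (1 / 2 + A + C - (2 ^ (p / 2))⁻¹ * weight p ζ / 2) := by gcongr; linarith
      _ = B - c * weight p ζ := by rw [hB, hc]; ring
  have hdsym : ∀ ζ, ‖dsym ζ ^ 3‖ ≤ weight p ζ := fun ζ => by
    rw [norm_pow]
    calc ‖dsym ζ‖ ^ 3 ≤ weight 1 ζ ^ 3 := pow_le_pow_left₀ (norm_nonneg _) (norm_dsym_le ζ) 3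
      _ = weight 3 ζ := by
        rw [← Real.rpow_natCast, weight_rpow]; norm_num
      _ ≤ _ := weight_le_weight hp.le ζ
  have hrpow : ∀ r : ℝ, 0 ≤ r → ∀ ζ, |2 * Real.pi * ζ| ^ r ≤ weight r ζ := fun r hr ζ => by
    have := Real.rpow_le_rpow (abs_nonneg _) (abs_le_weight_one ζ) hr
    rwa [weight_rpow, one_mul] at this
  set K := max (Real.exp B * (1 + 1 / c)) (1 + η * (1 + 2 * C)) with hK
  have hK1 : 1 ≤ K := le_max_of_le_right (by nlinarith)
  refine ⟨K, ?_, hK1, ?_, ?_⟩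
  · have h1 : Measurable fun ξ => Φ ξ := by
      simp only [hΦ]
      fun_prop
    unfold evolutionSymbol
    have h2 := continuous_dsym.measurable
    fun_prop
  · intro t ht κ hκ ζ
    have hw := weight_pos p ζ
    rw [Complex.norm_exp, Complex.re_ofReal_mul]
    calc Real.exp (t * (evolutionSymbol η Φ ζ).re)
        ≤ Real.exp (B + -(c * (t * weight p ζ))) := by
          refine Real.exp_le_exp.2 ?_
          have h1 := mul_le_mul_of_nonneg_left (hre ζ) ht.1.le
          have h2 : t * B ≤ 1 * B := mul_le_mul_of_nonneg_right ht.2 hB0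
          linarith
      _ ≤ Real.exp B * ((1 + 1 / c) * (t * weight p ζ) ^ (-κ)) := by
          rw [Real.exp_add]
          gcongr
          exact exp_neg_le_rpow hc0 (mul_pos ht.1 hw) hκ
      _ = Real.exp B * (1 + 1 / c) * t ^ (-κ) * weight (-(κ * p)) ζ := by
          rw [Real.mul_rpow ht.1.le hw.le, weight_rpow]
          ring_nf
      _ ≤ _ := by
          have h1 := weight_pos (-(κ * p)) ζ
          have h2 := Real.rpow_nonneg ht.1.le (-κ)
          gcongr
          exact le_max_left _ _
  · intro ζ
    have hw1 : 1 ≤ weight p ζ := one_le_weight (by linarith) ζ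
    have h1 := hΦ₁ (2 * Real.pi * ζ)
    have h2 := (hrpow q hq ζ).trans (weight_le_weight hqp.le ζ)
    have h3 := hrpow p (by linarith) ζ
    have h4 : |Φ (2 * Real.pi * ζ)| ≤ (1 + 2 * C) * weight p ζ := by
      rw [hΦ]
      refine (abs_add_le _ _).trans ?_
      rw [abs_neg, abs_of_nonneg (Real.rpow_nonneg (abs_nonneg _) _)]
      nlinarith
    calc ‖evolutionSymbol η Φ ζ‖ ≤ ‖-dsym ζ ^ 3‖ + ‖((η * Φ (2 * Real.pi * ζ) : ℝ) : ℂ)‖ :=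
          norm_add_le _ _
      _ ≤ weight p ζ + η * ((1 + 2 * C) * weight p ζ) := by
          rw [norm_neg, Complex.norm_real, Real.norm_eq_abs, abs_mul, abs_of_pos hη]
          gcongr
          exact hdsym ζ
      _ = (1 + η * (1 + 2 * C)) * weight p ζ := by ring
      _ ≤ _ := by
          gcongr
          exact le_max_right _ _

theorem IsDissipative.norm_exp_le_const {m : ℝ → ℂ} {p K : ℝ} (hm : IsDissipative m p K) {t : ℝ}
    (ht : t ∈ Icc (0 : ℝ) 1) (ζ : ℝ) : ‖Complex.exp (t * m ζ)‖ ≤ K := by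
  rcases ht.1.eq_or_lt with h | h
  · rw [← h]
    simpa using hm.one_le
  · have := hm.norm_exp_le t ⟨h, ht.2⟩ 0 ⟨le_rfl, zero_le_one⟩ ζ
    simpa [weight_zero] using this

theorem IsDissipative.measurable_exp {m : ℝ → ℂ} {p K : ℝ} (hm : IsDissipative m p K) (t : ℝ) :
    Measurable fun ζ => Complex.exp (t * m ζ) := by
  have := hm.measurable
  fun_prop

/-! ### The Duhamel integral -/

/-- The Duhamel integral `∫₀ᵗ exp ((t - τ) m) n(τ) dτ`, at each frequency. -/
def duhamel (m : ℝ → ℂ) (n : ℝ → ℝ → ℂ) (t ζ : ℝ) : ℂ :=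
  ∫ τ in (0 : ℝ)..t, Complex.exp (((t - τ : ℝ) : ℂ) * m ζ) * n τ ζ

/-- A continuous forcing term on `(0, T]` of size `A * τ ^ (-γ) * ⟨ξ⟩ ^ (-r)`. -/
structure IsForcing (n : ℝ → ℝ → ℂ) (T A γ r : ℝ) : Prop where
  continuousOn : ContinuousOn (Function.uncurry n) (Ioc 0 T ×ˢ univ)
  norm_le : ∀ τ ∈ Ioc 0 T, ∀ ζ, ‖n τ ζ‖ ≤ A * τ ^ (-γ) * weight (-r) ζ

/-- The integral `∫₀¹ (1 - ρ) ^ (-κ) ρ ^ (-γ) dρ`. -/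
def betaConst (κ γ : ℝ) : ℝ := ∫ ρ in (0 : ℝ)..1, (1 - ρ) ^ (-κ) * ρ ^ (-γ)

theorem intervalIntegrable_betaConst {κ γ : ℝ} (hκ : κ < 1) (hγ : γ < 1) :
    IntervalIntegrable (fun ρ : ℝ => (1 - ρ) ^ (-κ) * ρ ^ (-γ)) volume 0 1 := by
  have h := (Complex.betaIntegral_convergent (u := ((1 - γ : ℝ) : ℂ)) (v := ((1 - κ : ℝ) : ℂ))
    (by rw [Complex.ofReal_re]; linarith) (by rw [Complex.ofReal_re]; linarith)).norm
  rw [intervalIntegrable_iff, uIoc_of_le zero_le_one, integrableOn_Ioc_iff_integrableOn_Ioo] at h ⊢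
  refine h.congr_fun (fun ρ hρ => ?_) measurableSet_Ioo
  have h1 : (0 : ℝ) < 1 - ρ := by linarith [hρ.2]
  show ‖(ρ : ℂ) ^ (((1 - γ : ℝ) : ℂ) - 1) * (1 - (ρ : ℂ)) ^ (((1 - κ : ℝ) : ℂ) - 1)‖ = _
  have h2 : (1 : ℂ) - (ρ : ℂ) = ((1 - ρ : ℝ) : ℂ) := by push_cast; ring
  rw [norm_mul, h2, Complex.norm_cpow_eq_rpow_re_of_pos hρ.1,
    Complex.norm_cpow_eq_rpow_re_of_pos h1, mul_comm]
  simp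

theorem betaConst_nonneg (κ γ : ℝ) : 0 ≤ betaConst κ γ := by
  refine intervalIntegral.integral_nonneg zero_le_one fun ρ hρ => ?_
  have h1 : (0 : ℝ) ≤ 1 - ρ := by linarith [hρ.2]
  exact mul_nonneg (Real.rpow_nonneg h1 _) (Real.rpow_nonneg hρ.1 _)

/-- The Duhamel integral after the substitution `τ = t ρ`, which has a fixed domain. -/
theorem duhamel_eq (m : ℝ → ℂ) (n : ℝ → ℝ → ℂ) (t ζ : ℝ) :
    duhamel m n t ζ
      = t * ∫ ρ in (0 : ℝ)..1, Complex.exp (((t * (1 - ρ) : ℝ) : ℂ) * m ζ) * n (t * ρ) ζ := by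
  have h := intervalIntegral.smul_integral_comp_mul_left (a := 0) (b := 1)
    (fun τ => Complex.exp (((t - τ : ℝ) : ℂ) * m ζ) * n τ ζ) t
  rw [mul_zero, mul_one] at h
  rw [duhamel, ← h, Complex.real_smul]
  congr 2
  ext ρ
  rw [mul_one_sub]

theorem duhamel_zero (m : ℝ → ℂ) (n : ℝ → ℝ → ℂ) (ζ : ℝ) : duhamel m n 0 ζ = 0 := by
  simp [duhamel]

section Bounds

variable {m : ℝ → ℂ} {p K T A γ r : ℝ} {n : ℝ → ℝ → ℂ}

theorem IsForcing.nonneg (hn : IsForcing n T A γ r) (hT : 0 < T) : 0 ≤ A := by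
  have h := (norm_nonneg _).trans (hn.norm_le T ⟨hT, le_rfl⟩ 0)
  have h1 := weight_pos (-r) 0
  have h2 := Real.rpow_pos_of_pos hT (-γ)
  rw [mul_assoc] at h
  exact nonneg_of_mul_nonneg_left h (by positivity)

theorem norm_duhamel_integrand_le (hm : IsDissipative m p K) (hn : IsForcing n T A γ r)
    (hT1 : T ≤ 1) {κ : ℝ} (hκ : κ ∈ Icc (0 : ℝ) 1) {t ρ : ℝ} (ht : t ∈ Ioc 0 T)
    (hρ : ρ ∈ Ioo (0 : ℝ) 1) (ζ : ℝ) :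
    ‖Complex.exp (((t * (1 - ρ) : ℝ) : ℂ) * m ζ) * n (t * ρ) ζ‖
      ≤ K * A * t ^ (-κ - γ) * weight (-(κ * p) - r) ζ * ((1 - ρ) ^ (-κ) * ρ ^ (-γ)) := by
  have h0 : (0 : ℝ) < 1 - ρ := by linarith [hρ.2]
  have hA := hn.nonneg (ht.1.trans_le ht.2)
  have hK : 0 ≤ K := zero_le_one.trans hm.one_le
  have h1 := hm.norm_exp_le (t * (1 - ρ)) ⟨mul_pos ht.1 h0, by nlinarith [hρ.1, ht.1, ht.2]⟩ κ hκ ζ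
  have h2 := hn.norm_le (t * ρ) ⟨mul_pos ht.1 hρ.1, by nlinarith [hρ.1, hρ.2, ht.1, ht.2]⟩ ζ
  rw [norm_mul]
  refine (mul_le_mul h1 h2 (norm_nonneg _) ?_).trans_eq ?_
  · have := weight_pos (-(κ * p)) ζ
    have := Real.rpow_pos_of_pos (mul_pos ht.1 h0) (-κ)
    positivity
  · rw [Real.mul_rpow ht.1.le h0.le, Real.mul_rpow ht.1.le hρ.1.le, sub_eq_add_neg (-κ),
      Real.rpow_add ht.1, sub_eq_add_neg (-(κ * p)), ← weight_mul]
    ring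

theorem norm_duhamel_le (hm : IsDissipative m p K) (hn : IsForcing n T A γ r)
    (hT1 : T ≤ 1) (hγ : γ < 1) {κ : ℝ} (hκ : κ ∈ Ico (0 : ℝ) 1) {t : ℝ} (ht : t ∈ Ioc 0 T) (ζ : ℝ) :
    ‖duhamel m n t ζ‖
      ≤ K * A * betaConst κ γ * t ^ (1 - κ - γ) * weight (-(κ * p) - r) ζ := by
  rw [duhamel_eq, norm_mul, Complex.norm_real, Real.norm_eq_abs, abs_of_pos ht.1]
  have h : ‖∫ ρ in (0 : ℝ)..1, Complex.exp (((t * (1 - ρ) : ℝ) : ℂ) * m ζ) * n (t * ρ) ζ‖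
      ≤ ∫ ρ in (0 : ℝ)..1, K * A * t ^ (-κ - γ) * weight (-(κ * p) - r) ζ *
        ((1 - ρ) ^ (-κ) * ρ ^ (-γ)) := by
    refine intervalIntegral.norm_integral_le_of_norm_le zero_le_one ?_
      ((intervalIntegrable_betaConst hκ.2 hγ).const_mul _)
    have h1 : ∀ᵐ ρ : ℝ, ρ ≠ 1 := by simp [ae_iff, measure_singleton]
    filter_upwards [h1] with ρ h1 hρ
    exact norm_duhamel_integrand_le hm hn hT1 ⟨hκ.1, hκ.2.le⟩ ht ⟨hρ.1, hρ.2.lt_of_ne h1⟩ ζ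
  rw [intervalIntegral.integral_const_mul] at h
  refine (mul_le_mul_of_nonneg_left h ht.1.le).trans_eq ?_
  have h2 : t ^ (1 - κ - γ) = t * t ^ (-κ - γ) := by
    nth_rw 2 [← Real.rpow_one t]
    rw [← Real.rpow_add ht.1]
    ring_nf
  rw [h2, betaConst]
  ring

theorem IsForcing.continuousOn_apply (hn : IsForcing n T A γ r) (ζ : ℝ) :
    ContinuousOn (fun τ => n τ ζ) (Ioc 0 T) :=
  hn.continuousOn.comp (f := fun τ => (τ, ζ)) (by fun_prop) fun τ hτ => ⟨hτ, mem_univ _⟩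

theorem continuousOn_duhamel (hm : IsDissipative m p K) (hn : IsForcing n T A γ r)
    (hT1 : T ≤ 1) (hγ0 : 0 ≤ γ) (hγ : γ < 1) (ζ : ℝ) :
    ContinuousOn (fun t => duhamel m n t ζ) (Ioc 0 T) := by
  intro t₀ ht₀
  simp only [duhamel_eq]
  refine ContinuousWithinAt.mul (by fun_prop) ?_
  have hA := hn.nonneg (ht₀.1.trans_le ht₀.2)
  have hK : 0 ≤ K := zero_le_one.trans hm.one_le
  have hmem : ∀ t ∈ Ioc 0 T, ∀ ρ ∈ Ioc (0 : ℝ) 1, t * ρ ∈ Ioc 0 T := fun t ht ρ hρ =>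
    ⟨mul_pos ht.1 hρ.1, by nlinarith [hρ.1, hρ.2, ht.1, ht.2]⟩
  have hev : ∀ᶠ t in 𝓝[Ioc 0 T] t₀, t ∈ Ioc 0 T ∧ t₀ / 2 ≤ t := by
    refine eventually_mem_nhdsWithin.and (eventually_nhdsWithin_of_eventually_nhds ?_)
    exact eventually_ge_nhds (half_lt_self ht₀.1)
  refine intervalIntegral.continuousWithinAt_of_dominated_interval
    (bound := fun ρ => K * A * (t₀ / 2) ^ (-γ) * weight (-r) ζ * ((1 - ρ) ^ (-(0 : ℝ)) * ρ ^ (-γ)))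
    ?_ ?_ ?_ ?_
  · filter_upwards [hev] with t ht
    rw [uIoc_of_le zero_le_one]
    refine ContinuousOn.aestronglyMeasurable ?_ measurableSet_Ioc
    refine ContinuousOn.mul (by fun_prop) ?_
    exact (hn.continuousOn_apply ζ).comp (by fun_prop) fun ρ hρ => hmem t ht.1 ρ hρ
  · filter_upwards [hev] with t ht
    have h1 : ∀ᵐ ρ : ℝ, ρ ≠ 1 := by simp [ae_iff, measure_singleton]
    filter_upwards [h1] with ρ h1 hρ
    rw [uIoc_of_le zero_le_one] at hρ
    have h2 := norm_duhamel_integrand_le hm hn hT1 (κ := 0) ⟨le_rfl, zero_le_one⟩ ht.1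
      ⟨hρ.1, hρ.2.lt_of_ne h1⟩ ζ
    refine h2.trans ?_
    have h3 : t ^ (-0 - γ) ≤ (t₀ / 2) ^ (-γ) := by
      rw [neg_zero, zero_sub]
      exact Real.rpow_le_rpow_of_nonpos (by linarith [ht₀.1]) ht.2 (by linarith)
    have h4 : weight (-(0 * p) - r) ζ = weight (-r) ζ := by ring_nf
    rw [h4]
    have h5 := weight_pos (-r) ζ
    have h6 : 0 ≤ (1 - ρ) ^ (-(0 : ℝ)) * ρ ^ (-γ) :=
      mul_nonneg (Real.rpow_nonneg (by linarith [hρ.2]) _) (Real.rpow_nonneg hρ.1.le _)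
    gcongr
  · exact (intervalIntegrable_betaConst zero_lt_one hγ).const_mul _
  · refine Eventually.of_forall fun ρ hρ => ?_
    rw [uIoc_of_le zero_le_one] at hρ
    refine ContinuousWithinAt.mul (by fun_prop) ?_
    have h1 := (hn.continuousOn_apply ζ).comp (f := fun t : ℝ => t * ρ) (s := Ioc 0 T)
      (by fun_prop) fun t ht => hmem t ht ρ hρ
    exact h1 t₀ ht₀

theorem IsForcing.aestronglyMeasurable (hn : IsForcing n T A γ r) :
    AEStronglyMeasurable (Function.uncurry n)
      ((volume.restrict (Ioc 0 T)).prod (volume : Measure ℝ)) := by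
  have h := hn.continuousOn.aestronglyMeasurable (μ := (volume : Measure ℝ).prod volume)
    (measurableSet_Ioc.prod MeasurableSet.univ)
  rwa [← Measure.prod_restrict, Measure.restrict_univ] at h

theorem aestronglyMeasurable_duhamel (hm : IsDissipative m p K) (hn : IsForcing n T A γ r)
    {t : ℝ} (ht : t ∈ Icc 0 T) : AEStronglyMeasurable (duhamel m n t) volume := by
  have h1 : AEStronglyMeasurable (fun q : ℝ × ℝ =>
      Complex.exp (((t - q.1 : ℝ) : ℂ) * m q.2) * n q.1 q.2)
      ((volume.restrict (Ioc 0 t)).prod (volume : Measure ℝ)) := by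
    refine AEStronglyMeasurable.mul ?_ ?_
    · have := hm.measurable
      exact (Measurable.aestronglyMeasurable (by fun_prop))
    · exact hn.aestronglyMeasurable.mono_measure (Measure.prod_mono
        (Measure.restrict_mono (Ioc_subset_Ioc_right ht.2) le_rfl) le_rfl)
  have h2 := h1.prod_swap.integral_prod_right'
  refine h2.congr (Eventually.of_forall fun ζ => ?_)
  simp only [duhamel, intervalIntegral.integral_of_le ht.1, Prod.swap_prod_mk]

/-- The Duhamel integral is in `H ^ a` if `a < κ p + r - 1 / 2` for some `κ < 1`: the semigroup gains
`κ p` derivatives, the forcing term decays like `⟨ξ⟩ ^ (-r)`, and square integrability in `ξ` costs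
`1 / 2`. -/
theorem memLp_weight_mul_duhamel (hm : IsDissipative m p K) (hn : IsForcing n T A γ r)
    (hT1 : T ≤ 1) (hγ : γ < 1) {κ a : ℝ} (hκ : κ ∈ Ico (0 : ℝ) 1)
    (ha : a - κ * p - r < -1 / 2) {t : ℝ} (ht : t ∈ Icc 0 T) :
    MemLp (fun ζ => (weight a ζ : ℂ) * duhamel m n t ζ) 2 volume := by
  have hmeas : AEStronglyMeasurable (fun ζ => (weight a ζ : ℂ) * duhamel m n t ζ) volume :=
    (continuous_weight_ofReal a).aestronglyMeasurable.mul (aestronglyMeasurable_duhamel hm hn ht)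
  rcases ht.1.eq_or_lt with h0 | h0
  · simp only [← h0, duhamel_zero, mul_zero]
    exact MemLp.zero'
  · refine memLp_of_norm_le hmeas ((memLp_weight ha).const_mul
      (K * A * betaConst κ γ * t ^ (1 - κ - γ))) (Eventually.of_forall fun ζ => ?_)
    rw [norm_mul, norm_weight_ofReal]
    refine (mul_le_mul_of_nonneg_left (norm_duhamel_le hm hn hT1 hγ hκ ⟨h0, ht.2⟩ ζ)
      (weight_pos a ζ).le).trans_eq ?_
    have : weight (a - κ * p - r) ζ = weight a ζ * weight (-(κ * p) - r) ζ := by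
      rw [weight_mul]; ring_nf
    rw [this]
    ring

/-- The `L ^ 2` norm of the weight `⟨ξ⟩ ^ r`, for `r < -1 / 2` (and `0` for the other `r`). -/
def weightNorm (r : ℝ) : ℝ := ‖mkL2 fun ζ => (weight r ζ : ℂ)‖

theorem memLp_weight_ofReal {r : ℝ} (h : r < -1 / 2) :
    MemLp (fun ζ => (weight r ζ : ℂ)) 2 volume := (memLp_weight h).ofReal

theorem norm_mkL2_weight_mul_duhamel_le (hm : IsDissipative m p K) (hn : IsForcing n T A γ r)
    (hT1 : T ≤ 1) (hγ : γ < 1) {κ a : ℝ} (hκ : κ ∈ Ico (0 : ℝ) 1)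
    (ha : a - κ * p - r < -1 / 2) {t : ℝ} (ht : t ∈ Ioc 0 T) :
    ‖mkL2 fun ζ => (weight a ζ : ℂ) * duhamel m n t ζ‖
      ≤ K * A * betaConst κ γ * t ^ (1 - κ - γ) * weightNorm (a - κ * p - r) := by
  refine norm_mkL2_le_mul (memLp_weight_mul_duhamel hm hn hT1 hγ hκ ha ⟨ht.1.le, ht.2⟩) ?_
  filter_upwards [coeFn_mkL2 (memLp_weight_ofReal ha)] with ζ hζ
  rw [hζ, norm_mul, norm_weight_ofReal, norm_weight_ofReal]
  refine (mul_le_mul_of_nonneg_left (norm_duhamel_le hm hn hT1 hγ hκ ht ζ)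
    (weight_pos a ζ).le).trans_eq ?_
  have : weight (a - κ * p - r) ζ = weight a ζ * weight (-(κ * p) - r) ζ := by
    rw [weight_mul]; ring_nf
  rw [this]
  ring

theorem continuousOn_mkL2_weight_mul_duhamel (hm : IsDissipative m p K)
    (hn : IsForcing n T A γ r) (hT1 : T ≤ 1) (hγ0 : 0 ≤ γ) (hγ : γ < 1) {κ a : ℝ}
    (hκ : κ ∈ Ico (0 : ℝ) 1) (ha : a - κ * p - r < -1 / 2) :
    ContinuousOn (fun t => mkL2 fun ζ => (weight a ζ : ℂ) * duhamel m n t ζ) (Ioc 0 T) := by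
  intro t₀ ht₀
  have hA := hn.nonneg (ht₀.1.trans_le ht₀.2)
  have hK : 0 ≤ K := zero_le_one.trans hm.one_le
  have hB := betaConst_nonneg κ γ
  -- near `t₀`, all powers of `t` are bounded by a constant
  obtain ⟨c, hc⟩ : ∃ c : ℝ, ∀ᶠ t in 𝓝[Ioc 0 T] t₀, t ^ (1 - κ - γ) ≤ c := by
    have h : Tendsto (fun t : ℝ => t ^ (1 - κ - γ)) (𝓝[Ioc 0 T] t₀) (𝓝 (t₀ ^ (1 - κ - γ))) :=
      ((Real.continuousAt_rpow_const t₀ _ (Or.inl ht₀.1.ne')).tendsto).mono_left nhdsWithin_le_nhds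
    exact ⟨t₀ ^ (1 - κ - γ) + 1, h.eventually_le_const (lt_add_one _)⟩
  have hmem : ∀ᶠ t in 𝓝[Ioc 0 T] t₀, t ∈ Ioc 0 T := eventually_mem_nhdsWithin
  have hbd : ∀ t ∈ Ioc 0 T, t ^ (1 - κ - γ) ≤ c → ∀ ζ, ‖(weight a ζ : ℂ) * duhamel m n t ζ‖
      ≤ K * A * betaConst κ γ * c * weight (a - κ * p - r) ζ := fun t ht htc ζ => by
    rw [norm_mul, norm_weight_ofReal]
    have h1 := norm_duhamel_le hm hn hT1 hγ hκ ht ζ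
    have h2 : weight (a - κ * p - r) ζ = weight a ζ * weight (-(κ * p) - r) ζ := by
      rw [weight_mul]; ring_nf
    have h3 := weight_pos a ζ
    have h4 := weight_pos (-(κ * p) - r) ζ
    calc weight a ζ * ‖duhamel m n t ζ‖
        ≤ weight a ζ * (K * A * betaConst κ γ * c * weight (-(κ * p) - r) ζ) := by
          refine mul_le_mul_of_nonneg_left (h1.trans ?_) h3.le
          gcongr
      _ = _ := by rw [h2]; ring
  refine tendsto_mkL2 (g := fun ζ => K * A * betaConst κ γ * c * weight (a - κ * p - r) ζ)
    ?_ ?_ ((memLp_weight ha).const_mul _) ?_ ?_ ?_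
  · filter_upwards [hmem] with t ht
    exact (continuous_weight_ofReal a).aestronglyMeasurable.mul
      (aestronglyMeasurable_duhamel hm hn ⟨ht.1.le, ht.2⟩)
  · exact (continuous_weight_ofReal a).aestronglyMeasurable.mul
      (aestronglyMeasurable_duhamel hm hn ⟨ht₀.1.le, ht₀.2⟩)
  · filter_upwards [hmem, hc] with t ht htc
    exact Eventually.of_forall (hbd t ht htc)
  · exact Eventually.of_forall (hbd t₀ ht₀ (hc.self_of_nhdsWithin ht₀))
  · refine Eventually.of_forall fun ζ => ?_
    exact (continuousOn_duhamel hm hn hT1 hγ0 hγ ζ t₀ ht₀).tendsto.const_mul _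

end Bounds

/-! ### The linear evolution in `L ^ 2` -/

section LinearFlow

variable {m : ℝ → ℂ} {p K : ℝ}

theorem memLp_weight_mul_exp (hm : IsDissipative m p K) {κ : ℝ} (hκ : κ ∈ Icc (0 : ℝ) 1) {t : ℝ}
    (ht : t ∈ Ioc (0 : ℝ) 1) (g : L2) :
    MemLp (fun ζ => (weight (κ * p) ζ : ℂ) * Complex.exp (t * m ζ) * g ζ) 2 volume ∧
      ‖mkL2 fun ζ => (weight (κ * p) ζ : ℂ) * Complex.exp (t * m ζ) * g ζ‖
        ≤ K * t ^ (-κ) * ‖g‖ := by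
  have h : ∀ ζ, ‖(weight (κ * p) ζ : ℂ) * Complex.exp (t * m ζ)‖ ≤ K * t ^ (-κ) := fun ζ => by
    rw [norm_mul, norm_weight_ofReal]
    refine (mul_le_mul_of_nonneg_left (hm.norm_exp_le t ht κ hκ ζ)
      (weight_pos _ ζ).le).trans_eq ?_
    linear_combination (K * t ^ (-κ)) * weight_mul_neg (κ * p) ζ
  have h1 := memLp_mul_of_norm_le g ((continuous_weight_ofReal _).aestronglyMeasurable.mul
    (hm.measurable_exp t).aestronglyMeasurable) h
  refine ⟨h1, norm_mkL2_le_mul h1 (Eventually.of_forall fun ζ => ?_)⟩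
  rw [norm_mul]
  exact mul_le_mul_of_nonneg_right (h ζ) (norm_nonneg _)

theorem continuousOn_weight_mul_exp (hm : IsDissipative m p K) {κ : ℝ} (hκ : κ ∈ Icc (0 : ℝ) 1)
    (g : L2) :
    ContinuousOn (fun t : ℝ => mkL2 fun ζ => (weight (κ * p) ζ : ℂ) * Complex.exp (t * m ζ) * g ζ)
      (Ioc 0 1) := by
  intro t₀ ht₀
  have hK : 0 ≤ K := zero_le_one.trans hm.one_le
  have hmem : ∀ᶠ t in 𝓝[Ioc (0 : ℝ) 1] t₀, t ∈ Ioc (0 : ℝ) 1 ∧ t₀ / 2 ≤ t :=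
    eventually_mem_nhdsWithin.and (eventually_nhdsWithin_of_eventually_nhds
      (eventually_ge_nhds (half_lt_self ht₀.1)))
  have hmeas : ∀ t : ℝ, AEStronglyMeasurable
      (fun ζ => (weight (κ * p) ζ : ℂ) * Complex.exp (t * m ζ) * g ζ) volume := fun t =>
    ((continuous_weight_ofReal _).aestronglyMeasurable.mul
      (hm.measurable_exp t).aestronglyMeasurable).mul (Lp.aestronglyMeasurable g)
  have hbd : ∀ t ∈ Ioc (0 : ℝ) 1, t₀ / 2 ≤ t → ∀ ζ,
      ‖(weight (κ * p) ζ : ℂ) * Complex.exp (t * m ζ) * g ζ‖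
        ≤ K * (t₀ / 2) ^ (-κ) * ‖g ζ‖ := fun t ht htt ζ => by
    rw [norm_mul, norm_mul, norm_weight_ofReal]
    refine mul_le_mul_of_nonneg_right ?_ (norm_nonneg _)
    refine (mul_le_mul_of_nonneg_left (hm.norm_exp_le t ht κ hκ ζ)
      (weight_pos _ ζ).le).trans ?_
    have h1 : t ^ (-κ) ≤ (t₀ / 2) ^ (-κ) :=
      Real.rpow_le_rpow_of_nonpos (by linarith [ht₀.1]) htt (by linarith [hκ.1])
    calc weight (κ * p) ζ * (K * t ^ (-κ) * weight (-(κ * p)) ζ) = K * t ^ (-κ) := by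
          linear_combination (K * t ^ (-κ)) * weight_mul_neg (κ * p) ζ
      _ ≤ _ := by gcongr
  refine tendsto_mkL2 (Eventually.of_forall hmeas) (hmeas t₀)
    ((Lp.memLp g).norm.const_mul (K * (t₀ / 2) ^ (-κ))) ?_
    (Eventually.of_forall (hbd t₀ ht₀ (by linarith [ht₀.1]))) (Eventually.of_forall fun ζ => ?_)
  · filter_upwards [hmem] with t ht using Eventually.of_forall (hbd t ht.1 ht.2)
  · refine Tendsto.mul_const _ (Tendsto.const_mul _ ?_)
    exact (Continuous.tendsto (f := fun t : ℝ => Complex.exp (t * m ζ)) (by fun_prop)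
      t₀).mono_left nhdsWithin_le_nhds

theorem memLp_exp_mul (hm : IsDissipative m p K) {t : ℝ} (ht : t ∈ Icc (0 : ℝ) 1) (g : L2) :
    MemLp (fun ζ => Complex.exp (t * m ζ) * g ζ) 2 volume ∧
      ‖mkL2 fun ζ => Complex.exp (t * m ζ) * g ζ‖ ≤ K * ‖g‖ := by
  have h1 := memLp_mul_of_norm_le g (hm.measurable_exp t).aestronglyMeasurable
    (hm.norm_exp_le_const ht)
  refine ⟨h1, norm_mkL2_le_mul h1 (Eventually.of_forall fun ζ => ?_)⟩
  rw [norm_mul]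
  exact mul_le_mul_of_nonneg_right (hm.norm_exp_le_const ht ζ) (norm_nonneg _)

theorem continuousOn_exp_mul (hm : IsDissipative m p K) (g : L2) :
    ContinuousOn (fun t : ℝ => mkL2 fun ζ => Complex.exp (t * m ζ) * g ζ) (Icc 0 1) := by
  intro t₀ ht₀
  have hmeas : ∀ t : ℝ, AEStronglyMeasurable
      (fun ζ => Complex.exp (t * m ζ) * g ζ) volume := fun t =>
    (hm.measurable_exp t).aestronglyMeasurable.mul (Lp.aestronglyMeasurable g)
  have hbd : ∀ t ∈ Icc (0 : ℝ) 1, ∀ ζ,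
      ‖Complex.exp (t * m ζ) * g ζ‖ ≤ K * ‖g ζ‖ := fun t ht ζ => by
    rw [norm_mul]
    exact mul_le_mul_of_nonneg_right (hm.norm_exp_le_const ht ζ) (norm_nonneg _)
  refine tendsto_mkL2 (Eventually.of_forall hmeas) (hmeas t₀)
    ((Lp.memLp g).norm.const_mul K) ?_
    (Eventually.of_forall (hbd t₀ ht₀)) (Eventually.of_forall fun ζ => ?_)
  · filter_upwards [eventually_mem_nhdsWithin] with t ht using Eventually.of_forall (hbd t ht)
  · refine Tendsto.mul_const _ ?_
    exact (Continuous.tendsto (f := fun t : ℝ => Complex.exp (t * m ζ)) (by fun_prop)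
      t₀).mono_left nhdsWithin_le_nhds

end LinearFlow

/-! ### Bounded continuous functions on `(0, T]` -/

section ExtendZero

variable {T : ℝ} {E : Type*} [NormedAddCommGroup E]

open Classical in
/-- The extension by `0` of a function on `(0, T]`. -/
def extendZero (v : Ioc (0 : ℝ) T →ᵇ E) (t : ℝ) : E := if h : t ∈ Ioc 0 T then v ⟨t, h⟩ else 0

theorem extendZero_of_mem (v : Ioc (0 : ℝ) T →ᵇ E) {t : ℝ} (h : t ∈ Ioc 0 T) :
    extendZero v t = v ⟨t, h⟩ := dif_pos h

theorem extendZero_of_notMem (v : Ioc (0 : ℝ) T →ᵇ E) {t : ℝ} (h : t ∉ Ioc 0 T) :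
    extendZero v t = 0 := dif_neg h

theorem continuousOn_extendZero (v : Ioc (0 : ℝ) T →ᵇ E) :
    ContinuousOn (extendZero v) (Ioc 0 T) := by
  rw [continuousOn_iff_continuous_domRestrict]
  refine v.continuous.congr fun t => ?_
  rw [domRestrict_apply, extendZero_of_mem v t.2]

theorem norm_extendZero_le (v : Ioc (0 : ℝ) T →ᵇ E) (t : ℝ) : ‖extendZero v t‖ ≤ ‖v‖ := by
  by_cases h : t ∈ Ioc 0 T
  · rw [extendZero_of_mem v h]
    exact v.norm_coe_le_norm _
  · rw [extendZero_of_notMem v h, norm_zero]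
    exact norm_nonneg _

theorem extendZero_add (v w : Ioc (0 : ℝ) T →ᵇ E) (t : ℝ) :
    extendZero (v + w) t = extendZero v t + extendZero w t := by
  unfold extendZero
  split_ifs <;> simp

theorem extendZero_smul [NormedSpace ℂ E] (c : ℂ) (v : Ioc (0 : ℝ) T →ᵇ E) (t : ℝ) :
    extendZero (c • v) t = c • extendZero v t := by
  unfold extendZero
  split_ifs <;> simp

end ExtendZero

/-- The pointwise application of a bounded bilinear map to bounded continuous functions. -/
def bilinFun {α E F G : Type*} [TopologicalSpace α] [NormedAddCommGroup E] [NormedSpace ℂ E]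
    [NormedAddCommGroup F] [NormedSpace ℂ F] [NormedAddCommGroup G] [NormedSpace ℂ G]
    (B : E →L[ℂ] F →L[ℂ] G) (v : α →ᵇ E) (w : α →ᵇ F) : α →ᵇ G :=
  BoundedContinuousFunction.ofNormedAddCommGroup (fun t => B (v t) (w t))
    (by fun_prop) (‖B‖ * ‖v‖ * ‖w‖) fun t => by
      refine (B.le_opNorm₂ _ _).trans ?_
      gcongr
      · exact v.norm_coe_le_norm t
      · exact w.norm_coe_le_norm t

/-- The bounded bilinear map on bounded continuous functions given by a bounded bilinear map. -/
def bilinBCF (α : Type*) {E F G : Type*} [TopologicalSpace α] [NormedAddCommGroup E]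
    [NormedSpace ℂ E] [NormedAddCommGroup F] [NormedSpace ℂ F] [NormedAddCommGroup G]
    [NormedSpace ℂ G] (B : E →L[ℂ] F →L[ℂ] G) : (α →ᵇ E) →L[ℂ] (α →ᵇ F) →L[ℂ] (α →ᵇ G) :=
  LinearMap.mkContinuous₂
    (LinearMap.mk₂ ℂ (bilinFun B) (fun v v' w => by ext t; simp [bilinFun])
      (fun c v w => by ext t; simp [bilinFun]) (fun v w w' => by ext t; simp [bilinFun])
      (fun c v w => by ext t; simp [bilinFun]))
    ‖B‖ fun v w => (BoundedContinuousFunction.norm_le (by positivity)).2 fun t => by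
      refine (B.le_opNorm₂ _ _).trans ?_
      gcongr
      · exact v.norm_coe_le_norm t
      · exact w.norm_coe_le_norm t

theorem bilinBCF_apply {α E F G : Type*} [TopologicalSpace α] [NormedAddCommGroup E]
    [NormedSpace ℂ E] [NormedAddCommGroup F] [NormedSpace ℂ F] [NormedAddCommGroup G]
    [NormedSpace ℂ G] (B : E →L[ℂ] F →L[ℂ] G) (v : α →ᵇ E) (w : α →ᵇ F) (t : α) :
    bilinBCF α B v w t = B (v t) (w t) := rfl

/-- The forcing terms `τ ^ (-γ) * ⟨ξ⟩ ^ (-r) * ν(τ)`, with `ν` bounded and continuous. -/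
def forcing {T : ℝ} (γ r : ℝ) (ν : Ioc (0 : ℝ) T →ᵇ (ℝ →ᵇ ℂ)) (τ ζ : ℝ) : ℂ :=
  ((τ ^ (-γ) : ℝ) : ℂ) * (weight (-r) ζ : ℂ) * extendZero ν τ ζ

theorem isForcing_forcing {T : ℝ} (γ r : ℝ) (ν : Ioc (0 : ℝ) T →ᵇ (ℝ →ᵇ ℂ)) :
    IsForcing (forcing γ r ν) T ‖ν‖ γ r where
  continuousOn := by
    refine ContinuousOn.mul (ContinuousOn.mul ?_ ?_) ?_
    · refine Complex.continuous_ofReal.comp_continuousOn ?_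
      exact ContinuousOn.rpow_const continuous_fst.continuousOn fun q hq => Or.inl hq.1.1.ne'
    · exact ((continuous_weight_ofReal _).comp continuous_snd).continuousOn
    · have h : ContinuousOn (fun q : ℝ × ℝ => (extendZero ν q.1, q.2)) (Ioc 0 T ×ˢ univ) :=
        ((continuousOn_extendZero ν).comp continuous_fst.continuousOn fun q hq => hq.1).prodMk
          continuous_snd.continuousOn
      exact (continuous_eval (F := ℝ →ᵇ ℂ)).comp_continuousOn h
  norm_le τ hτ ζ := by
    rw [forcing, norm_mul, norm_mul, norm_weight_ofReal, Complex.norm_real, Real.norm_eq_abs,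
      abs_of_nonneg (Real.rpow_nonneg hτ.1.le _), mul_comm, mul_assoc]
    refine mul_le_mul_of_nonneg_right ?_
      (mul_nonneg (Real.rpow_nonneg hτ.1.le _) (weight_pos _ _).le)
    exact ((extendZero ν τ).norm_coe_le_norm ζ).trans (norm_extendZero_le ν τ)

theorem forcing_add {T : ℝ} (γ r : ℝ) (ν ν' : Ioc (0 : ℝ) T →ᵇ (ℝ →ᵇ ℂ)) (τ ζ : ℝ) :
    forcing γ r (ν + ν') τ ζ = forcing γ r ν τ ζ + forcing γ r ν' τ ζ := by
  rw [forcing, extendZero_add, forcing, forcing, BoundedContinuousFunction.add_apply, mul_add]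

theorem forcing_smul {T : ℝ} (γ r : ℝ) (c : ℂ) (ν : Ioc (0 : ℝ) T →ᵇ (ℝ →ᵇ ℂ)) (τ ζ : ℝ) :
    forcing γ r (c • ν) τ ζ = c * forcing γ r ν τ ζ := by
  rw [forcing, extendZero_smul, forcing, BoundedContinuousFunction.smul_apply, smul_eq_mul]
  ring

theorem intervalIntegrable_duhamel_integrand {m : ℝ → ℂ} {p K T A γ r : ℝ} {n : ℝ → ℝ → ℂ}
    (hm : IsDissipative m p K) (hn : IsForcing n T A γ r) (hT1 : T ≤ 1) (hγ : γ < 1) {t : ℝ}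
    (ht : t ∈ Icc 0 T) (ζ : ℝ) :
    IntervalIntegrable (fun τ => Complex.exp (((t - τ : ℝ) : ℂ) * m ζ) * n τ ζ) volume 0 t := by
  have h1 : IntervalIntegrable (fun τ : ℝ => K * (A * τ ^ (-γ) * weight (-r) ζ)) volume 0 t :=
    (((intervalIntegral.intervalIntegrable_rpow' (by linarith)).const_mul A).mul_const _).const_mul _
  refine h1.mono_fun' ?_ ?_
  · rw [uIoc_of_le ht.1]
    refine ContinuousOn.aestronglyMeasurable (ContinuousOn.mul (by fun_prop) ?_) measurableSet_Ioc
    exact (hn.continuousOn_apply ζ).mono (Ioc_subset_Ioc_right ht.2)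
  · rw [uIoc_of_le ht.1]
    refine (ae_restrict_mem measurableSet_Ioc).mono fun τ hτ => ?_
    refine (norm_mul_le _ _).trans ?_
    refine mul_le_mul (hm.norm_exp_le_const ⟨by linarith [hτ.2], by linarith [hτ.1, ht.2]⟩ ζ)
      (hn.norm_le τ ⟨hτ.1, hτ.2.trans ht.2⟩ ζ) (norm_nonneg _) (zero_le_one.trans hm.one_le)

/-! ### The linear and the Duhamel part of the solution map -/

/-- The exponents of the solution space: `⟨ξ⟩ ^ σ * (𝓕 u)` is allowed to grow in `L ^ 2` like
`t ^ (-β)`, where `2 β < 1` makes `(u_x) ^ 2` integrable in time; the Duhamel integral is estimated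
in `H ^ σ` with a loss of `κ` powers of `t`, and in `H ^ s` with a loss of `κ'` powers. -/
structure IsExponents (p s σ β κ κ' : ℝ) : Prop where
  one_le_σ : 1 ≤ σ
  β_mul : β * p = σ - s
  β_nonneg : 0 ≤ β
  two_β_lt : 2 * β < 1
  β_le : β ≤ (1 + |s|) / p
  κ_nonneg : 0 ≤ κ
  two_κ_lt : 2 * κ < 1
  lt_κ_mul : 3 / 2 < κ * p
  κ'_nonneg : 0 ≤ κ'
  κ'_lt : κ' < 1 - 2 * β
  lt_κ'_mul : s - σ + 3 / 2 < κ' * p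

/-- A choice of exponents: `σ = max s 1`, and `2 β = 2 (σ - s) / p < 1` is the hypothesis on `s`;
`κ` lies strictly between `3 / (2 p)` and `1 / 2`, which is possible since `p > 3`. -/
theorem exists_isExponents {p s : ℝ} (hp : 3 < p) (hs : 1 - p / 2 < s) :
    ∃ σ β κ κ', IsExponents p s σ β κ κ' := by
  have hp0 : 0 < p := by linarith
  have h1 : ((max s 1 - s) / p) * p = max s 1 - s := by field_simp
  have h2 : 2 * ((max s 1 - s) / p) < 1 := by
    rw [← mul_div_assoc, div_lt_one hp0]
    rcases max_cases s 1 with h | h <;> linarith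
  have h3 : 0 ≤ (max s 1 - s) / p := div_nonneg (by linarith [le_max_left s 1]) hp0.le
  have h4 : ((3 + p) / (4 * p)) * p = (3 + p) / 4 := by field_simp
  have h5 : 2 * ((3 + p) / (4 * p)) < 1 := by
    rw [← mul_div_assoc, div_lt_one (by positivity)]
    linarith
  refine ⟨max s 1, (max s 1 - s) / p, (3 + p) / (4 * p),
    max 0 ((3 + p) / (4 * p) - (max s 1 - s) / p), le_max_right _ _, h1, h3, h2, ?_, ?_, h5, ?_,
    le_max_left _ _, ?_, ?_⟩
  · refine div_le_div_of_nonneg_right ?_ hp0.le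
    rcases max_cases s 1 with h | h <;> linarith [neg_abs_le s, abs_nonneg s]
  · positivity
  · rw [h4]; linarith
  · refine max_lt (by linarith) (by linarith)
  · have := mul_le_mul_of_nonneg_right
      (le_max_right 0 ((3 + p) / (4 * p) - (max s 1 - s) / p)) hp0.le
    rw [sub_mul, h4, h1] at this
    linarith

section Maps

variable {m : ℝ → ℂ} {p K s σ β κ κ' T : ℝ}

theorem duhamel_forcing_add (hm : IsDissipative m p K) (hT1 : T ≤ 1) {γ r : ℝ} (hγ : γ < 1)
    (ν ν' : Ioc (0 : ℝ) T →ᵇ (ℝ →ᵇ ℂ)) {t : ℝ} (ht : t ∈ Icc 0 T) (ζ : ℝ) :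
    duhamel m (forcing γ r (ν + ν')) t ζ
      = duhamel m (forcing γ r ν) t ζ + duhamel m (forcing γ r ν') t ζ := by
  simp only [duhamel, forcing_add, mul_add]
  exact intervalIntegral.integral_add
    (intervalIntegrable_duhamel_integrand hm (isForcing_forcing γ r ν) hT1 hγ ht ζ)
    (intervalIntegrable_duhamel_integrand hm (isForcing_forcing γ r ν') hT1 hγ ht ζ)

theorem duhamel_forcing_smul {γ r : ℝ} (c : ℂ) (ν : Ioc (0 : ℝ) T →ᵇ (ℝ →ᵇ ℂ)) (t ζ : ℝ) :
    duhamel m (forcing γ r (c • ν)) t ζ = c * duhamel m (forcing γ r ν) t ζ := by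
  simp only [duhamel, forcing_smul, mul_left_comm]
  exact intervalIntegral.integral_const_mul _ _

theorem mkL2_duhamel_add (hm : IsDissipative m p K) (hT1 : T ≤ 1) {γ r a k : ℝ} (hγ : γ < 1)
    (hk : k ∈ Ico (0 : ℝ) 1) (ha : a - k * p - r < -1 / 2) (ν ν' : Ioc (0 : ℝ) T →ᵇ (ℝ →ᵇ ℂ))
    {t : ℝ} (ht : t ∈ Icc 0 T) :
    (mkL2 fun ζ => (weight a ζ : ℂ) * duhamel m (forcing γ r (ν + ν')) t ζ)
      = (mkL2 fun ζ => (weight a ζ : ℂ) * duhamel m (forcing γ r ν) t ζ)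
        + mkL2 fun ζ => (weight a ζ : ℂ) * duhamel m (forcing γ r ν') t ζ := by
  rw [← mkL2_add (memLp_weight_mul_duhamel hm (isForcing_forcing γ r ν) hT1 hγ hk ha ht)
    (memLp_weight_mul_duhamel hm (isForcing_forcing γ r ν') hT1 hγ hk ha ht)]
  congr 1
  ext ζ
  rw [duhamel_forcing_add hm hT1 hγ ν ν' ht, mul_add, Pi.add_apply]

theorem mkL2_duhamel_smul (hm : IsDissipative m p K) (hT1 : T ≤ 1) {γ r a k : ℝ} (hγ : γ < 1)
    (hk : k ∈ Ico (0 : ℝ) 1) (ha : a - k * p - r < -1 / 2) (c : ℂ)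
    (ν : Ioc (0 : ℝ) T →ᵇ (ℝ →ᵇ ℂ)) {t : ℝ} (ht : t ∈ Icc 0 T) :
    (mkL2 fun ζ => (weight a ζ : ℂ) * duhamel m (forcing γ r (c • ν)) t ζ)
      = c • mkL2 fun ζ => (weight a ζ : ℂ) * duhamel m (forcing γ r ν) t ζ := by
  rw [← mkL2_smul c (memLp_weight_mul_duhamel hm (isForcing_forcing γ r ν) hT1 hγ hk ha ht)]
  congr 1
  ext ζ
  rw [duhamel_forcing_smul, Pi.smul_apply, smul_eq_mul]
  ring

/-- The bounded continuous function `t ↦ t ^ β * f t` on `(0, T]`. -/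
def rescale (β C : ℝ) (f : ℝ → L2) (hf : ContinuousOn f (Ioc 0 T))
    (h : ∀ t ∈ Ioc 0 T, ‖((t ^ β : ℝ) : ℂ) • f t‖ ≤ C) : Ioc (0 : ℝ) T →ᵇ L2 :=
  BoundedContinuousFunction.ofNormedAddCommGroup
    (fun t : Ioc (0 : ℝ) T => (((t : ℝ) ^ β : ℝ) : ℂ) • f t)
    (by
      have h1 : Continuous fun t : Ioc (0 : ℝ) T => (((t : ℝ) ^ β : ℝ) : ℂ) :=
        Complex.continuous_ofReal.comp
          (Continuous.rpow_const continuous_subtype_val fun t => Or.inl t.2.1.ne')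
      have h2 : Continuous fun t : Ioc (0 : ℝ) T => f t :=
        continuousOn_iff_continuous_domRestrict.1 hf
      exact h1.smul h2)
    C fun t => h t t.2

/-- The continuous function on `[0, T]` given by a function on `ℝ`. -/
def restrictIcc (f : ℝ → L2) (hf : ContinuousOn f (Icc 0 T)) : C(Icc (0 : ℝ) T, L2) :=
  ⟨fun t => f t, continuousOn_iff_continuous_domRestrict.1 hf⟩

theorem norm_restrictIcc_le {f : ℝ → L2} (hf : ContinuousOn f (Icc 0 T)) {C : ℝ} (hC : 0 ≤ C)
    (h : ∀ t ∈ Icc 0 T, ‖f t‖ ≤ C) : ‖restrictIcc f hf‖ ≤ C :=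
  (ContinuousMap.norm_le _ hC).2 fun t => h t t.2

theorem mkL2_mul_add {a : ℝ → ℂ} (h : ∀ g : L2, MemLp (fun ζ => a ζ * g ζ) 2 volume) (f g : L2) :
    (mkL2 fun ζ => a ζ * (f + g : L2) ζ) = (mkL2 fun ζ => a ζ * f ζ) + mkL2 fun ζ => a ζ * g ζ := by
  rw [← mkL2_add (h f) (h g)]
  refine mkL2_congr ?_
  filter_upwards [Lp.coeFn_add f g] with ζ hζ
  rw [hζ, Pi.add_apply, Pi.add_apply, mul_add]

theorem mkL2_mul_smul {a : ℝ → ℂ} (h : ∀ g : L2, MemLp (fun ζ => a ζ * g ζ) 2 volume) (c : ℂ)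
    (g : L2) : (mkL2 fun ζ => a ζ * (c • g : L2) ζ) = c • mkL2 fun ζ => a ζ * g ζ := by
  rw [← mkL2_smul c (h g)]
  refine mkL2_congr ?_
  filter_upwards [Lp.coeFn_smul c g] with ζ hζ
  rw [hζ, Pi.smul_apply, Pi.smul_apply, smul_eq_mul, smul_eq_mul]
  ring

/-- The linear evolution of `g ∈ L ^ 2`, in `C([0, T]; L ^ 2)`. -/
def flowCFun (hm : IsDissipative m p K) (hT1 : T ≤ 1) (g : L2) : C(Icc (0 : ℝ) T, L2) :=
  restrictIcc (fun t : ℝ => mkL2 fun ζ => Complex.exp (t * m ζ) * g ζ)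
    ((continuousOn_exp_mul hm g).mono (Icc_subset_Icc_right hT1))

theorem flowCFun_apply (hm : IsDissipative m p K) (hT1 : T ≤ 1) (g : L2) (t : Icc (0 : ℝ) T) :
    flowCFun hm hT1 g t = mkL2 fun ζ => Complex.exp ((t : ℝ) * m ζ) * g ζ := rfl

theorem norm_flowCFun_le (hm : IsDissipative m p K) (hT1 : T ≤ 1) (g : L2) :
    ‖flowCFun hm hT1 g‖ ≤ K * ‖g‖ :=
  norm_restrictIcc_le _ (mul_nonneg (zero_le_one.trans hm.one_le) (norm_nonneg _)) fun _ ht =>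
    (memLp_exp_mul hm ⟨ht.1, ht.2.trans hT1⟩ g).2

/-- The linear evolution as a map from `L ^ 2` to `C([0, T]; L ^ 2)`. -/
def flowC (hm : IsDissipative m p K) (hT1 : T ≤ 1) : L2 →L[ℂ] C(Icc (0 : ℝ) T, L2) :=
  LinearMap.mkContinuous
    { toFun := flowCFun hm hT1
      map_add' := fun f g => by
        ext1 t
        rw [ContinuousMap.add_apply, flowCFun_apply, flowCFun_apply, flowCFun_apply]
        exact mkL2_mul_add
          (fun g => (memLp_exp_mul hm ⟨t.2.1, t.2.2.trans hT1⟩ g).1) f g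
      map_smul' := fun c g => by
        ext1 t
        rw [RingHom.id_apply, ContinuousMap.smul_apply, flowCFun_apply, flowCFun_apply]
        exact mkL2_mul_smul
          (fun g => (memLp_exp_mul hm ⟨t.2.1, t.2.2.trans hT1⟩ g).1) c g }
    K (norm_flowCFun_le hm hT1)

theorem flowC_apply (hm : IsDissipative m p K) (hT1 : T ≤ 1) (g : L2) (t : Icc (0 : ℝ) T) :
    flowC hm hT1 g t = mkL2 fun ζ => Complex.exp ((t : ℝ) * m ζ) * g ζ := rfl

theorem norm_rescale_flow_le (hm : IsDissipative m p K) (hT1 : T ≤ 1) (hβ : β ∈ Icc (0 : ℝ) 1)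
    (g : L2) {t : ℝ} (ht : t ∈ Ioc 0 T) : ‖((t ^ β : ℝ) : ℂ) •
      mkL2 fun ζ => (weight (β * p) ζ : ℂ) * Complex.exp (t * m ζ) * g ζ‖ ≤ K * ‖g‖ := by
  rw [norm_smul, Complex.norm_real, Real.norm_eq_abs, abs_of_nonneg (Real.rpow_nonneg ht.1.le _)]
  refine (mul_le_mul_of_nonneg_left (memLp_weight_mul_exp hm hβ ⟨ht.1, ht.2.trans hT1⟩ g).2
    (Real.rpow_nonneg ht.1.le _)).trans_eq ?_
  have : t ^ β * t ^ (-β) = 1 := by rw [← Real.rpow_add ht.1, add_neg_cancel, Real.rpow_zero]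
  linear_combination (K * ‖g‖) * this

/-- The function `t ↦ t ^ β * ⟨ξ⟩ ^ (β * p) * exp (t m) g`. -/
def flowBFun (hm : IsDissipative m p K) (hT1 : T ≤ 1) (hβ : β ∈ Icc (0 : ℝ) 1) (g : L2) :
    Ioc (0 : ℝ) T →ᵇ L2 :=
  rescale β (K * ‖g‖)
    (fun t : ℝ => mkL2 fun ζ => (weight (β * p) ζ : ℂ) * Complex.exp (t * m ζ) * g ζ)
    ((continuousOn_weight_mul_exp hm hβ g).mono (Ioc_subset_Ioc_right hT1))
    fun _ ht => norm_rescale_flow_le hm hT1 hβ g ht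

theorem flowBFun_apply (hm : IsDissipative m p K) (hT1 : T ≤ 1) (hβ : β ∈ Icc (0 : ℝ) 1) (g : L2)
    (t : Ioc (0 : ℝ) T) : flowBFun hm hT1 hβ g t = (((t : ℝ) ^ β : ℝ) : ℂ) •
      mkL2 fun ζ => (weight (β * p) ζ : ℂ) * Complex.exp ((t : ℝ) * m ζ) * g ζ := rfl

theorem norm_flowBFun_le (hm : IsDissipative m p K) (hT1 : T ≤ 1) (hβ : β ∈ Icc (0 : ℝ) 1)
    (g : L2) : ‖flowBFun hm hT1 hβ g‖ ≤ K * ‖g‖ :=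
  (BoundedContinuousFunction.norm_le
    (mul_nonneg (zero_le_one.trans hm.one_le) (norm_nonneg _))).2 fun t =>
      norm_rescale_flow_le hm hT1 hβ g t.2

/-- The linear evolution, as the map sending `⟨ξ⟩ ^ s * (𝓕 u₀)` to the bounded function
`t ^ β * ⟨ξ⟩ ^ (s + β * p) * (𝓕 u(t))`. -/
def flowB (hm : IsDissipative m p K) (hT1 : T ≤ 1) (hβ : β ∈ Icc (0 : ℝ) 1) :
    L2 →L[ℂ] (Ioc (0 : ℝ) T →ᵇ L2) :=
  LinearMap.mkContinuous
    { toFun := flowBFun hm hT1 hβ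
      map_add' := fun f g => by
        ext1 t
        rw [BoundedContinuousFunction.add_apply, flowBFun_apply, flowBFun_apply, flowBFun_apply,
          ← smul_add, mkL2_mul_add
            (fun g => (memLp_weight_mul_exp hm hβ ⟨t.2.1, t.2.2.trans hT1⟩ g).1) f g]
      map_smul' := fun c g => by
        ext1 t
        rw [RingHom.id_apply, BoundedContinuousFunction.smul_apply, flowBFun_apply, flowBFun_apply,
          smul_comm c, mkL2_mul_smul
            (fun g => (memLp_weight_mul_exp hm hβ ⟨t.2.1, t.2.2.trans hT1⟩ g).1) c g] }
    K (norm_flowBFun_le hm hT1 hβ)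

theorem flowB_apply (hm : IsDissipative m p K) (hT1 : T ≤ 1) (hβ : β ∈ Icc (0 : ℝ) 1) (g : L2)
    (t : Ioc (0 : ℝ) T) : flowB hm hT1 hβ g t = (((t : ℝ) ^ β : ℝ) : ℂ) •
      mkL2 fun ζ => (weight (β * p) ζ : ℂ) * Complex.exp ((t : ℝ) * m ζ) * g ζ := rfl

theorem norm_flowB_le (hm : IsDissipative m p K) (hT1 : T ≤ 1) (hβ : β ∈ Icc (0 : ℝ) 1) (g : L2) :
    ‖flowB hm hT1 hβ g‖ ≤ K * ‖g‖ := norm_flowBFun_le hm hT1 hβ g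

theorem IsExponents.κ_mem (e : IsExponents p s σ β κ κ') : κ ∈ Ico (0 : ℝ) 1 :=
  ⟨e.κ_nonneg, by linarith [e.two_κ_lt, e.κ_nonneg]⟩

theorem IsExponents.κ'_mem (e : IsExponents p s σ β κ κ') : κ' ∈ Ico (0 : ℝ) 1 :=
  ⟨e.κ'_nonneg, by linarith [e.κ'_lt, e.β_nonneg]⟩

theorem IsExponents.β_mem (e : IsExponents p s σ β κ κ') : β ∈ Icc (0 : ℝ) 1 :=
  ⟨e.β_nonneg, by linarith [e.two_β_lt, e.β_nonneg]⟩

theorem IsExponents.gain_σ (e : IsExponents p s σ β κ κ') : σ - κ * p - (σ - 1) < -1 / 2 := by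
  linarith [e.lt_κ_mul]

theorem IsExponents.gain_s (e : IsExponents p s σ β κ κ') : s - κ' * p - (σ - 1) < -1 / 2 := by
  linarith [e.lt_κ'_mul]

/-- The forcing with the time singularity and the weight of `(u_x) ^ 2`. -/
abbrev quadForcing (σ β : ℝ) (ν : Ioc (0 : ℝ) T →ᵇ (ℝ →ᵇ ℂ)) : ℝ → ℝ → ℂ :=
  forcing (2 * β) (σ - 1) ν

theorem continuousOn_duhamelC (hm : IsDissipative m p K) (e : IsExponents p s σ β κ κ')
    (hT1 : T ≤ 1) (ν : Ioc (0 : ℝ) T →ᵇ (ℝ →ᵇ ℂ)) :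
    ContinuousOn (fun t => mkL2 fun ζ => (weight s ζ : ℂ) * duhamel m (quadForcing σ β ν) t ζ)
      (Icc 0 T) := by
  have hn := isForcing_forcing (2 * β) (σ - 1) ν
  have h2β : 0 ≤ 2 * β := by linarith [e.β_nonneg]
  intro t₀ ht₀
  rcases ht₀.1.eq_or_lt with h0 | h0
  · -- at `t = 0` the norm is bounded by a positive power of `t`
    subst h0
    have h1 : (mkL2 fun ζ => (weight s ζ : ℂ) * duhamel m (quadForcing σ β ν) 0 ζ) = 0 := by
      simp only [duhamel_zero, mul_zero]
      exact mkL2_eq_of_ae (Lp.coeFn_zero _ _ _).symm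
    have hpos : 0 < 1 - κ' - 2 * β := by linarith [e.κ'_lt]
    set C := K * ‖ν‖ * betaConst κ' (2 * β) * weightNorm (s - κ' * p - (σ - 1)) with hC
    have h3 : Tendsto (fun t : ℝ => C * t ^ (1 - κ' - 2 * β)) (𝓝[Icc 0 T] 0) (𝓝 0) := by
      have h : Tendsto (fun t : ℝ => C * t ^ (1 - κ' - 2 * β)) (𝓝 0)
          (𝓝 (C * 0 ^ (1 - κ' - 2 * β))) :=
        ((Real.continuousAt_rpow_const 0 _ (Or.inr hpos.le)).tendsto).const_mul C
      rw [Real.zero_rpow hpos.ne', mul_zero] at h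
      exact h.mono_left nhdsWithin_le_nhds
    rw [ContinuousWithinAt, h1]
    refine squeeze_zero_norm' ?_ h3
    filter_upwards [eventually_mem_nhdsWithin] with t ht
    rcases ht.1.eq_or_lt with h4 | h4
    · rw [← h4, h1, norm_zero, Real.zero_rpow hpos.ne', mul_zero]
    · refine (norm_mkL2_weight_mul_duhamel_le hm hn hT1 e.two_β_lt e.κ'_mem e.gain_s
        ⟨h4, ht.2⟩).trans_eq ?_
      rw [hC]
      ring
  · have h1 := continuousOn_mkL2_weight_mul_duhamel hm hn hT1 h2β e.two_β_lt e.κ'_mem e.gain_s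
      t₀ ⟨h0, ht₀.2⟩
    have h2 : 𝓝[Icc 0 T] t₀ = 𝓝[Ioc 0 T] t₀ := by
      rw [← Ioi_inter_Iic, nhdsWithin_inter_of_mem (mem_nhdsWithin_of_mem_nhds (Ioi_mem_nhds h0)),
        ← Ici_inter_Iic, nhdsWithin_inter_of_mem (mem_nhdsWithin_of_mem_nhds (Ici_mem_nhds h0))]
    rw [ContinuousWithinAt, h2]
    exact h1

/-- The Duhamel integral of a forcing term, in `C([0, T]; H ^ s)`. -/
def duhamelCFun (hm : IsDissipative m p K) (e : IsExponents p s σ β κ κ') (hT1 : T ≤ 1)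
    (ν : Ioc (0 : ℝ) T →ᵇ (ℝ →ᵇ ℂ)) : C(Icc (0 : ℝ) T, L2) :=
  restrictIcc (fun t => mkL2 fun ζ => (weight s ζ : ℂ) * duhamel m (quadForcing σ β ν) t ζ)
    (continuousOn_duhamelC hm e hT1 ν)

theorem duhamelCFun_apply (hm : IsDissipative m p K) (e : IsExponents p s σ β κ κ') (hT1 : T ≤ 1)
    (ν : Ioc (0 : ℝ) T →ᵇ (ℝ →ᵇ ℂ)) (t : Icc (0 : ℝ) T) : duhamelCFun hm e hT1 ν t =
      mkL2 fun ζ => (weight s ζ : ℂ) * duhamel m (quadForcing σ β ν) t ζ := rfl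

theorem weightNorm_nonneg (r : ℝ) : 0 ≤ weightNorm r := norm_nonneg _

theorem norm_duhamelCFun_le (hm : IsDissipative m p K) (e : IsExponents p s σ β κ κ') (hT1 : T ≤ 1)
    (ν : Ioc (0 : ℝ) T →ᵇ (ℝ →ᵇ ℂ)) : ‖duhamelCFun hm e hT1 ν‖
      ≤ K * betaConst κ' (2 * β) * weightNorm (s - κ' * p - (σ - 1)) * ‖ν‖ := by
  have hK : 0 ≤ K := zero_le_one.trans hm.one_le
  have hB := betaConst_nonneg κ' (2 * β)
  have hW := weightNorm_nonneg (s - κ' * p - (σ - 1))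
  refine norm_restrictIcc_le _ (by positivity) fun t ht => ?_
  rcases ht.1.eq_or_lt with h0 | h0
  · have h1 : (mkL2 fun ζ => (weight s ζ : ℂ) * duhamel m (quadForcing σ β ν) t ζ) = 0 := by
      simp only [← h0, duhamel_zero, mul_zero]
      exact mkL2_eq_of_ae (Lp.coeFn_zero _ _ _).symm
    rw [h1, norm_zero]
    positivity
  · refine (norm_mkL2_weight_mul_duhamel_le hm (isForcing_forcing (2 * β) (σ - 1) ν) hT1
      e.two_β_lt e.κ'_mem e.gain_s ⟨h0, ht.2⟩).trans ?_
    have h2 : t ^ (1 - κ' - 2 * β) ≤ 1 :=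
      Real.rpow_le_one ht.1 (ht.2.trans hT1) (by linarith [e.κ'_lt])
    calc _ = K * betaConst κ' (2 * β) * weightNorm (s - κ' * p - (σ - 1)) * ‖ν‖ *
          t ^ (1 - κ' - 2 * β) := by ring
      _ ≤ _ := mul_le_of_le_one_right (by positivity) h2

/-- The Duhamel integral as a linear map into `C([0, T]; H ^ s)`. -/
def duhamelC (hm : IsDissipative m p K) (e : IsExponents p s σ β κ κ') (hT1 : T ≤ 1) :
    (Ioc (0 : ℝ) T →ᵇ (ℝ →ᵇ ℂ)) →L[ℂ] C(Icc (0 : ℝ) T, L2) :=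
  LinearMap.mkContinuous
    { toFun := duhamelCFun hm e hT1
      map_add' := fun ν ν' => by
        ext1 t
        rw [ContinuousMap.add_apply, duhamelCFun_apply, duhamelCFun_apply, duhamelCFun_apply]
        exact mkL2_duhamel_add hm hT1 e.two_β_lt e.κ'_mem e.gain_s ν ν' t.2
      map_smul' := fun c ν => by
        ext1 t
        rw [RingHom.id_apply, ContinuousMap.smul_apply, duhamelCFun_apply, duhamelCFun_apply]
        exact mkL2_duhamel_smul hm hT1 e.two_β_lt e.κ'_mem e.gain_s c ν t.2 }
    (K * betaConst κ' (2 * β) * weightNorm (s - κ' * p - (σ - 1))) (norm_duhamelCFun_le hm e hT1)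

theorem duhamelC_apply (hm : IsDissipative m p K) (e : IsExponents p s σ β κ κ') (hT1 : T ≤ 1)
    (ν : Ioc (0 : ℝ) T →ᵇ (ℝ →ᵇ ℂ)) (t : Icc (0 : ℝ) T) : duhamelC hm e hT1 ν t =
      mkL2 fun ζ => (weight s ζ : ℂ) * duhamel m (quadForcing σ β ν) t ζ := rfl

theorem norm_rescale_duhamel_le (hm : IsDissipative m p K) (e : IsExponents p s σ β κ κ')
    (hT1 : T ≤ 1) (ν : Ioc (0 : ℝ) T →ᵇ (ℝ →ᵇ ℂ)) {t : ℝ} (ht : t ∈ Ioc 0 T) :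
    ‖((t ^ β : ℝ) : ℂ) • mkL2 fun ζ => (weight σ ζ : ℂ) * duhamel m (quadForcing σ β ν) t ζ‖
      ≤ K * betaConst κ (2 * β) * weightNorm (σ - κ * p - (σ - 1)) * T ^ (1 - κ - β) * ‖ν‖ := by
  have hK : 0 ≤ K := zero_le_one.trans hm.one_le
  have hB := betaConst_nonneg κ (2 * β)
  have hW := weightNorm_nonneg (σ - κ * p - (σ - 1))
  rw [norm_smul, Complex.norm_real, Real.norm_eq_abs, abs_of_nonneg (Real.rpow_nonneg ht.1.le _)]
  refine (mul_le_mul_of_nonneg_left (norm_mkL2_weight_mul_duhamel_le hm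
    (isForcing_forcing (2 * β) (σ - 1) ν) hT1 e.two_β_lt e.κ_mem e.gain_σ ht)
    (Real.rpow_nonneg ht.1.le _)).trans ?_
  have h1 : t ^ (1 - κ - β) = t ^ β * t ^ (1 - κ - 2 * β) := by
    rw [← Real.rpow_add ht.1]; ring_nf
  have h2 : t ^ (1 - κ - β) ≤ T ^ (1 - κ - β) :=
    Real.rpow_le_rpow ht.1.le ht.2 (by linarith [e.two_κ_lt, e.two_β_lt])
  calc _ = K * betaConst κ (2 * β) * weightNorm (σ - κ * p - (σ - 1)) * t ^ (1 - κ - β) * ‖ν‖ := by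
        rw [h1]; ring
    _ ≤ _ := by gcongr

/-- The Duhamel integral of a forcing term, in `H ^ σ` with the factor `t ^ β`. -/
def duhamelBFun (hm : IsDissipative m p K) (e : IsExponents p s σ β κ κ') (hT1 : T ≤ 1)
    (ν : Ioc (0 : ℝ) T →ᵇ (ℝ →ᵇ ℂ)) : Ioc (0 : ℝ) T →ᵇ L2 :=
  rescale β (K * betaConst κ (2 * β) * weightNorm (σ - κ * p - (σ - 1)) * T ^ (1 - κ - β) * ‖ν‖)
    (fun t => mkL2 fun ζ => (weight σ ζ : ℂ) * duhamel m (quadForcing σ β ν) t ζ)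
    (continuousOn_mkL2_weight_mul_duhamel hm (isForcing_forcing (2 * β) (σ - 1) ν) hT1
      (by linarith [e.β_nonneg]) e.two_β_lt e.κ_mem e.gain_σ)
    fun _ ht => norm_rescale_duhamel_le hm e hT1 ν ht

theorem duhamelBFun_apply (hm : IsDissipative m p K) (e : IsExponents p s σ β κ κ') (hT1 : T ≤ 1)
    (ν : Ioc (0 : ℝ) T →ᵇ (ℝ →ᵇ ℂ)) (t : Ioc (0 : ℝ) T) : duhamelBFun hm e hT1 ν t =
      (((t : ℝ) ^ β : ℝ) : ℂ) •
        mkL2 fun ζ => (weight σ ζ : ℂ) * duhamel m (quadForcing σ β ν) t ζ := rfl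

theorem norm_duhamelBFun_le (hm : IsDissipative m p K) (e : IsExponents p s σ β κ κ')
    (hT : 0 < T) (hT1 : T ≤ 1) (ν : Ioc (0 : ℝ) T →ᵇ (ℝ →ᵇ ℂ)) : ‖duhamelBFun hm e hT1 ν‖
      ≤ K * betaConst κ (2 * β) * weightNorm (σ - κ * p - (σ - 1)) * T ^ (1 - κ - β) * ‖ν‖ := by
  have hK : 0 ≤ K := zero_le_one.trans hm.one_le
  have hB := betaConst_nonneg κ (2 * β)
  have hW := weightNorm_nonneg (σ - κ * p - (σ - 1))
  exact (BoundedContinuousFunction.norm_le (by positivity)).2 fun t =>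
    norm_rescale_duhamel_le hm e hT1 ν t.2

/-- The Duhamel integral as a linear map into the functions with values in `H ^ σ`, with the factor
`t ^ β`. -/
def duhamelB (hm : IsDissipative m p K) (e : IsExponents p s σ β κ κ') (hT : 0 < T) (hT1 : T ≤ 1) :
    (Ioc (0 : ℝ) T →ᵇ (ℝ →ᵇ ℂ)) →L[ℂ] (Ioc (0 : ℝ) T →ᵇ L2) :=
  LinearMap.mkContinuous
    { toFun := duhamelBFun hm e hT1
      map_add' := fun ν ν' => by
        ext1 t
        rw [BoundedContinuousFunction.add_apply, duhamelBFun_apply, duhamelBFun_apply,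
          duhamelBFun_apply, ← smul_add,
          mkL2_duhamel_add hm hT1 e.two_β_lt e.κ_mem e.gain_σ ν ν' ⟨t.2.1.le, t.2.2⟩]
      map_smul' := fun c ν => by
        ext1 t
        rw [RingHom.id_apply, BoundedContinuousFunction.smul_apply, duhamelBFun_apply,
          duhamelBFun_apply, smul_comm c,
          mkL2_duhamel_smul hm hT1 e.two_β_lt e.κ_mem e.gain_σ c ν ⟨t.2.1.le, t.2.2⟩] }
    (K * betaConst κ (2 * β) * weightNorm (σ - κ * p - (σ - 1)) * T ^ (1 - κ - β))
    (norm_duhamelBFun_le hm e hT hT1)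

theorem duhamelB_apply (hm : IsDissipative m p K) (e : IsExponents p s σ β κ κ') (hT : 0 < T)
    (hT1 : T ≤ 1) (ν : Ioc (0 : ℝ) T →ᵇ (ℝ →ᵇ ℂ)) (t : Ioc (0 : ℝ) T) :
    duhamelB hm e hT hT1 ν t = (((t : ℝ) ^ β : ℝ) : ℂ) •
        mkL2 fun ζ => (weight σ ζ : ℂ) * duhamel m (quadForcing σ β ν) t ζ := rfl

theorem norm_duhamelB_le (hm : IsDissipative m p K) (e : IsExponents p s σ β κ κ')
    (hT : 0 < T) (hT1 : T ≤ 1) (ν : Ioc (0 : ℝ) T →ᵇ (ℝ →ᵇ ℂ)) : ‖duhamelB hm e hT hT1 ν‖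
      ≤ K * betaConst κ (2 * β) * weightNorm (σ - κ * p - (σ - 1)) * T ^ (1 - κ - β) * ‖ν‖ :=
  norm_duhamelBFun_le hm e hT hT1 ν

end Maps

/-! ### A quadratic fixed point problem -/

section FixedPoint

variable {X : Type*} [NormedAddCommGroup X] [NormedSpace ℂ X]

theorem norm_bilin_self_sub_le (B : X →L[ℂ] X →L[ℂ] X) {b r : ℝ} (hb : 0 ≤ b)
    (hB : ∀ x y, ‖B x y‖ ≤ b * ‖x‖ * ‖y‖) {x y : X} (hx : ‖x‖ ≤ r) (hy : ‖y‖ ≤ r) :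
    ‖B x x - B y y‖ ≤ 2 * b * r * ‖x - y‖ := by
  have h : B x x - B y y = B x (x - y) + B (x - y) y := by
    simp only [map_sub, _root_.sub_apply]
    abel
  have h1 := hB x (x - y)
  have h2 := hB (x - y) y
  have h3 : b * ‖x‖ * ‖x - y‖ ≤ b * r * ‖x - y‖ := by gcongr
  have h4 : b * ‖x - y‖ * ‖y‖ ≤ b * ‖x - y‖ * r := by gcongr
  rw [h]
  refine (norm_add_le _ _).trans ?_
  linarith

variable [CompleteSpace X]

/-- The equation `y = a - B(y, y)` has a unique solution in a ball, for small `a`. -/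
theorem existsUnique_quadratic (B : X →L[ℂ] X →L[ℂ] X) {b M : ℝ} (hb : 0 ≤ b)
    (hB : ∀ x y, ‖B x y‖ ≤ b * ‖x‖ * ‖y‖) (hM : 0 < M) (hbM : 4 * b * M < 1) {a : X}
    (ha : ‖a‖ ≤ M) :
    ∃ y, (‖y‖ ≤ 2 * M ∧ y = a - B y y) ∧ ∀ z, ‖z‖ ≤ 2 * M → z = a - B z z → z = y := by
  set f : X → X := fun y => a - B y y with hf
  have hmaps : MapsTo f (Metric.closedBall 0 (2 * M)) (Metric.closedBall 0 (2 * M)) := by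
    intro y hy
    rw [mem_closedBall_zero_iff] at hy ⊢
    have h1 : b * ‖y‖ * ‖y‖ ≤ b * (2 * M) * (2 * M) := by gcongr
    have h2 := (norm_sub_le a (B y y)).trans (add_le_add ha ((hB y y).trans h1))
    nlinarith
  have hlip : ∀ x y, ‖x‖ ≤ 2 * M → ‖y‖ ≤ 2 * M → ‖f x - f y‖ ≤ 4 * b * M * ‖x - y‖ := by
    intro x y hx hy
    have h := norm_bilin_self_sub_le B hb hB hx hy
    rw [hf]
    simp only [sub_sub_sub_cancel_left]
    rw [norm_sub_rev]
    linarith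
  have hc : ContractingWith (⟨4 * b * M, by positivity⟩ : ℝ≥0) hmaps.restrict := by
    refine ⟨by exact_mod_cast hbM, LipschitzWith.of_dist_le_mul fun x y => ?_⟩
    rw [Subtype.dist_eq, Subtype.dist_eq, dist_eq_norm, dist_eq_norm]
    exact hlip x y (mem_closedBall_zero_iff.1 x.2) (mem_closedBall_zero_iff.1 y.2)
  obtain ⟨y, hy, hfy, -⟩ := hc.exists_fixedPoint' (Metric.isClosed_closedBall.isComplete) hmaps
    (x := 0) (Metric.mem_closedBall_self (by positivity)) (edist_ne_top _ _)
  rw [mem_closedBall_zero_iff] at hy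
  have hfy' : f y = y := hfy
  refine ⟨y, ⟨hy, hfy'.symm⟩, fun z hz hfz => ?_⟩
  have h := hlip z y hz hy
  have hfz' : f z = z := hfz.symm
  rw [hfz', hfy'] at h
  have h1 : ‖z - y‖ = 0 := by
    by_contra hne
    have hpos : 0 < ‖z - y‖ := lt_of_le_of_ne (norm_nonneg _) (Ne.symm hne)
    nlinarith
  exact sub_eq_zero.1 (norm_eq_zero.1 h1)

/-- The solution of `y = a - B(y, y)` depends smoothly on `a`: the derivative
`h ↦ h + B(y, h) + B(h, y)` of the inverse map is an invertible perturbation of the identity. -/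
theorem exists_contDiffOn_quadratic (B : X →L[ℂ] X →L[ℂ] X) {b M : ℝ} (hb : 0 ≤ b)
    (hB : ∀ x y, ‖B x y‖ ≤ b * ‖x‖ * ‖y‖) (hM : 0 < M) (hbM : 4 * b * M < 1) :
    ∃ G : X → X, ContDiffOn ℂ ∞ G (Metric.ball 0 M) ∧
      ∀ a ∈ Metric.ball (0 : X) M, G a = a - B (G a) (G a) := by
  classical
  have hex : ∀ a : X, ∃ y, ‖a‖ ≤ M →
      (‖y‖ ≤ 2 * M ∧ y = a - B y y) ∧ ∀ z, ‖z‖ ≤ 2 * M → z = a - B z z → z = y := fun a => by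
    by_cases h : ‖a‖ ≤ M
    · obtain ⟨y, hy⟩ := existsUnique_quadratic B hb hB hM hbM h
      exact ⟨y, fun _ => hy⟩
    · exact ⟨0, fun h' => absurd h' h⟩
  choose G hG using hex
  refine ⟨G, fun a₀ ha₀ => ?_, fun a ha => (hG a (mem_ball_zero_iff.1 ha).le).1.2⟩
  have ha₀' := mem_ball_zero_iff.1 ha₀
  obtain ⟨⟨hy, hfix⟩, -⟩ := hG a₀ ha₀'.le
  set y₀ := G a₀ with hy₀
  have hlt : ‖y₀‖ < 2 * M := by
    have h1 : b * ‖y₀‖ * ‖y₀‖ ≤ b * (2 * M) * (2 * M) := by gcongr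
    have h2 := (norm_sub_le a₀ (B y₀ y₀)).trans (add_le_add_right ((hB y₀ y₀).trans h1) _)
    rw [← hfix] at h2
    nlinarith
  set f : X → X := fun y => y + B y y with hf
  have hfd : ContDiff ℂ ∞ f := by
    rw [hf]
    exact contDiff_id.add (B.contDiff.clm_apply contDiff_id)
  set L : X →L[ℂ] X := -(B y₀ + B.flip y₀) with hL
  have hLn : ‖L‖ < 1 := by
    refine lt_of_le_of_lt (ContinuousLinearMap.opNorm_le_bound _
      (by positivity : 0 ≤ 2 * b * (2 * M)) fun x => ?_) (by linarith)
    have h1 := hB y₀ x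
    have h2 := hB x y₀
    have h3 : b * ‖y₀‖ * ‖x‖ ≤ b * (2 * M) * ‖x‖ := by gcongr
    have h4 : b * ‖x‖ * ‖y₀‖ ≤ b * ‖x‖ * (2 * M) := by gcongr
    have h5 : L x = -(B y₀ x + B x y₀) := by simp [hL]
    rw [h5, norm_neg]
    refine (norm_add_le _ _).trans ?_
    linarith
  -- the derivative of `f` at `y₀` is `1 - L`, with `‖L‖ < 1`
  set E : X ≃L[ℂ] X := ContinuousLinearEquiv.unitsEquiv ℂ X (Units.oneSub L hLn) with hE
  have hder : HasFDerivAt f (E : X →L[ℂ] X) y₀ := by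
    have h1 : HasFDerivAt f (ContinuousLinearMap.id ℂ X + (B y₀ + B.flip y₀)) y₀ := by
      refine (hasFDerivAt_id y₀).add ?_
      have h2 := B.hasFDerivAt_of_bilinear (hasFDerivAt_id y₀) (hasFDerivAt_id y₀)
      refine h2.congr_fderiv ?_
      ext x
      simp
    refine h1.congr_fderiv ?_
    ext x
    have h3 : E x = x - L x := by simp [hE]
    rw [ContinuousLinearEquiv.coe_coe, h3]
    simp [hL]
    abel
  have hcd : ContDiffAt ℂ ∞ f y₀ := hfd.contDiffAt
  have hne : (∞ : WithTop ℕ∞) ≠ 0 := by simp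
  have hfy : f y₀ = a₀ := by
    change y₀ + B y₀ y₀ = a₀
    exact eq_sub_iff_add_eq.1 hfix
  set g := hcd.localInverse hder hne with hg
  have hgc : ContDiffAt ℂ ∞ g a₀ := by
    have := hcd.to_localInverse hder hne
    rwa [hfy] at this
  have hgy : g a₀ = y₀ := by
    have := hcd.localInverse_apply_image hder hne
    rwa [hfy] at this
  have hright : ∀ᶠ a in 𝓝 a₀, f (g a) = a := by
    have := (hcd.hasStrictFDerivAt' hder hne).eventually_right_inverse
    rwa [hfy] at this
  have hball : ∀ᶠ a in 𝓝 a₀, ‖g a‖ < 2 * M := by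
    have h := hgc.continuousAt.norm
    rw [ContinuousAt, hgy] at h
    exact h.eventually_lt_const hlt
  have hM' : ∀ᶠ a in 𝓝 a₀, ‖a‖ < M := continuous_norm.continuousAt.eventually_lt_const ha₀'
  -- by uniqueness in the ball, `G` is the local inverse of `f`
  have hev : G =ᶠ[𝓝 a₀] g := by
    filter_upwards [hright, hball, hM'] with a h1 h2 h3
    refine ((hG a h3.le).2 (g a) h2.le ?_).symm
    exact eq_sub_of_add_eq h1
  exact (hgc.congr_of_eventuallyEq hev).contDiffWithinAt

end FixedPoint

/-! ### The solution map -/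

section SolutionSpace

variable {p s σ β T : ℝ}

/-- The functions `x = ⟨ξ⟩ ^ s * (𝓕 u)` and `v = t ^ β * ⟨ξ⟩ ^ σ * (𝓕 u)` come from the same `u`. -/
def IsCompatible (s σ β : ℝ) (x : C(Icc (0 : ℝ) T, L2)) (v : Ioc (0 : ℝ) T →ᵇ L2) : Prop :=
  ∀ t : Ioc (0 : ℝ) T, v t =ᵐ[volume]
    fun ζ => (((t : ℝ) ^ β : ℝ) : ℂ) * (weight (σ - s) ζ : ℂ) * x ⟨t, t.2.1.le, t.2.2⟩ ζ

/-- The path in `H ^ s` given by `⟨ξ⟩ ^ s * (𝓕 u)`. -/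
def sobolevPath (s : ℝ) (x : C(Icc (0 : ℝ) T, L2)) : C(Icc (0 : ℝ) T, Sobolev s) :=
  ⟨fun t => (Sobolev.equivL2 s).symm (x t), (Sobolev.equivL2 s).symm.continuous.comp x.continuous⟩

theorem sobolevPath_apply (x : C(Icc (0 : ℝ) T, L2)) (t : Icc (0 : ℝ) T) :
    sobolevPath s x t = (Sobolev.equivL2 s).symm (x t) := rfl

theorem fourierFun_equivL2_symm (g : L2) (ζ : ℝ) :
    ((Sobolev.equivL2 s).symm g).fourierFun ζ = (weight (-s) ζ : ℂ) * g ζ := by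
  rw [Sobolev.fourierFun, Sobolev.toL2_equivL2_symm]

theorem IsCompatible.dx_eq {x : C(Icc (0 : ℝ) T, L2)} {v : Ioc (0 : ℝ) T →ᵇ L2}
    (h : IsCompatible s σ β x v) (hσ : 1 ≤ σ) (t : Icc (0 : ℝ) T) (ht : 0 < (t : ℝ)) :
    dx (sobolevPath s x t)
      = (((((t : ℝ) ^ (-β) : ℝ) : ℂ) • velocity σ hσ (v ⟨t, ht, t.2.2⟩) : L2) : 𝓢'(ℝ, ℂ)) := by
  rw [dx_eq_iff, FourierTransform.fourier_smul]
  filter_upwards [Lp.coeFn_smul (((t : ℝ) ^ (-β) : ℝ) : ℂ) (𝓕 (velocity σ hσ (v ⟨t, ht, t.2.2⟩))),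
    fourier_velocity hσ (v ⟨t, ht, t.2.2⟩), h ⟨t, ht, t.2.2⟩] with ζ h1 h2 h3
  rw [h1, Pi.smul_apply, h2, h3, sobolevPath_apply, fourierFun_equivL2_symm, smul_eq_mul]
  have h4 : (((t : ℝ) ^ (-β) : ℝ) : ℂ) * (((t : ℝ) ^ β : ℝ) : ℂ) = 1 := by
    rw [← Complex.ofReal_mul, ← Real.rpow_add ht, neg_add_cancel, Real.rpow_zero,
      Complex.ofReal_one]
  have h5 : (weight (-σ) ζ : ℂ) * (weight (σ - s) ζ : ℂ) = (weight (-s) ζ : ℂ) := by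
    rw [← Complex.ofReal_mul, weight_mul]
    congr 2
    ring
  calc _ = ((((t : ℝ) ^ (-β) : ℝ) : ℂ) * (((t : ℝ) ^ β : ℝ) : ℂ)) * (dsym ζ *
        ((weight (-σ) ζ : ℂ) * (weight (σ - s) ζ : ℂ)) * x t ζ) := by ring
    _ = _ := by rw [h4, h5]; ring

theorem IsCompatible.yTerm_le {x : C(Icc (0 : ℝ) T, L2)} {v : Ioc (0 : ℝ) T →ᵇ L2}
    (h : IsCompatible s σ β x v) (hσ : 1 ≤ σ) (hβ : β ≤ (1 + |s|) / p) (hT1 : T ≤ 1)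
    (t : Icc (0 : ℝ) T) : yTerm p s T (sobolevPath s x) t ≤ ‖x‖ + ‖v‖ := by
  refine add_le_add ?_ ?_
  · rw [sobolevPath_apply, LinearIsometryEquiv.norm_map]
    exact x.norm_coe_le_norm t
  · split
    · rename_i ht
      have h1 := Real.rpow_nonneg ht.le ((1 + |s|) / p)
      have h2 := Real.rpow_nonneg ht.le (-β)
      rw [h.dx_eq hσ t ht, l2norm_coe, norm_smul, Complex.norm_real, Real.norm_eq_abs,
        abs_of_nonneg h2, ← mul_assoc, ← Real.rpow_add ht]
      have h3 : (t : ℝ) ^ ((1 + |s|) / p + -β) ≤ 1 :=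
        Real.rpow_le_one ht.le (t.2.2.trans hT1) (by linarith)
      refine (mul_le_of_le_one_left (norm_nonneg _) h3).trans ?_
      exact (norm_velocity_le hσ _).trans (v.norm_coe_le_norm _)
    · exact norm_nonneg _

/-- The element of `C([0, T]; H ^ s) ∩ Y_T ^ s` given by a compatible pair. -/
def IsCompatible.toYSpace {x : C(Icc (0 : ℝ) T, L2)} {v : Ioc (0 : ℝ) T →ᵇ L2}
    (h : IsCompatible s σ β x v) (hσ : 1 ≤ σ) (hβ : β ≤ (1 + |s|) / p) (hT1 : T ≤ 1) :
    YSpace p s T :=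
  ⟨sobolevPath s x, fun t ht => ⟨_, h.dx_eq hσ t ht⟩, ‖x‖ + ‖v‖, by
    rintro _ ⟨t, rfl⟩
    exact h.yTerm_le hσ hβ hT1 t⟩

theorem IsCompatible.toC_toYSpace {x : C(Icc (0 : ℝ) T, L2)} {v : Ioc (0 : ℝ) T →ᵇ L2}
    (h : IsCompatible s σ β x v) (hσ : 1 ≤ σ) (hβ : β ≤ (1 + |s|) / p) (hT1 : T ≤ 1) :
    YSpace.toC (h.toYSpace hσ hβ hT1) = sobolevPath s x := rfl

/-- The bounded linear map into `C([0, T]; H ^ s) ∩ Y_T ^ s` given by compatible pairs. -/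
def toYSpaceL {E : Type*} [NormedAddCommGroup E] [NormedSpace ℂ E]
    (X : E →L[ℂ] C(Icc (0 : ℝ) T, L2)) (V : E →L[ℂ] (Ioc (0 : ℝ) T →ᵇ L2))
    (h : ∀ e, IsCompatible s σ β (X e) (V e)) (hσ : 1 ≤ σ) (hβ : β ≤ (1 + |s|) / p) (hT1 : T ≤ 1) :
    E →L[ℂ] YSpace p s T :=
  LinearMap.mkContinuous
    { toFun := fun e => (h e).toYSpace hσ hβ hT1
      map_add' := fun e e' => by
        apply YSpace.toC_injective
        ext1 t
        rw [map_add YSpace.toC, ContinuousMap.add_apply]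
        simp only [IsCompatible.toC_toYSpace, sobolevPath_apply, map_add, ContinuousMap.add_apply]
      map_smul' := fun c e => by
        apply YSpace.toC_injective
        ext1 t
        rw [RingHom.id_apply, map_smul YSpace.toC, ContinuousMap.smul_apply]
        simp only [IsCompatible.toC_toYSpace, sobolevPath_apply, map_smul,
          ContinuousMap.smul_apply] }
    (‖X‖ + ‖V‖) fun e => by
      refine Real.iSup_le (fun t => ?_) (by positivity)
      refine ((h e).yTerm_le hσ hβ hT1 t).trans ?_
      rw [add_mul]
      exact add_le_add (X.le_opNorm e) (V.le_opNorm e)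

theorem toFun_eq_toC (f : YSpace p s T) {t : ℝ} (ht : t ∈ Icc 0 T) :
    f.toFun t = YSpace.toC f ⟨t, ht⟩ := dif_pos ht

theorem norm_toFun_le (f : YSpace p s T) (t : ℝ) : ‖f.toFun t‖ ≤ ‖f‖ := by
  by_cases ht : t ∈ Icc 0 T
  · rw [toFun_eq_toC f ht]
    exact (norm_le_yTerm p s T _ _).trans (YSpace.yTerm_le_norm f _)
  · rw [YSpace.toFun, dif_neg ht, norm_zero]
    exact norm_nonneg _

theorem toFun_sub (f g : YSpace p s T) (t : ℝ) : (f - g).toFun t = f.toFun t - g.toFun t := by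
  by_cases ht : t ∈ Icc 0 T
  · rw [toFun_eq_toC _ ht, toFun_eq_toC _ ht, toFun_eq_toC _ ht, map_sub]
    rfl
  · simp [YSpace.toFun, ht]

theorem continuousOn_toFun (f : YSpace p s T) : ContinuousOn f.toFun (Icc 0 T) := by
  rw [continuousOn_iff_continuous_domRestrict]
  refine (YSpace.toC f).continuous.congr fun t => ?_
  rw [domRestrict_apply, toFun_eq_toC f t.2]

end SolutionSpace

theorem contDiffOn_bilin_self {E X Z : Type*} [NormedAddCommGroup E] [NormedSpace ℂ E]
    [NormedAddCommGroup X] [NormedSpace ℂ X] [NormedAddCommGroup Z] [NormedSpace ℂ Z]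
    (N : X →L[ℂ] X →L[ℂ] Z) {g : E → X} {D : Set E} (hg : ContDiffOn ℂ ∞ g D) :
    ContDiffOn ℂ ∞ (fun u => N (g u) (g u)) D :=
  (N.contDiff.comp_contDiffOn hg).clm_apply hg

section SolutionMap

variable {m : ℝ → ℂ} {p K s σ β κ κ' T : ℝ}

theorem isCompatible_flow (hm : IsDissipative m p K) (e : IsExponents p s σ β κ κ')
    (hT1 : T ≤ 1) (g : L2) : IsCompatible s σ β (flowC hm hT1 g) (flowB hm hT1 e.β_mem g) := by
  intro t
  have ht : (t : ℝ) ∈ Ioc (0 : ℝ) 1 := ⟨t.2.1, t.2.2.trans hT1⟩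
  rw [flowB_apply, flowC_apply]
  filter_upwards [Lp.coeFn_smul (((t : ℝ) ^ β : ℝ) : ℂ)
      (mkL2 fun ζ => (weight (β * p) ζ : ℂ) * Complex.exp ((t : ℝ) * m ζ) * g ζ),
    coeFn_mkL2 (memLp_weight_mul_exp hm e.β_mem ht g).1,
    coeFn_mkL2 (memLp_exp_mul hm ⟨ht.1.le, ht.2⟩ g).1] with ζ h1 h2 h3
  rw [h1, Pi.smul_apply, h2, h3, smul_eq_mul, e.β_mul]
  ring

theorem isCompatible_duhamel (hm : IsDissipative m p K) (e : IsExponents p s σ β κ κ')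
    (hT : 0 < T) (hT1 : T ≤ 1) (ν : Ioc (0 : ℝ) T →ᵇ (ℝ →ᵇ ℂ)) :
    IsCompatible s σ β (duhamelC hm e hT1 ν) (duhamelB hm e hT hT1 ν) := by
  intro t
  have hn := isForcing_forcing (2 * β) (σ - 1) ν
  rw [duhamelB_apply, duhamelC_apply]
  filter_upwards [Lp.coeFn_smul (((t : ℝ) ^ β : ℝ) : ℂ)
      (mkL2 fun ζ => (weight σ ζ : ℂ) * duhamel m (quadForcing σ β ν) t ζ),
    coeFn_mkL2 (memLp_weight_mul_duhamel hm hn hT1 e.two_β_lt e.κ_mem e.gain_σ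
      ⟨t.2.1.le, t.2.2⟩),
    coeFn_mkL2 (memLp_weight_mul_duhamel hm hn hT1 e.two_β_lt e.κ'_mem e.gain_s
      ⟨t.2.1.le, t.2.2⟩)] with ζ h1 h2 h3
  rw [h1, Pi.smul_apply, h2, h3, smul_eq_mul]
  have h4 : (weight σ ζ : ℂ) = (weight (σ - s) ζ : ℂ) * (weight s ζ : ℂ) := by
    rw [← Complex.ofReal_mul, weight_mul, sub_add_cancel]
  rw [h4]
  ring

theorem IsCompatible.sub {x x' : C(Icc (0 : ℝ) T, L2)} {v v' : Ioc (0 : ℝ) T →ᵇ L2}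
    (h : IsCompatible s σ β x v) (h' : IsCompatible s σ β x' v') :
    IsCompatible s σ β (x - x') (v - v') := by
  intro t
  rw [BoundedContinuousFunction.sub_apply, ContinuousMap.sub_apply]
  filter_upwards [Lp.coeFn_sub (v t) (v' t), h t, h' t,
    Lp.coeFn_sub (x ⟨t, t.2.1.le, t.2.2⟩) (x' ⟨t, t.2.1.le, t.2.2⟩)] with ζ h1 h2 h3 h4
  rw [h1, h4, Pi.sub_apply, Pi.sub_apply, h2, h3, mul_sub]

/-- The solution map on a ball of `H ^ s`, for a time that depends on the radius. The solutions are
described on the Fourier side by the Duhamel formula; `y` is `t ^ β * ⟨ξ⟩ ^ σ * (𝓕 u)`. -/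
theorem exists_solutionMap (hm : IsDissipative m p K) (e : IsExponents p s σ β κ κ') {R : ℝ}
    (hR : 0 < R) : ∃ T, 0 < T ∧ T ≤ 1 ∧ ∃ S : Sobolev s → YSpace p s T,
      ContDiffOn ℂ ∞ S (Metric.ball 0 R) ∧
      ∀ u₀ ∈ Metric.ball (0 : Sobolev s) R, ∃ y : Ioc (0 : ℝ) T →ᵇ L2,
        (∀ t ∈ Icc 0 T, ((S u₀).toFun t).fourierFun =ᵐ[volume] fun ζ =>
          Complex.exp (t * m ζ) * u₀.fourierFun ζ -
            duhamel m (quadForcing σ β (bilinBCF _ (weightedMul σ e.one_le_σ) y y)) t ζ) ∧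
        ∀ t : Ioc (0 : ℝ) T, y t =ᵐ[volume]
          fun ζ => (((t : ℝ) ^ β : ℝ) : ℂ) * (weight σ ζ : ℂ) * ((S u₀).toFun t).fourierFun ζ := by
  have hK : 0 < K := zero_lt_one.trans_le hm.one_le
  set b₀ : ℝ := K * betaConst κ (2 * β) * weightNorm (σ - κ * p - (σ - 1)) with hb₀
  have hb₀0 : 0 ≤ b₀ :=
    mul_nonneg (mul_nonneg hK.le (betaConst_nonneg _ _)) (weightNorm_nonneg _)
  have hpos : 0 < 1 - κ - β := by linarith [e.two_κ_lt, e.two_β_lt]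
  -- the time is chosen such that the Duhamel term is a contraction
  obtain ⟨T, hT, hT1, hTs⟩ : ∃ T : ℝ, 0 < T ∧ T ≤ 1 ∧
      4 * (b₀ * T ^ (1 - κ - β) * 2 ^ ((σ - 1) / 2)) * (K * R) < 1 := by
    have h1 : Tendsto (fun T : ℝ => 4 * (b₀ * T ^ (1 - κ - β) * 2 ^ ((σ - 1) / 2)) * (K * R))
        (𝓝[>] 0) (𝓝 (4 * (b₀ * 0 ^ (1 - κ - β) * 2 ^ ((σ - 1) / 2)) * (K * R))) := by
      refine Tendsto.mono_left ?_ nhdsWithin_le_nhds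
      exact ((((Real.continuousAt_rpow_const 0 _ (Or.inr hpos.le)).tendsto.const_mul b₀).mul_const
        _).const_mul 4).mul_const _
    rw [Real.zero_rpow hpos.ne', mul_zero, zero_mul, mul_zero, zero_mul] at h1
    have h2 := (h1.eventually_lt_const zero_lt_one).and
      (Ioc_mem_nhdsGT (zero_lt_one (α := ℝ)))
    obtain ⟨T, h3, h4⟩ := h2.exists
    exact ⟨T, h4.1, h4.2, h3⟩
  refine ⟨T, hT, hT1, ?_⟩
  set N := bilinBCF (Ioc (0 : ℝ) T) (weightedMul σ e.one_le_σ) with hN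
  set B := (ContinuousLinearMap.compL ℂ _ _ _ (duhamelB hm e hT hT1)) ∘L N with hB
  have hBa : ∀ x y, B x y = duhamelB hm e hT hT1 (N x y) := fun x y => rfl
  have hBn : ∀ x y, ‖B x y‖ ≤ b₀ * T ^ (1 - κ - β) * 2 ^ ((σ - 1) / 2) * ‖x‖ * ‖y‖ := by
    intro x y
    have h1 : ‖N x y‖ ≤ 2 ^ ((σ - 1) / 2) * ‖x‖ * ‖y‖ :=
      (BoundedContinuousFunction.norm_le (by positivity)).2 fun t => by
        rw [hN, bilinBCF_apply]
        refine (norm_weightedMul_le _ _ _).trans ?_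
        gcongr
        · exact x.norm_coe_le_norm t
        · exact y.norm_coe_le_norm t
    rw [hBa]
    refine (norm_duhamelB_le hm e hT hT1 _).trans ?_
    calc _ ≤ b₀ * T ^ (1 - κ - β) * (2 ^ ((σ - 1) / 2) * ‖x‖ * ‖y‖) :=
          mul_le_mul_of_nonneg_left h1 (by positivity)
      _ = _ := by ring
  obtain ⟨G, hG, hGfix⟩ := exists_contDiffOn_quadratic B (by positivity) hBn (mul_pos hK hR) hTs
  set J : Sobolev s →L[ℂ] L2 := (Sobolev.equivL2 s).toContinuousLinearEquiv.toContinuousLinearMap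
    with hJ
  have hJa : ∀ u, J u = u.toL2 := fun u => rfl
  set A : Sobolev s →L[ℂ] (Ioc (0 : ℝ) T →ᵇ L2) := flowB hm hT1 e.β_mem ∘L J with hA
  have hAball : ∀ u ∈ Metric.ball (0 : Sobolev s) R, A u ∈ Metric.ball (0 : Ioc (0 : ℝ) T →ᵇ L2)
      (K * R) := by
    intro u hu
    rw [mem_ball_zero_iff] at hu ⊢
    exact (norm_flowB_le hm hT1 e.β_mem (J u)).trans_lt (mul_lt_mul_of_pos_left hu hK)
  set AY : Sobolev s →L[ℂ] YSpace p s T := toYSpaceL (flowC hm hT1) (flowB hm hT1 e.β_mem)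
    (isCompatible_flow hm e hT1) e.one_le_σ e.β_le hT1 ∘L J with hAY
  set DY : (Ioc (0 : ℝ) T →ᵇ (ℝ →ᵇ ℂ)) →L[ℂ] YSpace p s T := toYSpaceL (duhamelC hm e hT1)
    (duhamelB hm e hT hT1) (isCompatible_duhamel hm e hT hT1) e.one_le_σ e.β_le hT1 with hDY
  refine ⟨fun u => AY u - DY (N (G (A u)) (G (A u))), ?_, fun u₀ hu₀ => ⟨G (A u₀), ?_⟩⟩
  · have h1 : ContDiffOn ℂ ∞ (fun u => G (A u)) (Metric.ball 0 R) :=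
      hG.comp A.contDiff.contDiffOn hAball
    have h2 : ContDiffOn ℂ ∞ (fun u => N (G (A u)) (G (A u))) (Metric.ball 0 R) :=
      contDiffOn_bilin_self N h1
    exact AY.contDiff.contDiffOn.sub (DY.contDiff.comp_contDiffOn h2)
  set y := G (A u₀) with hy
  have hyfix : y = A u₀ - duhamelB hm e hT hT1 (N y y) := hGfix _ (hAball u₀ hu₀)
  have hx : ∀ t : Icc (0 : ℝ) T, (AY u₀ - DY (N y y)).toFun t = (Sobolev.equivL2 s).symm
      ((flowC hm hT1 u₀.toL2 - duhamelC hm e hT1 (N y y)) t) := fun t => by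
    rw [toFun_eq_toC _ t.2, map_sub, ContinuousMap.sub_apply, ContinuousMap.sub_apply, map_sub]
    rfl
  constructor
  · intro t ht
    have h1 := hx ⟨t, ht⟩
    change (AY u₀ - DY (N y y)).toFun t = _ at h1
    change ((AY u₀ - DY (N y y)).toFun t).fourierFun =ᵐ[volume] _
    rw [h1, ContinuousMap.sub_apply, flowC_apply, duhamelC_apply]
    filter_upwards [Lp.coeFn_sub (mkL2 fun ζ => Complex.exp (t * m ζ) * u₀.toL2 ζ)
        (mkL2 fun ζ => (weight s ζ : ℂ) * duhamel m (quadForcing σ β (N y y)) t ζ),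
      coeFn_mkL2 (memLp_exp_mul hm ⟨ht.1, ht.2.trans hT1⟩ u₀.toL2).1,
      coeFn_mkL2 (memLp_weight_mul_duhamel hm (isForcing_forcing (2 * β) (σ - 1) (N y y)) hT1
        e.two_β_lt e.κ'_mem e.gain_s ht)] with ζ h2 h3 h4
    rw [fourierFun_equivL2_symm, h2, Pi.sub_apply, h3, h4, Sobolev.fourierFun]
    have h5 : (weight (-s) ζ : ℂ) * (weight s ζ : ℂ) = 1 := by
      rw [← Complex.ofReal_mul, mul_comm, weight_mul_neg, Complex.ofReal_one]
    linear_combination (-duhamel m (quadForcing σ β (N y y)) t ζ) * h5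
  · intro t
    have h1 := ((isCompatible_flow hm e hT1 u₀.toL2).sub
      (isCompatible_duhamel hm e hT hT1 (N y y))) t
    have h2 : flowB hm hT1 e.β_mem u₀.toL2 - duhamelB hm e hT hT1 (N y y) = y := hyfix.symm
    rw [h2] at h1
    have h3 := hx ⟨t, t.2.1.le, t.2.2⟩
    change (AY u₀ - DY (N y y)).toFun t = _ at h3
    filter_upwards [h1] with ζ h4
    change _ = _ * ((AY u₀ - DY (N y y)).toFun t).fourierFun ζ
    rw [h4, h3, fourierFun_equivL2_symm]
    have h5 : (weight (σ - s) ζ : ℂ) = (weight σ ζ : ℂ) * (weight (-s) ζ : ℂ) := by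
      rw [← Complex.ofReal_mul, weight_mul, sub_eq_add_neg]
    rw [h5]
    ring

end SolutionMap

/-! ### The linear equation at a fixed frequency -/

/-- Integration by parts for a smooth function and the primitive of an integrable function. -/
theorem integral_deriv_mul_primitive {f g g' : ℝ → ℂ} {b : ℝ} (hb : 0 ≤ b)
    (hf : IntervalIntegrable f volume 0 b) (hg : ∀ t, HasDerivAt g (g' t) t)
    (hg' : Continuous g') :
    ∫ t in (0 : ℝ)..b, g' t * ∫ τ in (0 : ℝ)..t, f τ
      = (g b * ∫ τ in (0 : ℝ)..b, f τ) - ∫ τ in (0 : ℝ)..b, g τ * f τ := by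
  have hfi : IntegrableOn f (Ioc 0 b) := (intervalIntegrable_iff_integrableOn_Ioc_of_le hb).1 hf
  have hgi : IntegrableOn g' (Ioc 0 b) :=
    (intervalIntegrable_iff_integrableOn_Ioc_of_le hb).1 (hg'.intervalIntegrable 0 b)
  have hgc : Continuous g := continuous_iff_continuousAt.2 fun t => (hg t).continuousAt
  set H : ℝ → ℝ → ℂ := fun t τ => {q : ℝ × ℝ | q.2 ≤ q.1}.indicator (fun q => g' q.1 * f q.2) (t, τ)
    with hH
  have hHi : Integrable (Function.uncurry H)
      ((volume.restrict (Ioc 0 b)).prod (volume.restrict (Ioc 0 b))) :=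
    (Integrable.mul_prod hgi hfi).indicator (measurableSet_le measurable_snd measurable_fst)
  have h1 : ∀ t ∈ Ioc 0 b, ∫ τ in Ioc 0 b, H t τ = g' t * ∫ τ in (0 : ℝ)..t, f τ := by
    intro t ht
    have h2 : ∀ τ, H t τ = (Iic t).indicator (fun τ => g' t * f τ) τ := fun τ => by
      simp only [hH, indicator, mem_ofPred_eq, mem_Iic]
    simp only [h2]
    rw [setIntegral_indicator measurableSet_Iic, Ioc_inter_Iic, min_eq_right ht.2,
      integral_const_mul, intervalIntegral.integral_of_le ht.1.le]
  have h3 : ∀ τ ∈ Ioc 0 b, ∫ t in Ioc 0 b, H t τ = (g b - g τ) * f τ := by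
    intro τ hτ
    have h2 : ∀ t, H t τ = (Ici τ).indicator (fun t => g' t * f τ) t := fun t => by
      simp only [hH, indicator, mem_ofPred_eq, mem_Ici]
    have h4 : Ioc 0 b ∩ Ici τ = Icc τ b := by
      ext x
      simp only [mem_inter_iff, mem_Ioc, mem_Ici, mem_Icc]
      constructor
      · rintro ⟨⟨-, h⟩, h'⟩
        exact ⟨h', h⟩
      · rintro ⟨h, h'⟩
        exact ⟨⟨hτ.1.trans_le h, h'⟩, h⟩
    simp only [h2]
    rw [setIntegral_indicator measurableSet_Ici, h4, integral_mul_const, integral_Icc_eq_integral_Ioc,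
      ← intervalIntegral.integral_of_le hτ.2,
      intervalIntegral.integral_eq_sub_of_hasDerivAt (fun t _ => hg t)
        (hg'.intervalIntegrable τ b)]
  have h5 := integral_integral_swap hHi
  rw [setIntegral_congr_fun measurableSet_Ioc h1, setIntegral_congr_fun measurableSet_Ioc h3] at h5
  rw [intervalIntegral.integral_of_le hb, h5, ← intervalIntegral.integral_of_le hb,
    ← intervalIntegral.integral_const_mul, ← intervalIntegral.integral_sub (hf.const_mul _)
      (hf.continuousOn_mul hgc.continuousOn)]
  simp only [sub_mul]

section ScalarODE

variable {μ c : ℂ} {n : ℝ → ℂ} {T : ℝ}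

/-- The solution of `y' = μ y - n`, `y(0) = c`, given by the Duhamel formula. -/
def scalarFlow (μ c : ℂ) (n : ℝ → ℂ) (t : ℝ) : ℂ :=
  Complex.exp (t * μ) * c - ∫ τ in (0 : ℝ)..t, Complex.exp (((t - τ : ℝ) : ℂ) * μ) * n τ

theorem scalarFlow_eq (μ c : ℂ) (n : ℝ → ℂ) (t : ℝ) : scalarFlow μ c n t =
    Complex.exp (t * μ) * (c - ∫ τ in (0 : ℝ)..t, Complex.exp (-τ * μ) * n τ) := by
  rw [scalarFlow, mul_sub, ← intervalIntegral.integral_const_mul]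
  congr 2
  ext τ
  rw [← mul_assoc, ← Complex.exp_add]
  congr 2
  push_cast
  ring

theorem intervalIntegrable_exp_neg_mul (hn : IntervalIntegrable n volume 0 T) :
    IntervalIntegrable (fun τ : ℝ => Complex.exp (-τ * μ) * n τ) volume 0 T :=
  hn.continuousOn_mul (Continuous.continuousOn (by fun_prop))

theorem IntervalIntegrable.mono_zero {f : ℝ → ℂ} (hf : IntervalIntegrable f volume 0 T) {t : ℝ}
    (ht : t ∈ Icc 0 T) : IntervalIntegrable f volume 0 t :=
  hf.mono_set (by rw [uIcc_of_le ht.1, uIcc_of_le (ht.1.trans ht.2)]; exact Icc_subset_Icc_right ht.2)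

theorem continuousOn_scalarFlow (hT : 0 ≤ T) (hn : IntervalIntegrable n volume 0 T) :
    ContinuousOn (scalarFlow μ c n) (Icc 0 T) := by
  have h := intervalIntegral.continuousOn_primitive_interval' (intervalIntegrable_exp_neg_mul
    (μ := μ) hn) left_mem_uIcc
  rw [uIcc_of_le hT] at h
  refine ContinuousOn.congr ?_ fun t _ => scalarFlow_eq μ c n t
  exact ContinuousOn.mul (Continuous.continuousOn (by fun_prop)) (continuousOn_const.sub h)

theorem intervalIntegrable_scalarFlow (hT : 0 ≤ T) (hn : IntervalIntegrable n volume 0 T) {t : ℝ}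
    (ht : t ∈ Icc 0 T) : IntervalIntegrable (scalarFlow μ c n) volume 0 t :=
  ContinuousOn.intervalIntegrable (by
    rw [uIcc_of_le ht.1]
    exact (continuousOn_scalarFlow hT hn).mono (Icc_subset_Icc_right ht.2))

theorem scalarFlow_eq_add_integral (hT : 0 ≤ T) (hn : IntervalIntegrable n volume 0 T) {t : ℝ}
    (ht : t ∈ Icc 0 T) :
    scalarFlow μ c n t = c + ∫ τ in (0 : ℝ)..t, (μ * scalarFlow μ c n τ - n τ) := by
  have hnt := IntervalIntegrable.mono_zero hn ht
  have hg : ∀ t : ℝ, HasDerivAt (fun t : ℝ => Complex.exp (t * μ)) (μ * Complex.exp (t * μ)) t := by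
    intro t
    have h := ((Complex.ofRealCLM.hasDerivAt (x := t)).mul_const μ).cexp
    simpa [mul_comm] using h
  have h1 := integral_deriv_mul_primitive ht.1 (intervalIntegrable_exp_neg_mul (μ := μ) hnt) hg
    (by fun_prop)
  have h2 : ∫ τ in (0 : ℝ)..t, μ * Complex.exp (τ * μ) = Complex.exp (t * μ) - 1 := by
    rw [intervalIntegral.integral_eq_sub_of_hasDerivAt (fun t _ => hg t)
      (Continuous.intervalIntegrable (by fun_prop) 0 t)]
    simp
  have h3 : ∫ τ in (0 : ℝ)..t, Complex.exp (τ * μ) * (Complex.exp (-τ * μ) * n τ)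
      = ∫ τ in (0 : ℝ)..t, n τ := by
    congr 1
    ext τ
    rw [← mul_assoc, ← Complex.exp_add]
    simp
  rw [h3] at h1
  have h4 : (fun τ => μ * scalarFlow μ c n τ) = fun τ : ℝ => μ * Complex.exp (τ * μ) * c -
      μ * Complex.exp (τ * μ) * ∫ σ in (0 : ℝ)..τ, Complex.exp (-σ * μ) * n σ := by
    ext τ
    rw [scalarFlow_eq]
    ring
  have h5 := intervalIntegral.continuousOn_primitive_interval' (intervalIntegrable_exp_neg_mul
    (μ := μ) hnt) left_mem_uIcc
  have h6 : IntervalIntegrable (fun τ : ℝ =>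
      μ * Complex.exp (τ * μ) * ∫ σ in (0 : ℝ)..τ, Complex.exp (-σ * μ) * n σ) volume 0 t :=
    (ContinuousOn.mul (Continuous.continuousOn (by fun_prop)) h5).intervalIntegrable
  rw [intervalIntegral.integral_sub ((intervalIntegrable_scalarFlow hT hn ht).const_mul μ) hnt, h4,
    intervalIntegral.integral_sub (Continuous.intervalIntegrable (by fun_prop) 0 t) h6, h1,
    intervalIntegral.integral_mul_const, h2, scalarFlow_eq]
  ring

theorem scalarFlow_sub (hT : 0 ≤ T) (hn : IntervalIntegrable n volume 0 T) {a b : ℝ}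
    (ha : a ∈ Icc 0 T) (hb : b ∈ Icc 0 T) :
    scalarFlow μ c n b - scalarFlow μ c n a
      = ∫ τ in a..b, (μ * scalarFlow μ c n τ - n τ) := by
  have h : ∀ t ∈ Icc 0 T,
      IntervalIntegrable (fun τ => μ * scalarFlow μ c n τ - n τ) volume 0 t := fun t ht =>
    ((intervalIntegrable_scalarFlow hT hn ht).const_mul μ).sub (IntervalIntegrable.mono_zero hn ht)
  rw [scalarFlow_eq_add_integral hT hn ha, scalarFlow_eq_add_integral hT hn hb,
    ← intervalIntegral.integral_interval_sub_left (h b hb) (h a ha)]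
  ring

/-- A solution of the integrated equation is given by the Duhamel formula. -/
theorem eq_scalarFlow (hT : 0 ≤ T) (hn : IntervalIntegrable n volume 0 T) {y z : ℝ → ℂ}
    (hyi : IntervalIntegrable y volume 0 T)
    (hz : ∀ t, z t = c + ∫ τ in (0 : ℝ)..t, (μ * y τ - n τ))
    (hy : ∀ᵐ t ∂volume.restrict (Ioc 0 T), y t = z t) {t : ℝ} (ht : t ∈ Icc 0 T) :
    z t = scalarFlow μ c n t := by
  have hF : IntervalIntegrable (fun τ => μ * y τ - n τ) volume 0 T := (hyi.const_mul μ).sub hn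
  have hzc : ContinuousOn z (Icc 0 T) := by
    have h := intervalIntegral.continuousOn_primitive_interval' hF left_mem_uIcc
    rw [uIcc_of_le hT] at h
    exact (continuousOn_const.add h).congr fun t _ => hz t
  have hVc := continuousOn_scalarFlow (μ := μ) (c := c) hT hn
  set D := fun t => z t - scalarFlow μ c n t with hD
  have hDc : ContinuousOn D (Icc 0 T) := hzc.sub hVc
  have hDi : ∀ t ∈ Icc 0 T, IntervalIntegrable D volume 0 t := fun t ht =>
    ContinuousOn.intervalIntegrable (by
      rw [uIcc_of_le ht.1]
      exact hDc.mono (Icc_subset_Icc_right ht.2))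
  have hDeq : ∀ t ∈ Icc 0 T, D t = μ * ∫ τ in (0 : ℝ)..t, D τ := by
    intro t ht
    have h1 : ∫ τ in (0 : ℝ)..t, (μ * y τ - n τ) = ∫ τ in (0 : ℝ)..t, (μ * z τ - n τ) := by
      rw [intervalIntegral.integral_of_le ht.1, intervalIntegral.integral_of_le ht.1]
      refine integral_congr_ae ?_
      filter_upwards [ae_restrict_of_ae_restrict_of_subset (Ioc_subset_Ioc_right ht.2) hy]
        with τ hτ
      rw [hτ]
    have hzi : IntervalIntegrable z volume 0 t := ContinuousOn.intervalIntegrable (by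
      rw [uIcc_of_le ht.1]
      exact hzc.mono (Icc_subset_Icc_right ht.2))
    have hnt := IntervalIntegrable.mono_zero hn ht
    have hVi := intervalIntegrable_scalarFlow (μ := μ) (c := c) hT hn ht
    simp only [hD]
    rw [hz t, h1, scalarFlow_eq_add_integral hT hn ht, add_sub_add_left_eq_sub,
      ← intervalIntegral.integral_const_mul,
      ← intervalIntegral.integral_sub ((hzi.const_mul μ).sub hnt) ((hVi.const_mul μ).sub hnt)]
    congr 1
    ext τ
    ring
  have hE : ∀ t ∈ Icc 0 T, ∫ τ in (0 : ℝ)..t, D τ = 0 := by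
    refine eq_zero_of_abs_deriv_le_mul_abs_self_of_eq_zero_right (f' := D) (K := ‖μ‖) ?_ ?_ ?_ ?_
    · have h := intervalIntegral.continuousOn_primitive_interval' (hDi T ⟨hT, le_rfl⟩) left_mem_uIcc
      rwa [uIcc_of_le hT] at h
    · intro x hx
      have hnhds : Icc 0 T ∈ 𝓝[>] x :=
        mem_of_superset (Ioc_mem_nhdsGT hx.2) fun z hz => ⟨hx.1.trans hz.1.le, hz.2⟩
      refine intervalIntegral.integral_hasDerivWithinAt_right (hDi x ⟨hx.1, hx.2.le⟩) ?_ ?_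
        (t := Ioi x)
      · exact ⟨Icc 0 T, hnhds, hDc.aestronglyMeasurable measurableSet_Icc⟩
      · have h := hDc x ⟨hx.1, hx.2.le⟩
        exact (h.mono_of_mem_nhdsWithin hnhds)
    · simp
    · intro x hx
      rw [hDeq x ⟨hx.1, hx.2.le⟩, norm_mul]
  have h := hDeq t ht
  rw [hE t ht, mul_zero] at h
  exact sub_eq_zero.1 h

end ScalarODE

/-! ### Functions of time and frequency -/

/-- The function `F(t, ζ)` is integrable on `(a, b] × ℝ` with respect to some weight
`⟨ξ⟩ ^ (-M)`. -/
def TemperedIntegrableOn (F : ℝ → ℝ → ℂ) (a b : ℝ) : Prop :=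
  ∃ M : ℝ, Integrable (fun q : ℝ × ℝ => (weight (-M) q.2 : ℂ) * F q.1 q.2)
    ((volume.restrict (Ioc a b)).prod volume)

section TemperedIntegrableOn

variable {F G : ℝ → ℝ → ℂ} {a b : ℝ}

theorem TemperedIntegrableOn.mono_weight {M M' : ℝ} (h : M ≤ M')
    (hM : Integrable (fun q : ℝ × ℝ => (weight (-M) q.2 : ℂ) * F q.1 q.2)
      ((volume.restrict (Ioc a b)).prod volume)) :
    Integrable (fun q : ℝ × ℝ => (weight (-M') q.2 : ℂ) * F q.1 q.2)
      ((volume.restrict (Ioc a b)).prod volume) := by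
  refine (hM.bdd_mul (c := 1) ((continuous_weight_ofReal (M - M')).comp
    continuous_snd).aestronglyMeasurable (Eventually.of_forall fun q => ?_)).congr
    (Eventually.of_forall fun q => ?_)
  · rw [Function.comp_apply, norm_weight_ofReal]
    exact weight_le_one (by linarith) q.2
  · show (weight (M - M') q.2 : ℂ) * ((weight (-M) q.2 : ℂ) * F q.1 q.2) = _
    rw [← mul_assoc, ← Complex.ofReal_mul, weight_mul]
    ring_nf

theorem TemperedIntegrableOn.sub (hF : TemperedIntegrableOn F a b)
    (hG : TemperedIntegrableOn G a b) :
    TemperedIntegrableOn (fun t ζ => F t ζ - G t ζ) a b := by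
  obtain ⟨M, hM⟩ := hF
  obtain ⟨M', hM'⟩ := hG
  refine ⟨max M M', ((TemperedIntegrableOn.mono_weight (le_max_left M M') hM).sub
    (TemperedIntegrableOn.mono_weight (le_max_right M M') hM')).congr
    (Eventually.of_forall fun q => ?_)⟩
  simp [mul_sub]

theorem TemperedIntegrableOn.mono (hF : TemperedIntegrableOn F a b) {a' b' : ℝ} (ha : a ≤ a')
    (hb : b' ≤ b) : TemperedIntegrableOn F a' b' := by
  obtain ⟨M, hM⟩ := hF
  refine ⟨M, hM.mono_measure ?_⟩
  exact Measure.prod_mono (Measure.restrict_mono (Ioc_subset_Ioc ha hb) le_rfl) le_rfl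

theorem TemperedIntegrableOn.integrable_mul_schwartz (hF : TemperedIntegrableOn F a b)
    (ψ : 𝓢(ℝ, ℂ)) : Integrable (fun q : ℝ × ℝ => F q.1 q.2 * ψ q.2)
      ((volume.restrict (Ioc a b)).prod volume) := by
  obtain ⟨M, hM⟩ := hF
  obtain ⟨C, hC⟩ := exists_bound_weight_mul_schwartz M ψ
  refine (hM.mul_bdd (c := C) ((((continuous_weight_ofReal M).mul ψ.continuous).comp
    continuous_snd).aestronglyMeasurable) (Eventually.of_forall fun q => hC q.2)).congr
    (Eventually.of_forall fun q => ?_)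
  have h : (weight M q.2 : ℂ) * (weight (-M) q.2 : ℂ) = 1 := by
    exact_mod_cast weight_mul_neg M q.2
  show (weight (-M) q.2 : ℂ) * F q.1 q.2 * ((weight M q.2 : ℂ) * ψ q.2) = F q.1 q.2 * ψ q.2
  linear_combination (F q.1 q.2 * ψ q.2) * h

theorem weight_ofReal_ne_zero (r ζ : ℝ) : (weight r ζ : ℂ) ≠ 0 :=
  Complex.ofReal_ne_zero.2 (weight_pos r ζ).ne'

theorem TemperedIntegrableOn.ae_integrableOn (hF : TemperedIntegrableOn F a b) :
    ∀ᵐ ζ, IntegrableOn (fun t => F t ζ) (Ioc a b) := by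
  obtain ⟨M, hM⟩ := hF
  filter_upwards [hM.prod_left_ae] with ζ hζ
  refine (hζ.const_mul (weight (-M) ζ : ℂ)⁻¹).congr (Eventually.of_forall fun t => ?_)
  exact inv_mul_cancel_left₀ (weight_ofReal_ne_zero _ _) _

theorem TemperedIntegrableOn.temperedIntegrable_integral (hF : TemperedIntegrableOn F a b)
    (hab : a ≤ b) : TemperedIntegrable fun ζ => ∫ t in a..b, F t ζ := by
  obtain ⟨M, hM⟩ := hF
  refine ⟨M, hM.integral_prod_right.congr (Eventually.of_forall fun ζ => ?_)⟩
  show ∫ t in Ioc a b, (weight (-M) ζ : ℂ) * F t ζ = _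
  rw [integral_const_mul, ← intervalIntegral.integral_of_le hab]

theorem TemperedIntegrableOn.integral_integral_mul (hF : TemperedIntegrableOn F a b)
    (hab : a ≤ b) (ψ : 𝓢(ℝ, ℂ)) :
    ∫ ζ, (∫ t in a..b, F t ζ) * ψ ζ = ∫ t in a..b, ∫ ζ, F t ζ * ψ ζ := by
  have h := integral_integral_swap (f := fun t ζ => F t ζ * ψ ζ) (hF.integrable_mul_schwartz ψ)
  rw [intervalIntegral.integral_of_le hab]
  refine Eq.trans ?_ h.symm
  congr 1
  ext ζ
  rw [intervalIntegral.integral_of_le hab, integral_mul_const]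

/-- The equation `f' = F`, integrated over `[a, b]`, holds in the sense of distributions if and
only if it holds at almost every frequency. -/
theorem TemperedIntegrableOn.forall_schwartz_iff (hF : TemperedIntegrableOn F a b) (hab : a ≤ b)
    {f g : ℝ → ℂ} (hf : TemperedIntegrable f) (hg : TemperedIntegrable g) :
    (∀ ψ : 𝓢(ℝ, ℂ), (∫ ζ, f ζ * ψ ζ) - ∫ ζ, g ζ * ψ ζ = ∫ t in a..b, ∫ ζ, F t ζ * ψ ζ) ↔
      (fun ζ => f ζ - g ζ) =ᵐ[volume] fun ζ => ∫ t in a..b, F t ζ := by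
  have hI := hF.temperedIntegrable_integral hab
  have key : ∀ ψ : 𝓢(ℝ, ℂ), (∫ ζ, (f ζ - g ζ - ∫ t in a..b, F t ζ) * ψ ζ) =
      (∫ ζ, f ζ * ψ ζ) - (∫ ζ, g ζ * ψ ζ) - ∫ t in a..b, ∫ ζ, F t ζ * ψ ζ := fun ψ => by
    simp only [sub_mul]
    have h1 := hf.integrable_mul_schwartz ψ
    have h2 := hg.integrable_mul_schwartz ψ
    have h3 := integral_sub (h1.sub h2) (hI.integrable_mul_schwartz ψ)
    simp only [Pi.sub_apply] at h3
    rw [h3, integral_sub h1 h2, hF.integral_integral_mul hab]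
  constructor
  · intro h
    have h0 := ((hf.sub hg).sub hI).ae_eq_zero fun ψ => by rw [key, h ψ, sub_self]
    filter_upwards [h0] with ζ hζ
    exact sub_eq_zero.1 hζ
  · intro h ψ
    have h0 : (∫ ζ, (f ζ - g ζ - ∫ t in a..b, F t ζ) * ψ ζ) = 0 := by
      rw [← integral_zero ℝ ℂ]
      refine integral_congr_ae ?_
      filter_upwards [h] with ζ hζ
      rw [hζ, sub_self, zero_mul]
    rw [key] at h0
    exact sub_eq_zero.1 h0

/-- Uniformly in time, the norm of `F(t, ·)` is at most a weight times an integrable function. -/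
theorem temperedIntegrableOn_of_norm_le (hF : StronglyMeasurable (Function.uncurry F)) {M : ℝ}
    {k : ℝ → ℝ} (hk : Integrable k (volume.restrict (Ioc a b)))
    {A : ℝ → ℝ → ℝ} (hA : ∀ t ∈ Ioc a b, Integrable (fun ζ => weight (-M) ζ * A t ζ))
    (hFA : ∀ t ∈ Ioc a b, ∀ᵐ ζ, ‖F t ζ‖ ≤ A t ζ)
    (hAk : ∀ t ∈ Ioc a b, ∫ ζ, weight (-M) ζ * A t ζ ≤ k t) : TemperedIntegrableOn F a b := by
  have hmeas : StronglyMeasurable fun q : ℝ × ℝ => (weight (-M) q.2 : ℂ) * F q.1 q.2 :=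
    ((continuous_weight_ofReal (-M)).comp continuous_snd).stronglyMeasurable.mul hF
  have hle : ∀ t ∈ Ioc a b, ∀ᵐ ζ, ‖(weight (-M) ζ : ℂ) * F t ζ‖ ≤ weight (-M) ζ * A t ζ := by
    intro t ht
    filter_upwards [hFA t ht] with ζ hζ
    rw [norm_mul, norm_weight_ofReal]
    exact mul_le_mul_of_nonneg_left hζ (weight_pos _ _).le
  refine ⟨M, (integrable_prod_iff hmeas.aestronglyMeasurable).2 ⟨?_, ?_⟩⟩
  · refine (ae_restrict_mem measurableSet_Ioc).mono fun t ht => ?_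
    exact (hA t ht).mono' (hmeas.comp_measurable
      (measurable_prodMk_left (x := t))).aestronglyMeasurable (hle t ht)
  · refine hk.mono' ?_ ?_
    · exact hmeas.norm.integral_prod_right'.aestronglyMeasurable
    · refine (ae_restrict_mem measurableSet_Ioc).mono fun t ht => ?_
      rw [Real.norm_eq_abs, abs_of_nonneg (integral_nonneg fun ζ => norm_nonneg _)]
      refine le_trans ?_ (hAk t ht)
      exact integral_mono_of_nonneg (Eventually.of_forall fun ζ => norm_nonneg _) (hA t ht)
        (hle t ht)

end TemperedIntegrableOn

theorem stronglyMeasurable_duhamel {m : ℝ → ℂ} {n : ℝ → ℝ → ℂ} (hm : Measurable m)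
    (hn : StronglyMeasurable (Function.uncurry n)) :
    StronglyMeasurable fun q : ℝ × ℝ => duhamel m n q.1 q.2 := by
  have hF : StronglyMeasurable fun x : (ℝ × ℝ) × ℝ =>
      Complex.exp (((x.1.1 - x.2 : ℝ) : ℂ) * m x.1.2) * n x.2 x.1.2 := by
    refine StronglyMeasurable.mul ?_ ?_
    · have : Measurable fun x : (ℝ × ℝ) × ℝ => m x.1.2 := hm.comp (by fun_prop)
      have h2 : Measurable fun x : (ℝ × ℝ) × ℝ => ((x.1.1 - x.2 : ℝ) : ℂ) :=
        Complex.measurable_ofReal.comp (by fun_prop)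
      exact (Complex.measurable_exp.comp (h2.mul this)).stronglyMeasurable
    · exact hn.comp_measurable (g := fun x : (ℝ × ℝ) × ℝ => (x.2, x.1.2)) (by fun_prop)
  set G : (ℝ × ℝ) × ℝ → ℂ := fun x => Complex.exp (((x.1.1 - x.2 : ℝ) : ℂ) * m x.1.2) * n x.2 x.1.2
    with hG
  have hA : MeasurableSet {x : (ℝ × ℝ) × ℝ | 0 < x.2 ∧ x.2 ≤ x.1.1} :=
    (measurableSet_lt (f := fun _ : (ℝ × ℝ) × ℝ => (0 : ℝ)) (g := fun x => x.2) (by fun_prop)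
      (by fun_prop)).inter (measurableSet_le (f := fun x : (ℝ × ℝ) × ℝ => x.2)
      (g := fun x => x.1.1) (by fun_prop) (by fun_prop))
  have hB : MeasurableSet {x : (ℝ × ℝ) × ℝ | x.1.1 < x.2 ∧ x.2 ≤ 0} :=
    (measurableSet_lt (f := fun x : (ℝ × ℝ) × ℝ => x.1.1) (g := fun x => x.2) (by fun_prop)
      (by fun_prop)).inter (measurableSet_le (f := fun x : (ℝ × ℝ) × ℝ => x.2)
      (g := fun _ => (0 : ℝ)) (by fun_prop) (by fun_prop))
  have h : (fun q : ℝ × ℝ => duhamel m n q.1 q.2) =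
      (fun q => ∫ τ, {x : (ℝ × ℝ) × ℝ | 0 < x.2 ∧ x.2 ≤ x.1.1}.indicator G (q, τ)) -
        fun q => ∫ τ, {x : (ℝ × ℝ) × ℝ | x.1.1 < x.2 ∧ x.2 ≤ 0}.indicator G (q, τ) := by
    ext q
    rw [Pi.sub_apply, duhamel, intervalIntegral, ← integral_indicator measurableSet_Ioc,
      ← integral_indicator measurableSet_Ioc]
    rfl
  rw [h]
  exact (hF.indicator hA).integral_prod_right'.sub (hF.indicator hB).integral_prod_right'

/-- The quadratic term `𝓕 (w(τ) ^ 2)`. -/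
def quad (w : ℝ → L2) (τ ζ : ℝ) : ℂ := fourierMul (w τ) (w τ) ζ

theorem norm_quad_le (w : ℝ → L2) (τ ζ : ℝ) : ‖quad w τ ζ‖ ≤ ‖w τ‖ ^ 2 :=
  (norm_fourierMul_apply_le _ _ ζ).trans_eq (sq _).symm

theorem stronglyMeasurable_fourierMul {w w' : ℝ → L2} (hw : StronglyMeasurable w)
    (hw' : StronglyMeasurable w') :
    StronglyMeasurable fun q : ℝ × ℝ => fourierMul (w q.1) (w' q.1) q.2 := by
  have h0 : Continuous fun f : L2 × L2 => fourierMul f.1 f.2 := by fun_prop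
  have h1 := h0.comp_stronglyMeasurable (hw.prodMk hw')
  have h2 := (continuous_eval (F := ℝ →ᵇ ℂ)).comp_stronglyMeasurable
    ((h1.comp_measurable (measurable_fst (β := ℝ))).prodMk measurable_snd.stronglyMeasurable)
  exact h2

theorem stronglyMeasurable_quad {w : ℝ → L2} (hw : StronglyMeasurable w) :
    StronglyMeasurable (Function.uncurry (quad w)) := stronglyMeasurable_fourierMul hw hw

/-! ### The integrated equation and the Duhamel formula -/

/-- The function `U(t) = 𝓕 (u(t))` satisfies the Duhamel formula on `[0, T]` with initial value `c`,
and `w` is the derivative of `u`. -/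
structure IsMild (m : ℝ → ℂ) (T : ℝ) (c : ℝ → ℂ) (U : ℝ → ℝ → ℂ) (w : ℝ → L2) : Prop where
  stronglyMeasurable : StronglyMeasurable w
  memLp : MemLp w 2 (volume.restrict (Ioc 0 T))
  fourier_eq : ∀ᵐ t ∂volume.restrict (Ioc 0 T),
    (𝓕 (w t) : L2) =ᵐ[volume] fun ζ => dsym ζ * U t ζ
  duhamel_eq : ∀ t ∈ Icc 0 T, U t =ᵐ[volume]
    fun ζ => Complex.exp (t * m ζ) * c ζ - duhamel m (quad w) t ζ

section Quad

variable {w : ℝ → L2} {a b T : ℝ}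

theorem integrable_norm_sq_of_memLp (hw : MemLp w 2 (volume.restrict (Ioc a b))) :
    Integrable (fun t => ‖w t‖ ^ 2) (volume.restrict (Ioc a b)) := hw.norm.integrable_sq

theorem intervalIntegrable_quad (hw : StronglyMeasurable w)
    (hw2 : MemLp w 2 (volume.restrict (Ioc 0 T))) (hT : 0 ≤ T) (ζ : ℝ) :
    IntervalIntegrable (fun τ => quad w τ ζ) volume 0 T := by
  rw [intervalIntegrable_iff_integrableOn_Ioc_of_le hT]
  refine (integrable_norm_sq_of_memLp hw2).mono' ?_
    (Eventually.of_forall fun τ => norm_quad_le w τ ζ)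
  exact ((stronglyMeasurable_quad hw).comp_measurable
    (measurable_prodMk_right (y := ζ))).aestronglyMeasurable

theorem temperedIntegrableOn_quad (hw : StronglyMeasurable w)
    (hw2 : MemLp w 2 (volume.restrict (Ioc a b))) : TemperedIntegrableOn (quad w) a b := by
  refine temperedIntegrableOn_of_norm_le (stronglyMeasurable_quad hw) (M := 2)
    (k := fun t => (∫ ζ, weight (-2) ζ) * ‖w t‖ ^ 2) (A := fun t _ => ‖w t‖ ^ 2)
    ((integrable_norm_sq_of_memLp hw2).const_mul _) (fun t _ => ?_)
    (fun t _ => Eventually.of_forall fun ζ => norm_quad_le w t ζ) fun t _ => ?_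
  · exact (integrable_weight (by norm_num)).mul_const _
  · exact (integral_mul_const _ _).le

theorem temperedIntegrable_fourierMul (f g : L2) : TemperedIntegrable (fourierMul f g) :=
  temperedIntegrable_of_bounded (fourierMul f g).continuous.aestronglyMeasurable
    (norm_fourierMul_apply_le f g)

theorem integral_sq_mul_schwartz (w : L2) (φ : 𝓢(ℝ, ℂ)) :
    ∫ x, (w x) ^ 2 * φ x = ∫ ζ, fourierMul w w ζ * (𝓕⁻ φ) ζ := by
  have h := VectorFourier.integral_fourierIntegral_smul_eq_flip (L := innerₗ ℝ) (μ := volume)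
    (ν := volume) (f := fun x => w x * w x) (g := ⇑(𝓕⁻ φ : 𝓢(ℝ, ℂ))) Real.continuous_fourierChar continuous_inner
    (integrable_mul_L2 w w) (𝓕⁻ φ).integrable
  rw [flip_innerₗ] at h
  have h1 : ∀ x, VectorFourier.fourierIntegral Real.fourierChar volume (innerₗ ℝ)
      (⇑(𝓕⁻ φ : 𝓢(ℝ, ℂ))) x = φ x :=
    fun x => by
      have h2 : 𝓕 (𝓕⁻ φ) = φ := FourierTransform.fourier_fourierInv_eq φ
      have h3 : (𝓕 (𝓕⁻ φ)) x = φ x := by rw [h2]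
      rw [← h3, SchwartzMap.fourier_coe]
      rfl
  simp only [h1, smul_eq_mul] at h
  simp only [sq, ← h, fourierMul_apply]
  rfl

end Quad

theorem TemperedIntegrable.mul_of_norm_le {a g : ℝ → ℂ} {C r : ℝ} (hg : TemperedIntegrable g)
    (ha : AEStronglyMeasurable a volume) (h : ∀ ζ, ‖a ζ‖ ≤ C * weight r ζ) :
    TemperedIntegrable fun ζ => a ζ * g ζ := by
  obtain ⟨M, hM⟩ := hg
  refine ⟨M + r, (hM.bdd_mul (c := C) (((continuous_weight_ofReal (-r)).aestronglyMeasurable).mul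
    ha) (Eventually.of_forall fun ζ => ?_)).congr (Eventually.of_forall fun ζ => ?_)⟩
  · rw [Pi.mul_apply, norm_mul, norm_weight_ofReal]
    refine (mul_le_mul_of_nonneg_left (h ζ) (weight_pos _ _).le).trans_eq ?_
    linear_combination C * weight_mul_neg r ζ
  · show (weight (-r) ζ : ℂ) * a ζ * ((weight (-M) ζ : ℂ) * g ζ) = _
    have h1 : (weight (-(M + r)) ζ : ℂ) = (weight (-r) ζ : ℂ) * (weight (-M) ζ : ℂ) := by
      rw [← Complex.ofReal_mul, weight_mul]
      congr 2
      ring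
    simp only [h1]
    ring

theorem Sobolev.temperedIntegrable_fourierFun {s : ℝ} (f : Sobolev s) :
    TemperedIntegrable f.fourierFun :=
  TemperedIntegrable.of_norm_le (C := 1) (M := -s) f.toL2 f.aestronglyMeasurable_fourierFun
    (Eventually.of_forall fun ζ => by rw [Sobolev.norm_fourierFun, one_mul])

theorem Sobolev.stronglyMeasurable_fourierFun {s : ℝ} (f : Sobolev s) :
    StronglyMeasurable f.fourierFun :=
  (continuous_weight_ofReal _).stronglyMeasurable.mul (Lp.stronglyMeasurable _)

theorem Sobolev.ext_fourierFun {s : ℝ} {f g : Sobolev s}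
    (h : f.fourierFun =ᵐ[volume] g.fourierFun) : f = g := by
  apply Sobolev.toL2_injective
  apply Lp.ext
  filter_upwards [h] with ζ hζ
  exact mul_left_cancel₀ (weight_ofReal_ne_zero _ _) hζ

theorem toDistr_eq_of_fourierFun {s r : ℝ} {f : Sobolev s} {g : Sobolev r}
    (h : f.fourierFun =ᵐ[volume] g.fourierFun) : f.toDistr = g.toDistr := by
  ext φ
  rw [Sobolev.toDistr_apply, Sobolev.toDistr_apply]
  refine integral_congr_ae ?_
  filter_upwards [h] with ζ hζ
  rw [hζ]

section Flow

variable {m : ℝ → ℂ} {p K T : ℝ} {c : ℝ → ℂ} {w : ℝ → L2}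

theorem duhamelFormula_eq_scalarFlow (t ζ : ℝ) :
    Complex.exp (t * m ζ) * c ζ - duhamel m (quad w) t ζ
      = scalarFlow (m ζ) (c ζ) (fun τ => quad w τ ζ) t := rfl

theorem norm_scalarFlow_le (hm : IsDissipative m p K) (hT1 : T ≤ 1)
    (hw2 : MemLp w 2 (volume.restrict (Ioc 0 T))) {t : ℝ} (ht : t ∈ Icc 0 T) (ζ : ℝ) :
    ‖scalarFlow (m ζ) (c ζ) (fun τ => quad w τ ζ) t‖
      ≤ K * ‖c ζ‖ + K * ∫ τ in Ioc 0 T, ‖w τ‖ ^ 2 := by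
  have hK : 0 ≤ K := zero_le_one.trans hm.one_le
  refine (norm_sub_le _ _).trans (add_le_add ?_ ?_)
  · rw [norm_mul]
    exact mul_le_mul_of_nonneg_right (hm.norm_exp_le_const ⟨ht.1, ht.2.trans hT1⟩ ζ) (norm_nonneg _)
  · have hi := integrable_norm_sq_of_memLp hw2
    rw [intervalIntegral.integral_of_le ht.1, ← integral_const_mul]
    refine (norm_integral_le_of_norm_le ((hi.mono_measure
      (Measure.restrict_mono (Ioc_subset_Ioc_right ht.2) le_rfl)).const_mul K) ?_).trans ?_
    · refine (ae_restrict_mem measurableSet_Ioc).mono fun τ hτ => ?_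
      rw [norm_mul]
      exact mul_le_mul (hm.norm_exp_le_const ⟨by linarith [hτ.2], by linarith [hτ.1, ht.2]⟩ ζ)
        (norm_quad_le w τ ζ) (norm_nonneg _) hK
    · exact setIntegral_mono_set (hi.const_mul K)
        (Eventually.of_forall fun τ => mul_nonneg hK (sq_nonneg _))
        (Ioc_subset_Ioc_right ht.2).eventuallyLE

theorem temperedIntegrableOn_flow (hm : IsDissipative m p K) (hT1 : T ≤ 1)
    (hc : StronglyMeasurable c) (hct : TemperedIntegrable c) (hw : StronglyMeasurable w)
    (hw2 : MemLp w 2 (volume.restrict (Ioc 0 T))) :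
    TemperedIntegrableOn
      (fun t ζ => m ζ * scalarFlow (m ζ) (c ζ) (fun τ => quad w τ ζ) t) 0 T := by
  obtain ⟨M₀, hM₀⟩ := hct
  set M := max M₀ 2 with hM
  have hM1 := TemperedIntegrable.mono_weight (le_max_left M₀ 2) hM₀
  have hM2 : 2 ≤ M := le_max_right M₀ 2
  have hK : 0 ≤ K := zero_le_one.trans hm.one_le
  set A := ∫ τ in Ioc 0 T, ‖w τ‖ ^ 2 with hA
  have hexp : Measurable fun q : ℝ × ℝ => Complex.exp (q.1 * m q.2) := by
    have h1 : Measurable fun q : ℝ × ℝ => m q.2 := hm.measurable.comp measurable_snd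
    have h2 : Measurable fun q : ℝ × ℝ => (q.1 : ℂ) := Complex.measurable_ofReal.comp measurable_fst
    exact Complex.measurable_exp.comp (h2.mul h1)
  have hmeas : StronglyMeasurable (Function.uncurry
      fun t ζ => m ζ * scalarFlow (m ζ) (c ζ) (fun τ => quad w τ ζ) t) :=
    (hm.measurable.comp measurable_snd).stronglyMeasurable.mul
      ((hexp.stronglyMeasurable.mul (hc.comp_measurable measurable_snd)).sub
        (stronglyMeasurable_duhamel hm.measurable (stronglyMeasurable_quad hw)))
  have hint : Integrable fun ζ => weight (-(M + p)) ζ *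
      (K * weight p ζ * (K * ‖c ζ‖ + K * A)) := by
    have h1 := (hM1.norm.const_mul (K * K)).add
      ((integrable_weight (r := -M) (by linarith)).const_mul (K * K * A))
    refine h1.congr (Eventually.of_forall fun ζ => ?_)
    have h2 : weight (-M) ζ = weight (-(M + p)) ζ * weight p ζ := by
      rw [weight_mul]
      ring_nf
    simp only [Pi.add_apply, norm_mul, norm_weight_ofReal]
    rw [← hM, h2]
    ring
  refine temperedIntegrableOn_of_norm_le hmeas (M := M + p) (integrable_const _)
    (A := fun t ζ => K * weight p ζ * (K * ‖c ζ‖ + K * A)) (fun _ _ => hint)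
    (fun t ht => Eventually.of_forall fun ζ => ?_) fun _ _ => le_rfl
  rw [norm_mul]
  exact mul_le_mul (hm.norm_le ζ) (norm_scalarFlow_le hm hT1 hw2 ⟨ht.1.le, ht.2⟩ ζ) (norm_nonneg _)
    (mul_nonneg hK (weight_pos _ _).le)

end Flow

section Weak

variable {Φ : ℝ → ℝ} {η p K T s : ℝ}

/-- The integrand in the definition of a solution, on the Fourier side. -/
theorem weak_integrand_eq (hm : IsDissipative (evolutionSymbol η Φ) p K) (f : Sobolev s) (w : L2)
    (φ : 𝓢(ℝ, ℂ)) :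
    (TemperedDistribution.derivCLM ℂ (TemperedDistribution.derivCLM ℂ (dx f))) φ
        + (η : ℂ) * opL Φ f φ + ∫ x : ℝ, (w x) ^ 2 * φ x
      = -∫ ζ, (evolutionSymbol η Φ ζ * f.fourierFun ζ - fourierMul w w ζ) * (𝓕⁻ φ) ζ := by
  have hf := f.temperedIntegrable_fourierFun
  have h1 := (hf.mul_of_norm_le hm.measurable.aestronglyMeasurable
    hm.norm_le).integrable_mul_schwartz (𝓕⁻ φ)
  have h2 := (temperedIntegrable_fourierMul w w).integrable_mul_schwartz (𝓕⁻ φ)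
  have h3 := (hf.mul_of_norm_le (a := fun ζ => dsym ζ ^ 3) (C := 1) (r := 3)
    (continuous_dsym.pow 3).aestronglyMeasurable fun ζ => by
      rw [norm_pow, one_mul]
      refine (pow_le_pow_left₀ (norm_nonneg _) (norm_dsym_le ζ) 3).trans_eq ?_
      rw [pow_succ, pow_two, weight_mul, weight_mul]
      norm_num).integrable_mul_schwartz (𝓕⁻ φ)
  have h4 : (η : ℂ) * opL Φ f φ = ∫ ζ, (-(evolutionSymbol η Φ ζ * f.fourierFun ζ * (𝓕⁻ φ) ζ)
      - dsym ζ ^ 3 * f.fourierFun ζ * (𝓕⁻ φ) ζ) := by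
    rw [opL, ← integral_const_mul]
    congr 1
    ext ζ
    rw [evolutionSymbol]
    push_cast
    ring
  have h5 := integral_sub h1.neg h3
  simp only [Pi.neg_apply] at h5
  rw [h4, h5, integral_neg, dxxx_apply, integral_sq_mul_schwartz]
  simp only [sub_mul]
  rw [integral_sub h1 h2]
  ring

theorem IsMild.isSolution (hm : IsDissipative (evolutionSymbol η Φ) p K) (hT : 0 ≤ T) (hT1 : T ≤ 1)
    {u₀ : Sobolev s} {u : ℝ → Sobolev s} {w : ℝ → L2}
    (h : IsMild (evolutionSymbol η Φ) T u₀.fourierFun (fun t => (u t).fourierFun) w)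
    (hu : ContinuousOn u (Icc 0 T)) : IsSolution Φ η T u₀ u := by
  refine ⟨hu, ?_, w, fun a ha => ?_, ?_, fun φ a b ha hab hb => ?_⟩
  · apply Sobolev.ext_fourierFun
    filter_upwards [h.duhamel_eq 0 ⟨le_rfl, hT⟩] with ζ hζ
    rw [hζ, duhamel_zero]
    simp
  · exact h.memLp.mono_measure (Measure.restrict_mono (Ioc_subset_Ioc_left ha.1.le) le_rfl)
  · filter_upwards [h.fourier_eq] with t ht
    exact (dx_eq_iff _ _).2 ht
  · have hc := u₀.stronglyMeasurable_fourierFun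
    have hct := u₀.temperedIntegrable_fourierFun
    have hF := ((temperedIntegrableOn_flow hm hT1 hc hct h.stronglyMeasurable h.memLp).sub
      (temperedIntegrableOn_quad h.stronglyMeasurable h.memLp)).mono ha.le hb
    have hae : (fun ζ => (u b).fourierFun ζ - (u a).fourierFun ζ) =ᵐ[volume] fun ζ =>
        ∫ t in a..b, (evolutionSymbol η Φ ζ * scalarFlow (evolutionSymbol η Φ ζ)
          (u₀.fourierFun ζ) (fun τ => quad w τ ζ) t - quad w t ζ) := by
      filter_upwards [h.duhamel_eq a ⟨ha.le, hab.trans hb⟩, h.duhamel_eq b ⟨ha.le.trans hab, hb⟩]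
        with ζ h1 h2
      rw [h1, h2, duhamelFormula_eq_scalarFlow, duhamelFormula_eq_scalarFlow]
      exact scalarFlow_sub hT (intervalIntegrable_quad h.stronglyMeasurable h.memLp hT ζ)
        ⟨ha.le, hab.trans hb⟩ ⟨ha.le.trans hab, hb⟩
    have h3 := (hF.forall_schwartz_iff hab (u b).temperedIntegrable_fourierFun
      (u a).temperedIntegrable_fourierFun).2 hae (𝓕⁻ φ)
    rw [Sobolev.toDistr_apply, Sobolev.toDistr_apply, h3, ← sub_neg_eq_add, sub_eq_zero,
      ← intervalIntegral.integral_neg]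
    refine intervalIntegral.integral_congr fun t ht => ?_
    rw [uIcc_of_le hab] at ht
    simp only [weak_integrand_eq hm, neg_neg]
    refine integral_congr_ae ?_
    filter_upwards [h.duhamel_eq t ⟨ha.le.trans ht.1, ht.2.trans hb⟩] with ζ hζ
    rw [hζ, duhamelFormula_eq_scalarFlow]
    rfl

end Weak

/-! ### From the integrated equation to the Duhamel formula -/

section FromWeak

variable {p K T s : ℝ}

theorem temperedIntegrableOn_rep {a : ℝ → ℂ} {C r : ℝ} (ha : Measurable a)
    (h : ∀ ζ, ‖a ζ‖ ≤ C * weight r ζ) {x : ℝ → L2} (hx : Continuous x) (b₁ b₂ : ℝ) :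
    TemperedIntegrableOn (fun t ζ => a ζ * rep (x t) ζ) b₁ b₂ := by
  have hC : 0 ≤ C := nonneg_of_mul_nonneg_left ((norm_nonneg _).trans (h 0)) (weight_pos r 0)
  have hmeas : StronglyMeasurable (Function.uncurry fun t ζ => a ζ * rep (x t) ζ) :=
    (ha.comp measurable_snd).stronglyMeasurable.mul (stronglyMeasurable_rep hx)
  have hw : ∀ ζ, weight (-(r + 1)) ζ * weight r ζ = weight (-1) ζ := fun ζ => by
    rw [weight_mul]
    ring_nf
  have h2 : Integrable fun ζ => weight (-2) ζ := integrable_weight (by norm_num)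
  have hsq : ∀ t, ∫ ζ, ‖x t ζ‖ ^ 2 = ‖x t‖ ^ 2 := fun t => by
    rw [← norm_mkL2_sq (Lp.memLp _), mkL2_coeFn]
  have hi : ∀ t, Integrable fun ζ => weight (-1) ζ * ‖x t ζ‖ := fun t =>
    (memLp_weight (by norm_num)).integrable_mul (Lp.memLp (x t)).norm
  refine temperedIntegrableOn_of_norm_le hmeas (M := r + 1)
    (k := fun t => C * ((∫ ζ, weight (-2) ζ) + ‖x t‖ ^ 2))
    (A := fun t ζ => C * weight r ζ * ‖x t ζ‖) ?_ (fun t _ => ?_) (fun t _ => ?_) fun t _ => ?_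
  · exact (Continuous.integrableOn_Ioc (by fun_prop))
  · refine ((hi t).const_mul C).congr (Eventually.of_forall fun ζ => ?_)
    simp only [← hw]
    ring
  · filter_upwards [rep_ae_eq (x t)] with ζ hζ
    rw [norm_mul, hζ]
    exact mul_le_mul_of_nonneg_right (h ζ) (norm_nonneg _)
  · rw [← hsq, ← integral_add h2 (Lp.memLp (x t)).norm.integrable_sq, ← integral_const_mul]
    refine integral_mono_of_nonneg (Eventually.of_forall fun ζ => ?_)
      ((h2.add (Lp.memLp (x t)).norm.integrable_sq).const_mul C)
      (Eventually.of_forall fun ζ => ?_)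
    · have := weight_pos (-(r + 1)) ζ
      have := weight_pos r ζ
      show 0 ≤ weight (-(r + 1)) ζ * (C * weight r ζ * ‖x t ζ‖)
      positivity
    · show weight (-(r + 1)) ζ * (C * weight r ζ * ‖x t ζ‖) ≤ C * (weight (-2) ζ + ‖x t ζ‖ ^ 2)
      have h3 : weight (-2) ζ = weight (-1) ζ ^ 2 := by
        rw [sq, weight_mul]
        norm_num
      calc _ = C * (weight (-1) ζ * ‖x t ζ‖) := by rw [← hw]; ring
        _ ≤ _ := by
          refine mul_le_mul_of_nonneg_left ?_ hC
          rw [h3]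
          nlinarith [sq_nonneg (weight (-1) ζ - ‖x t ζ‖), sq_nonneg (weight (-1) ζ),
            sq_nonneg ‖x t ζ‖]

/-- If the integrated equation holds on `[0, T]` in the sense of distributions, then the Duhamel
formula holds at almost every frequency. -/
theorem duhamel_of_weak {m : ℝ → ℂ} (hm : IsDissipative m p K) (hT : 0 ≤ T) {u : ℝ → Sobolev s}
    (hu : ContinuousOn u (Icc 0 T)) {w : ℝ → L2} (hw : StronglyMeasurable w)
    (hw2 : MemLp w 2 (volume.restrict (Ioc 0 T)))
    (h : ∀ t ∈ Icc 0 T, ∀ ψ : 𝓢(ℝ, ℂ),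
      (∫ ζ, (u t).fourierFun ζ * ψ ζ) - ∫ ζ, (u 0).fourierFun ζ * ψ ζ
        = ∫ τ in (0 : ℝ)..t, ∫ ζ, (m ζ * (u τ).fourierFun ζ - quad w τ ζ) * ψ ζ) :
    ∀ t ∈ Icc 0 T, (u t).fourierFun =ᵐ[volume]
      fun ζ => Complex.exp (t * m ζ) * (u 0).fourierFun ζ - duhamel m (quad w) t ζ := by
  -- a representative of the Fourier transform of `u` that is measurable in time and frequency
  set x : ℝ → L2 := IccExtend hT fun t => (u t).toL2 with hx
  have hxc : Continuous x :=
    Continuous.Icc_extend' (Sobolev.continuous_toL2.comp (continuousOn_iff_continuous_domRestrict.1 hu))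
  have hxu : ∀ t ∈ Icc 0 T, x t = (u t).toL2 := fun t ht => IccExtend_of_mem hT _ ht
  set Y : ℝ → ℝ → ℂ := fun t ζ => (weight (-s) ζ : ℂ) * rep (x t) ζ with hY
  have hYm : StronglyMeasurable (Function.uncurry Y) :=
    ((continuous_weight_ofReal _).comp continuous_snd).stronglyMeasurable.mul
      (stronglyMeasurable_rep hxc)
  have hYu : ∀ t ∈ Icc 0 T, Y t =ᵐ[volume] (u t).fourierFun := by
    intro t ht
    filter_upwards [rep_ae_eq (x t)] with ζ hζ
    rw [hY, Sobolev.fourierFun, ← hxu t ht, ← hζ]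
  have hYi : TemperedIntegrableOn Y 0 T :=
    temperedIntegrableOn_rep (continuous_weight_ofReal (-s)).measurable (C := 1) (r := -s)
      (fun ζ => by rw [norm_weight_ofReal, one_mul]) hxc 0 T
  have hmY : TemperedIntegrableOn (fun t ζ => m ζ * Y t ζ) 0 T := by
    have h1 := temperedIntegrableOn_rep (a := fun ζ => m ζ * (weight (-s) ζ : ℂ)) (C := K)
      (r := p - s) (hm.measurable.mul (continuous_weight_ofReal (-s)).measurable) (fun ζ => by
        rw [norm_mul, norm_weight_ofReal, sub_eq_add_neg, ← weight_mul, ← mul_assoc]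
        exact mul_le_mul_of_nonneg_right (hm.norm_le ζ) (weight_pos _ _).le) hxc 0 T
    simpa only [hY, mul_assoc] using h1
  have hq := temperedIntegrableOn_quad hw hw2
  have hF := hmY.sub hq
  have hFm : StronglyMeasurable (Function.uncurry fun t ζ => m ζ * Y t ζ - quad w t ζ) :=
    ((hm.measurable.comp measurable_snd).stronglyMeasurable.mul hYm).sub (stronglyMeasurable_quad hw)
  set Z : ℝ → ℝ → ℂ := fun t ζ => Y 0 ζ + ∫ τ in (0 : ℝ)..t, (m ζ * Y τ ζ - quad w τ ζ) with hZ
  have hZm : StronglyMeasurable (Function.uncurry Z) := by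
    have h1 := stronglyMeasurable_duhamel (m := 0) measurable_zero hFm
    simp only [duhamel, Pi.zero_apply, mul_zero, Complex.exp_zero, one_mul] at h1
    exact (hYm.comp_measurable (g := fun q : ℝ × ℝ => ((0 : ℝ), q.2)) (by fun_prop)).add h1
  have h0 : (0 : ℝ) ∈ Icc 0 T := ⟨le_rfl, hT⟩
  have hYZ : ∀ t ∈ Icc 0 T, Y t =ᵐ[volume] Z t := by
    intro t ht
    have h1 := ((hF.mono le_rfl ht.2).forall_schwartz_iff ht.1
      (u t).temperedIntegrable_fourierFun (u 0).temperedIntegrable_fourierFun).1 fun ψ => by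
        rw [h t ht ψ]
        refine intervalIntegral.integral_congr fun τ hτ => ?_
        rw [uIcc_of_le ht.1] at hτ
        refine integral_congr_ae ?_
        filter_upwards [hYu τ ⟨hτ.1, hτ.2.trans ht.2⟩] with ζ hζ
        rw [hζ]
    filter_upwards [h1, hYu t ht, hYu 0 h0] with ζ h2 h3 h4
    change Y t ζ = Y 0 ζ + ∫ τ in (0 : ℝ)..t, (m ζ * Y τ ζ - quad w τ ζ)
    rw [h3, h4, ← h2]
    ring
  -- for almost every `ζ`, the two functions of time agree almost everywhere
  have hswap : ∀ᵐ ζ, ∀ᵐ t ∂volume.restrict (Ioc 0 T), Y t ζ = Z t ζ := by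
    have hset : MeasurableSet {q : ℝ × ℝ | Y q.1 q.2 = Z q.1 q.2} :=
      measurableSet_eq_fun hYm.measurable hZm.measurable
    exact (Measure.ae_ae_comm hset).1 ((ae_restrict_mem measurableSet_Ioc).mono fun t ht =>
      hYZ t ⟨ht.1.le, ht.2⟩)
  intro t ht
  filter_upwards [hYu t ht, hYu 0 h0, hYZ t ht, hswap, hYi.ae_integrableOn] with ζ h1 h2 h3 h4 h5
  rw [← h1, ← h2, duhamelFormula_eq_scalarFlow (c := Y 0), h3]
  exact eq_scalarFlow hT (intervalIntegrable_quad hw hw2 hT ζ)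
    ((intervalIntegrable_iff_integrableOn_Ioc_of_le hT).2 h5) (fun t => rfl) h4 ht

/-- A solution, restarted at a positive time, is given by the Duhamel formula. -/
theorem IsSolution.exists_isMild {Φ : ℝ → ℝ} {η : ℝ}
    (hm : IsDissipative (evolutionSymbol η Φ) p K) {u₀ : Sobolev s} {u : ℝ → Sobolev s}
    (h : IsSolution Φ η T u₀ u) {a : ℝ} (ha : a ∈ Ioo 0 T) :
    ∃ w, IsMild (evolutionSymbol η Φ) (T - a) (u a).fourierFun
      (fun t => (u (a + t)).fourierFun) w := by
  obtain ⟨hu, -, w₀, hw₀, hdx, hweak⟩ := h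
  -- a strongly measurable version of the derivative
  have hmeas := (hw₀ a ha).aestronglyMeasurable
  set w₁ := hmeas.mk w₀ with hw₁
  have hw₁m : StronglyMeasurable w₁ := hmeas.stronglyMeasurable_mk
  have hae : w₀ =ᵐ[volume.restrict (Ioc a T)] w₁ := hmeas.ae_eq_mk
  have hmp : MeasurePreserving (fun t => a + t) (volume.restrict (Ioc 0 (T - a)))
      (volume.restrict (Ioc a T)) := by
    have h1 := (measurePreserving_add_left (volume : Measure ℝ) a).restrict_preimage
      (measurableSet_Ioc (a := a) (b := T))
    rwa [preimage_const_add_Ioc, sub_self] at h1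
  set w : ℝ → L2 := fun t => w₁ (a + t) with hw
  have hwm : StronglyMeasurable w := hw₁m.comp_measurable (measurable_const_add a)
  have hw2 : MemLp w 2 (volume.restrict (Ioc 0 (T - a))) :=
    ((memLp_congr_ae hae).1 (hw₀ a ha)).comp_measurePreserving hmp
  have hmaps : MapsTo (fun t => a + t) (Icc 0 (T - a)) (Icc 0 T) := fun t ht =>
    ⟨add_nonneg ha.1.le ht.1, by linarith [ht.2]⟩
  refine ⟨w, hwm, hw2, ?_, ?_⟩
  · have h1 : ∀ᵐ t ∂volume.restrict (Ioc a T), dx (u t) = (w₁ t : 𝓢'(ℝ, ℂ)) := by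
      filter_upwards [hae, ae_restrict_of_ae_restrict_of_subset (Ioc_subset_Ioc_left ha.1.le) hdx]
        with t h2 h3
      rw [h3, h2]
    filter_upwards [hmp.quasiMeasurePreserving.ae h1] with t ht
    exact (dx_eq_iff _ _).1 ht
  · have h1 := duhamel_of_weak hm (u := fun t => u (a + t)) (sub_nonneg.2 ha.2.le)
      (hu.comp (by fun_prop) hmaps) hwm hw2 fun t ht ψ => by
        have h2 := hweak (𝓕 ψ) a (a + t) ha.1 (by linarith [ht.1]) (by linarith [ht.2])
        simp only [weak_integrand_eq hm, Sobolev.toDistr_apply,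
          FourierTransform.fourierInv_fourier_eq, intervalIntegral.integral_neg] at h2
        rw [add_neg_eq_zero] at h2
        rw [add_zero, h2]
        have h3 := intervalIntegral.integral_comp_add_left (a := 0) (b := t) (fun τ =>
          ∫ ζ, (evolutionSymbol η Φ ζ * (u τ).fourierFun ζ - fourierMul (w₀ τ) (w₀ τ) ζ) * ψ ζ) a
        rw [add_zero] at h3
        rw [← h3, intervalIntegral.integral_of_le ht.1, intervalIntegral.integral_of_le ht.1]
        refine integral_congr_ae ?_
        filter_upwards [ae_restrict_of_ae_restrict_of_subset (Ioc_subset_Ioc_right ht.2)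
          (hmp.quasiMeasurePreserving.ae hae)] with τ hτ
        simp only [hτ]
        rfl
    simpa only [add_zero] using h1

end FromWeak

/-! ### Uniqueness for the Duhamel formula -/

/-- The integral of `s ^ (-α) * exp (-l s)` over `(0, 1]` tends to `0` as `l → ∞`. -/
theorem exists_lintegral_kernel_le {α : ℝ} (hα : α < 1) {ε : ℝ≥0∞} (hε : 0 < ε) :
    ∃ l : ℕ, ∫⁻ s in Ioc (0 : ℝ) 1, ENNReal.ofReal (s ^ (-α) * Real.exp (-(l * s))) ≤ ε := by
  have hi : IntegrableOn (fun s : ℝ => s ^ (-α)) (Ioc 0 1) :=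
    (intervalIntegrable_iff_integrableOn_Ioc_of_le zero_le_one).1
      (intervalIntegral.intervalIntegrable_rpow' (by linarith))
  have h : Tendsto (fun l : ℕ => ∫⁻ s in Ioc (0 : ℝ) 1,
      ENNReal.ofReal (s ^ (-α) * Real.exp (-(l * s)))) atTop
      (𝓝 (∫⁻ _ in Ioc (0 : ℝ) 1, 0)) := by
    refine tendsto_lintegral_of_dominated_convergence (fun s => ENNReal.ofReal (s ^ (-α)))
      (fun l => by fun_prop) (fun l => ?_) ?_ ?_
    · refine (ae_restrict_mem measurableSet_Ioc).mono fun s hs => ENNReal.ofReal_le_ofReal ?_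
      refine mul_le_of_le_one_right (Real.rpow_nonneg hs.1.le _) (Real.exp_le_one_iff.2 ?_)
      have := hs.1
      have : (0 : ℝ) ≤ l := Nat.cast_nonneg l
      nlinarith
    · exact hi.lintegral_lt_top.ne
    · refine (ae_restrict_mem measurableSet_Ioc).mono fun s hs => ?_
      have h1 : Tendsto (fun l : ℕ => s ^ (-α) * Real.exp (-(l * s))) atTop
          (𝓝 (s ^ (-α) * 0)) := by
        refine Tendsto.const_mul _ (Real.tendsto_exp_neg_atTop_nhds_zero.comp ?_)
        exact tendsto_natCast_atTop_atTop.atTop_mul_const hs.1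
      have h2 := ENNReal.tendsto_ofReal h1
      rwa [mul_zero, ENNReal.ofReal_zero] at h2
  rw [lintegral_zero] at h
  exact (h.eventually_le_const hε).exists

/-- A Volterra inequality with an integrable kernel has only the trivial solution: with respect to
the weight `exp (-l t)`, for large `l`, the Volterra operator is a contraction of `L ^ 1`. -/
theorem ae_eq_zero_of_volterra {H : ℝ → ℝ≥0∞} (hH : Measurable H) {T : ℝ} (hT1 : T ≤ 1)
    (hfin : ∫⁻ t in Ioc 0 T, H t ≠ ⊤) {C : ℝ≥0∞} (hC : C ≠ ⊤) {α : ℝ} (hα : α < 1)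
    (h : ∀ᵐ t ∂volume.restrict (Ioc 0 T),
      H t ≤ C * ∫⁻ τ in Ioo 0 t, ENNReal.ofReal ((t - τ) ^ (-α)) * H τ) :
    ∀ᵐ t ∂volume.restrict (Ioc 0 T), H t = 0 := by
  obtain ⟨l, hl⟩ : ∃ l : ℕ, C * ∫⁻ s in Ioc (0 : ℝ) 1,
      ENNReal.ofReal (s ^ (-α) * Real.exp (-(l * s))) ≤ 2⁻¹ := by
    rcases eq_or_ne C 0 with h0 | h0
    · exact ⟨0, by simp [h0]⟩
    · obtain ⟨l, hl⟩ := exists_lintegral_kernel_le hα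
        (ε := 2⁻¹ / C) (ENNReal.div_pos (by simp) hC)
      exact ⟨l, (mul_le_mul_right hl C).trans_eq (ENNReal.mul_div_cancel h0 hC)⟩
  set k : ℝ → ℝ≥0∞ := (Ioc (0 : ℝ) 1).indicator fun s =>
    ENNReal.ofReal (s ^ (-α) * Real.exp (-(l * s))) with hk
  have hkm : Measurable k := Measurable.indicator (by fun_prop) measurableSet_Ioc
  set E : ℝ → ℝ≥0∞ := fun t => ENNReal.ofReal (Real.exp (-(l * t))) * H t with hE
  have hEm : Measurable E := Measurable.mul (by fun_prop) hH
  set X := ∫⁻ t in Ioc 0 T, E t with hX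
  have hle : ∀ t ∈ Ioc (0 : ℝ) T, ENNReal.ofReal (Real.exp (-(l * t))) *
      (C * ∫⁻ τ in Ioo 0 t, ENNReal.ofReal ((t - τ) ^ (-α)) * H τ)
        ≤ C * ∫⁻ τ in Ioc 0 T, k (t - τ) * E τ := by
    intro t ht
    rw [mul_left_comm, ← lintegral_const_mul' _ _ ENNReal.ofReal_ne_top]
    refine mul_le_mul_right ((lintegral_mono_ae ?_).trans (lintegral_mono_set
      (Ioo_subset_Ioc_self.trans (Ioc_subset_Ioc_right ht.2)))) C
    refine (ae_restrict_mem measurableSet_Ioo).mono fun τ hτ => le_of_eq ?_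
    have h1 : t - τ ∈ Ioc (0 : ℝ) 1 := ⟨by linarith [hτ.2], by linarith [hτ.1, ht.2]⟩
    have h2 : Real.exp (-(l * t)) = Real.exp (-(l * (t - τ))) * Real.exp (-(l * τ)) := by
      rw [← Real.exp_add]
      ring_nf
    rw [hk, indicator_of_mem h1, hE, h2, ENNReal.ofReal_mul (Real.exp_nonneg _),
      ENNReal.ofReal_mul (Real.rpow_nonneg h1.1.le _)]
    ring
  have hX1 : X ≤ 2⁻¹ * X := by
    calc X ≤ ∫⁻ t in Ioc 0 T, C * ∫⁻ τ in Ioc 0 T, k (t - τ) * E τ := by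
          refine lintegral_mono_ae ?_
          filter_upwards [h, ae_restrict_mem measurableSet_Ioc] with t h1 h2
          exact (mul_le_mul_right h1 _).trans (hle t h2)
      _ = C * ∫⁻ t in Ioc 0 T, ∫⁻ τ in Ioc 0 T, k (t - τ) * E τ := lintegral_const_mul' _ _ hC
      _ = C * ∫⁻ τ in Ioc 0 T, ∫⁻ t in Ioc 0 T, k (t - τ) * E τ := by
          rw [lintegral_lintegral_swap]
          exact ((hkm.comp (measurable_fst.sub measurable_snd)).mul
            (hEm.comp measurable_snd)).aemeasurable
      _ ≤ C * ∫⁻ τ in Ioc 0 T, (∫⁻ s, k s) * E τ := by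
          refine mul_le_mul_right (lintegral_mono fun τ => ?_) C
          have h1 : Measurable fun t => k (t - τ) := hkm.comp (measurable_id.sub_const τ)
          rw [lintegral_mul_const _ h1]
          refine mul_le_mul_left ?_ (E τ)
          exact (setLIntegral_le_lintegral _ _).trans_eq (lintegral_sub_right_eq_self k τ)
      _ = (C * ∫⁻ s, k s) * X := by
          rw [lintegral_const_mul _ hEm, mul_assoc]
      _ ≤ 2⁻¹ * X := by
          rw [hk, lintegral_indicator measurableSet_Ioc]
          exact mul_le_mul_left hl X
  have hXfin : X ≠ ⊤ := by
    refine ne_top_of_le_ne_top hfin (setLIntegral_mono hH fun t ht => ?_)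
    refine mul_le_of_le_one_left' ?_
    rw [ENNReal.ofReal_le_one, Real.exp_le_one_iff]
    have := ht.1
    have : (0 : ℝ) ≤ l := Nat.cast_nonneg l
    nlinarith
  have hX0 : X = 0 := by
    by_contra hne
    have h1 := ENNReal.mul_le_mul_iff_left hne hXfin |>.1 ((one_mul X).le.trans hX1)
    exact absurd h1 (by simp)
  have h2 := (lintegral_eq_zero_iff hEm).1 hX0
  filter_upwards [h2] with t ht
  have h3 : ENNReal.ofReal (Real.exp (-(l * t))) ≠ 0 := by simp [Real.exp_pos]
  exact (mul_eq_zero.1 ht).resolve_left h3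

theorem sq_lintegral_mul_le {μ : Measure ℝ} {f g : ℝ → ℝ≥0∞} (hf : AEMeasurable f μ)
    (hg : AEMeasurable g μ) :
    (∫⁻ t, f t * g t ∂μ) ^ 2 ≤ (∫⁻ t, f t ^ 2 ∂μ) * ∫⁻ t, g t ^ 2 ∂μ := by
  have h := ENNReal.lintegral_mul_le_Lp_mul_Lq μ Real.HolderConjugate.two_two hf hg
  have h1 := pow_le_pow_left' h 2
  rw [mul_pow] at h1
  have h2 : ∀ x : ℝ≥0∞, (x ^ (1 / 2 : ℝ)) ^ 2 = x := fun x => by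
    rw [← ENNReal.rpow_natCast, ← ENNReal.rpow_mul]
    norm_num
  simp only [h2, ENNReal.rpow_ofNat] at h1
  exact h1

section Uniqueness

variable {m : ℝ → ℂ} {p K κ T : ℝ} {c c' : ℝ → ℂ} {U U' : ℝ → ℝ → ℂ} {w w' : ℝ → L2}

theorem quad_sub_quad (w w' : ℝ → L2) (τ ζ : ℝ) :
    quad w τ ζ - quad w' τ ζ = fourierMul (w τ + w' τ) (w τ - w' τ) ζ := by
  have h : fourierMul (w τ + w' τ) (w τ - w' τ)
      = fourierMul (w τ) (w τ) - fourierMul (w' τ) (w' τ) := by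
    rw [map_add, map_sub, _root_.add_apply, _root_.add_apply, fourierMul_comm (w' τ) (w τ)]
    abel
  rw [h]
  rfl

theorem enorm_duhamel_sub_le (hm : IsDissipative m p K) (hκ : κ ∈ Icc (0 : ℝ) 1) (hT1 : T ≤ 1)
    (hw : StronglyMeasurable w) (hw2 : MemLp w 2 (volume.restrict (Ioc 0 T)))
    (hw' : StronglyMeasurable w') (hw2' : MemLp w' 2 (volume.restrict (Ioc 0 T))) {t : ℝ}
    (ht : t ∈ Ioc 0 T) (ζ : ℝ) :
    ‖duhamel m (quad w) t ζ - duhamel m (quad w') t ζ‖ₑ ≤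
      ENNReal.ofReal (K * weight (-(κ * p)) ζ) * ∫⁻ τ in Ioo 0 t,
        ENNReal.ofReal ((t - τ) ^ (-κ)) * ‖w τ - w' τ‖ₑ * ‖w τ + w' τ‖ₑ := by
  have hK : 0 ≤ K := zero_le_one.trans hm.one_le
  have hT : 0 ≤ T := ht.1.le.trans ht.2
  have hexp : ContinuousOn (fun τ : ℝ => Complex.exp (((t - τ : ℝ) : ℂ) * m ζ)) (uIcc 0 t) :=
    Continuous.continuousOn (by fun_prop)
  have h1 := (IntervalIntegrable.mono_zero (intervalIntegrable_quad hw hw2 hT ζ)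
    ⟨ht.1.le, ht.2⟩).continuousOn_mul hexp
  have h2 := (IntervalIntegrable.mono_zero (intervalIntegrable_quad hw' hw2' hT ζ)
    ⟨ht.1.le, ht.2⟩).continuousOn_mul hexp
  rw [duhamel, duhamel, ← intervalIntegral.integral_sub h1 h2,
    intervalIntegral.integral_of_le ht.1.le, integral_Ioc_eq_integral_Ioo,
    ← lintegral_const_mul' _ _ ENNReal.ofReal_ne_top]
  refine (enorm_integral_le_lintegral_enorm _).trans (lintegral_mono_ae ?_)
  refine (ae_restrict_mem measurableSet_Ioo).mono fun τ hτ => ?_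
  rw [← mul_sub, quad_sub_quad]
  have h3 : 0 < t - τ := by linarith [hτ.2]
  have h4 := hm.norm_exp_le (t - τ) ⟨h3, by linarith [hτ.1, ht.2]⟩ κ hκ ζ
  have h5 : ‖Complex.exp (((t - τ : ℝ) : ℂ) * m ζ) * fourierMul (w τ + w' τ) (w τ - w' τ) ζ‖
      ≤ K * weight (-(κ * p)) ζ * ((t - τ) ^ (-κ) * ‖w τ - w' τ‖ * ‖w τ + w' τ‖) := by
    rw [norm_mul]
    refine (mul_le_mul h4 (norm_fourierMul_apply_le _ _ ζ) (norm_nonneg _)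
      ((norm_nonneg _).trans h4)).trans_eq ?_
    ring
  have h6 := Real.rpow_nonneg h3.le (-κ)
  have h7 := weight_pos (-(κ * p)) ζ
  rw [← ofReal_norm, ← ofReal_norm, ← ofReal_norm,
    ← ENNReal.ofReal_mul h6, ← ENNReal.ofReal_mul (by positivity),
    ← ENNReal.ofReal_mul (by positivity)]
  exact ENNReal.ofReal_le_ofReal h5

/-- An estimate of a derivative with the Fourier transform `i ξ d(ξ)`. The constant is made positive,
so that the estimate is trivial for `J = ∞`. -/
theorem enorm_le_of_fourier (hκ : 3 / 2 < κ * p) (hK : 0 ≤ K) {f : L2}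
    {d : ℝ → ℂ} (hd : (𝓕 f : L2) =ᵐ[volume] fun ζ => dsym ζ * d ζ) {J : ℝ≥0∞}
    (h : ∀ ζ, ‖d ζ‖ₑ ≤ ENNReal.ofReal (K * weight (-(κ * p)) ζ) * J) :
    ‖f‖ₑ ≤ ENNReal.ofReal (K * weightNorm (1 - κ * p) + 1) * J := by
  have hW := weightNorm_nonneg (1 - κ * p)
  rcases eq_or_ne J ⊤ with rfl | hJ
  · rw [ENNReal.mul_top (by rw [Ne, ENNReal.ofReal_eq_zero, not_le]; positivity)]
    exact le_top
  have h1 : ∀ ζ, ‖d ζ‖ ≤ K * weight (-(κ * p)) ζ * J.toReal := fun ζ => by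
    have h2 := ENNReal.toReal_mono (ENNReal.mul_ne_top ENNReal.ofReal_ne_top hJ) (h ζ)
    rwa [toReal_enorm, ENNReal.toReal_mul,
      ENNReal.toReal_ofReal (mul_nonneg hK (weight_pos _ _).le)] at h2
  have h3 : ‖f‖ ≤ K * J.toReal * weightNorm (1 - κ * p) := by
    rw [← Lp.norm_fourier_eq, weightNorm]
    refine Lp.norm_le_mul_norm_of_ae_le_mul ?_
    filter_upwards [hd, coeFn_mkL2 (memLp_weight_ofReal (r := 1 - κ * p) (by linarith))]
      with ζ e1 e2
    rw [e1, e2, norm_mul, norm_weight_ofReal, sub_eq_add_neg, ← weight_mul]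
    refine (mul_le_mul (norm_dsym_le ζ) (h1 ζ) (norm_nonneg _) (weight_pos _ _).le).trans_eq ?_
    ring
  have h4 : ‖f‖ ≤ (K * weightNorm (1 - κ * p) + 1) * J.toReal := by
    have := ENNReal.toReal_nonneg (a := J)
    nlinarith
  rw [← ofReal_norm]
  refine (ENNReal.ofReal_le_ofReal h4).trans_eq ?_
  rw [ENNReal.ofReal_mul (by positivity), ENNReal.ofReal_toReal hJ]

/-- The Duhamel formula has at most one solution: by the Cauchy-Schwarz inequality in time, the
square `H(t)` of the norm of the difference of the derivatives satisfies a Volterra inequality with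
the kernel `(t - τ) ^ (-2 κ)`. -/
theorem IsMild.unique (hm : IsDissipative m p K) (hκ0 : 0 ≤ κ) (hκ1 : 2 * κ < 1)
    (hκ : 3 / 2 < κ * p) (hT1 : T ≤ 1) (h : IsMild m T c U w) (h' : IsMild m T c' U' w')
    (hc : c =ᵐ[volume] c') : ∀ t ∈ Icc 0 T, U t =ᵐ[volume] U' t := by
  have hK : 0 ≤ K := zero_le_one.trans hm.one_le
  have hD := h.stronglyMeasurable.sub h'.stronglyMeasurable
  have hS := h.stronglyMeasurable.add h'.stronglyMeasurable
  set H : ℝ → ℝ≥0∞ := fun t => ‖w t - w' t‖ₑ ^ 2 with hH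
  have hHm : Measurable H := hD.enorm.pow_const 2
  set A : ℝ≥0∞ := ∫⁻ τ in Ioc 0 T, ‖w τ + w' τ‖ₑ ^ 2 with hA
  have hfin : ∀ {v : ℝ → L2}, MemLp v 2 (volume.restrict (Ioc 0 T)) →
      ∫⁻ t in Ioc 0 T, ‖v t‖ₑ ^ 2 ≠ ⊤ := by
    intro v hv
    have h1 := hv.norm.integrable_sq.2
    rw [hasFiniteIntegral_iff_enorm] at h1
    simpa [enorm_pow] using h1.ne
  have hvolterra : ∀ᵐ t ∂volume.restrict (Ioc 0 T),
      H t ≤ (ENNReal.ofReal (K * weightNorm (1 - κ * p) + 1) ^ 2 * A) *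
        ∫⁻ τ in Ioo 0 t, ENNReal.ofReal ((t - τ) ^ (-(2 * κ))) * H τ := by
    filter_upwards [h.fourier_eq, h'.fourier_eq, ae_restrict_mem measurableSet_Ioc] with t h1 h2 ht
    have h3 := enorm_duhamel_sub_le hm ⟨hκ0, by linarith⟩ hT1 h.stronglyMeasurable h.memLp
      h'.stronglyMeasurable h'.memLp ht
    have h4 : (𝓕 (w t - w' t) : L2) =ᵐ[volume]
        fun ζ => dsym ζ * -(duhamel m (quad w) t ζ - duhamel m (quad w') t ζ) := by
      have h5 : (𝓕 (w t - w' t) : L2) = 𝓕 (w t) - 𝓕 (w' t) :=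
        map_sub (FourierTransform.fourierCLM ℂ L2) (w t) (w' t)
      rw [h5]
      filter_upwards [h1, h2, h.duhamel_eq t ⟨ht.1.le, ht.2⟩, h'.duhamel_eq t ⟨ht.1.le, ht.2⟩, hc,
        Lp.coeFn_sub (𝓕 (w t)) (𝓕 (w' t))] with ζ e1 e2 e3 e4 e5 e6
      rw [e6, Pi.sub_apply, e1, e2, e3, e4, e5]
      ring
    have h5 := enorm_le_of_fourier hκ hK h4 fun ζ => by
      rw [enorm_neg]
      exact h3 ζ
    have h6 := pow_le_pow_left' h5 2
    rw [mul_pow] at h6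
    refine h6.trans ?_
    rw [mul_assoc]
    refine mul_le_mul_right ?_ _
    refine (sq_lintegral_mul_le (Measurable.aemeasurable ?_) hS.enorm.aemeasurable).trans ?_
    · exact Measurable.mul (by fun_prop) hD.enorm
    rw [mul_comm]
    refine mul_le_mul' (lintegral_mono_set
      (Ioo_subset_Ioc_self.trans (Ioc_subset_Ioc_right ht.2))) (lintegral_mono_ae ?_)
    refine (ae_restrict_mem measurableSet_Ioo).mono fun τ hτ => le_of_eq ?_
    have h7 : 0 < t - τ := by linarith [hτ.2]
    rw [mul_pow, ← ENNReal.ofReal_pow (Real.rpow_nonneg h7.le _), ← Real.rpow_natCast,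
      ← Real.rpow_mul h7.le]
    congr 3
    push_cast
    ring_nf
  have hzero := ae_eq_zero_of_volterra hHm hT1 (hfin (h.memLp.sub h'.memLp))
    (ENNReal.mul_ne_top (ENNReal.pow_ne_top ENNReal.ofReal_ne_top)
      (hfin (h.memLp.add h'.memLp))) hκ1 hvolterra
  intro t ht
  have hduh : ∀ ζ, duhamel m (quad w) t ζ = duhamel m (quad w') t ζ := by
    intro ζ
    rw [duhamel, duhamel, intervalIntegral.integral_of_le ht.1, intervalIntegral.integral_of_le ht.1]
    refine integral_congr_ae ?_
    filter_upwards [ae_restrict_of_ae_restrict_of_subset (Ioc_subset_Ioc_right ht.2) hzero]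
      with τ hτ
    have : w τ = w' τ := by simpa [hH, sub_eq_zero] using hτ
    rw [quad, quad, this]
  filter_upwards [h.duhamel_eq t ht, h'.duhamel_eq t ht, hc] with ζ e1 e2 e3
  rw [e1, e2, e3, hduh]

end Uniqueness

/-! ### The solution map gives the unique solution -/

theorem duhamel_congr {m : ℝ → ℂ} {n n' : ℝ → ℝ → ℂ} {T t ζ : ℝ} (ht : t ∈ Icc 0 T)
    (h : ∀ᵐ τ ∂volume.restrict (Ioc 0 T), n τ ζ = n' τ ζ) :
    duhamel m n t ζ = duhamel m n' t ζ := by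
  rw [duhamel, duhamel, intervalIntegral.integral_of_le ht.1, intervalIntegral.integral_of_le ht.1]
  refine integral_congr_ae ?_
  filter_upwards [ae_restrict_of_ae_restrict_of_subset (Ioc_subset_Ioc_right ht.2) h] with τ hτ
  rw [hτ]

theorem IsMild.mono {m : ℝ → ℂ} {T T' : ℝ} {c : ℝ → ℂ} {U : ℝ → ℝ → ℂ} {w : ℝ → L2}
    (h : IsMild m T c U w) (hT : T' ≤ T) : IsMild m T' c U w where
  stronglyMeasurable := h.stronglyMeasurable
  memLp := h.memLp.mono_measure (Measure.restrict_mono (Ioc_subset_Ioc_right hT) le_rfl)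
  fourier_eq := ae_restrict_of_ae_restrict_of_subset (Ioc_subset_Ioc_right hT) h.fourier_eq
  duhamel_eq t ht := h.duhamel_eq t ⟨ht.1, ht.2.trans hT⟩

theorem stronglyMeasurable_extendZero {T : ℝ} {E : Type*} [NormedAddCommGroup E]
    (v : Ioc (0 : ℝ) T →ᵇ E) : StronglyMeasurable (extendZero v) := by
  have h : extendZero v = Function.extend Subtype.val v 0 := by
    ext t
    by_cases ht : t ∈ Ioc 0 T
    · rw [extendZero_of_mem v ht]
      exact (Subtype.val_injective.extend_apply v 0 ⟨t, ht⟩).symm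
    · rw [extendZero_of_notMem v ht, Function.extend_apply' _ _ _ fun ⟨x, hx⟩ => ht (hx ▸ x.2)]
      rfl
  rw [h]
  exact (MeasurableEmbedding.subtype_coe measurableSet_Ioc).stronglyMeasurable_extend
    v.continuous.stronglyMeasurable stronglyMeasurable_zero

section Solution

variable {m : ℝ → ℂ} {p K s σ β κ κ' T R : ℝ}

/-- The derivative of `u`, if `y` is `t ^ β * ⟨ξ⟩ ^ σ * (𝓕 u)`. -/
def velocityPath (σ β : ℝ) (hσ : 1 ≤ σ) (y : Ioc (0 : ℝ) T →ᵇ L2) (τ : ℝ) : L2 :=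
  ((τ ^ (-β) : ℝ) : ℂ) • velocity σ hσ (extendZero y τ)

theorem stronglyMeasurable_velocityPath (hσ : 1 ≤ σ) (y : Ioc (0 : ℝ) T →ᵇ L2) :
    StronglyMeasurable (velocityPath σ β hσ y) := by
  have h1 : Measurable fun τ : ℝ => ((τ ^ (-β) : ℝ) : ℂ) := by fun_prop
  exact h1.stronglyMeasurable.smul
    ((velocity σ hσ).continuous.comp_stronglyMeasurable (stronglyMeasurable_extendZero y))

theorem memLp_velocityPath (hσ : 1 ≤ σ) (hβ : 2 * β < 1) (hT : 0 ≤ T) (y : Ioc (0 : ℝ) T →ᵇ L2) :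
    MemLp (velocityPath σ β hσ y) 2 (volume.restrict (Ioc 0 T)) := by
  have hmeas := stronglyMeasurable_velocityPath (β := β) hσ y
  rw [memLp_two_iff_integrable_sq_norm hmeas.aestronglyMeasurable]
  have h1 : Integrable (fun τ : ℝ => τ ^ (-(2 * β)) * ‖y‖ ^ 2) (volume.restrict (Ioc 0 T)) :=
    Integrable.mul_const ((intervalIntegrable_iff_integrableOn_Ioc_of_le hT).1
      (intervalIntegral.intervalIntegrable_rpow' (by linarith))) _
  refine h1.mono' (hmeas.norm.aestronglyMeasurable.pow 2) ?_
  refine (ae_restrict_mem measurableSet_Ioc).mono fun τ hτ => ?_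
  have h2 := Real.rpow_nonneg hτ.1.le (-β)
  have h3 : τ ^ (-(2 * β)) = (τ ^ (-β)) ^ 2 := by
    rw [← Real.rpow_natCast, ← Real.rpow_mul hτ.1.le]
    congr 1
    push_cast
    ring
  rw [norm_pow, norm_norm, h3, ← mul_pow]
  refine pow_le_pow_left₀ (norm_nonneg _) ?_ 2
  rw [velocityPath, norm_smul, Complex.norm_real, Real.norm_eq_abs, abs_of_nonneg h2]
  exact mul_le_mul_of_nonneg_left ((norm_velocity_le hσ _).trans (norm_extendZero_le y τ)) h2

theorem quad_velocityPath (hσ : 1 ≤ σ) (y : Ioc (0 : ℝ) T →ᵇ L2) {τ : ℝ} (hτ : τ ∈ Ioc 0 T)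
    (ζ : ℝ) : quad (velocityPath σ β hσ y) τ ζ
      = quadForcing σ β (bilinBCF _ (weightedMul σ hσ) y y) τ ζ := by
  have h1 : ((τ ^ (-(2 * β)) : ℝ) : ℂ) = ((τ ^ (-β) : ℝ) : ℂ) * ((τ ^ (-β) : ℝ) : ℂ) := by
    rw [← Complex.ofReal_mul, ← Real.rpow_add hτ.1]
    congr 2
    ring
  rw [quad, velocityPath, ContinuousLinearMap.map_smul₂, map_smul,
    BoundedContinuousFunction.smul_apply, BoundedContinuousFunction.smul_apply,
    fourierMul_eq_weightedMul hσ, quadForcing, forcing,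
    extendZero_of_mem _ hτ, extendZero_of_mem _ hτ, bilinBCF_apply, h1, smul_eq_mul,
    smul_eq_mul, neg_sub]
  ring

theorem isMild_of_duhamel (e : IsExponents p s σ β κ κ') (hT : 0 ≤ T) {c : ℝ → ℂ}
    {u : ℝ → Sobolev s} {y : Ioc (0 : ℝ) T →ᵇ L2}
    (hu : ∀ t ∈ Icc 0 T, (u t).fourierFun =ᵐ[volume] fun ζ =>
      Complex.exp (t * m ζ) * c ζ -
        duhamel m (quadForcing σ β (bilinBCF _ (weightedMul σ e.one_le_σ) y y)) t ζ)
    (hy : ∀ t : Ioc (0 : ℝ) T, y t =ᵐ[volume]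
      fun ζ => (((t : ℝ) ^ β : ℝ) : ℂ) * (weight σ ζ : ℂ) * (u t).fourierFun ζ) :
    IsMild m T c (fun t => (u t).fourierFun) (velocityPath σ β e.one_le_σ y) where
  stronglyMeasurable := stronglyMeasurable_velocityPath _ y
  memLp := memLp_velocityPath _ e.two_β_lt hT y
  fourier_eq := by
    refine (ae_restrict_mem measurableSet_Ioc).mono fun t ht => ?_
    rw [velocityPath, FourierTransform.fourier_smul, extendZero_of_mem y ht]
    filter_upwards [Lp.coeFn_smul ((t ^ (-β) : ℝ) : ℂ) (𝓕 (velocity σ e.one_le_σ (y ⟨t, ht⟩))),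
      fourier_velocity e.one_le_σ (y ⟨t, ht⟩), hy ⟨t, ht⟩] with ζ h1 h2 h3
    have h4 : ((t ^ (-β) : ℝ) : ℂ) * ((t ^ β : ℝ) : ℂ) = 1 := by
      rw [← Complex.ofReal_mul, ← Real.rpow_add ht.1, neg_add_cancel, Real.rpow_zero,
        Complex.ofReal_one]
    have h5 : (weight (-σ) ζ : ℂ) * (weight σ ζ : ℂ) = 1 := by
      rw [← Complex.ofReal_mul, mul_comm, weight_mul_neg, Complex.ofReal_one]
    rw [h1, Pi.smul_apply, h2, h3, smul_eq_mul]
    calc _ = (((t ^ (-β) : ℝ) : ℂ) * ((t ^ β : ℝ) : ℂ)) *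
          ((weight (-σ) ζ : ℂ) * (weight σ ζ : ℂ)) * (dsym ζ * (u t).fourierFun ζ) := by ring
      _ = _ := by rw [h4, h5]; ring
  duhamel_eq t ht := by
    filter_upwards [hu t ht] with ζ hζ
    rw [hζ, duhamel_congr ht ((ae_restrict_mem measurableSet_Ioc).mono fun τ hτ =>
      quad_velocityPath e.one_le_σ y hτ ζ)]

/-- Any solution agrees with the one given by the solution map: this is true after a restart at a
small positive time `a`, and then `a` tends to `0`. -/
theorem eq_of_isSolution {Φ : ℝ → ℝ} {η : ℝ} (hm : IsDissipative (evolutionSymbol η Φ) p K)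
    (e : IsExponents p s σ β κ κ') (hT : 0 < T) (hT1 : T ≤ 1) {S : Sobolev s → YSpace p s T}
    (hS : ContinuousOn S (Metric.ball 0 R))
    (hmild : ∀ u₀ ∈ Metric.ball (0 : Sobolev s) R, ∃ w,
      IsMild (evolutionSymbol η Φ) T u₀.fourierFun (fun t => ((S u₀).toFun t).fourierFun) w)
    {u₀ : Sobolev s} (hu₀ : u₀ ∈ Metric.ball 0 R) {v : ℝ → Sobolev s}
    (hv : IsSolution Φ η T u₀ v) : ∀ t ∈ Icc 0 T, v t = (S u₀).toFun t := by
  have hSc := continuousOn_toFun (S u₀)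
  intro t ht
  rcases ht.1.eq_or_lt with h0 | h0
  · obtain ⟨w, hw⟩ := hmild u₀ hu₀
    rw [← h0, hv.2.1]
    exact (hw.isSolution hm hT.le hT1 hSc).2.1.symm
  have hIoo : ∀ᶠ a in 𝓝[>] (0 : ℝ), a ∈ Ioo 0 t := Ioo_mem_nhdsGT h0
  have hva : Tendsto v (𝓝[>] 0) (𝓝 u₀) := by
    have h1 := hv.1 0 ⟨le_rfl, hT.le⟩
    rw [ContinuousWithinAt, hv.2.1] at h1
    exact h1.mono_left (nhdsWithin_le_of_mem (mem_of_superset (Ioo_mem_nhdsGT hT)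
      Ioo_subset_Icc_self))
  have hball : ∀ᶠ a in 𝓝[>] (0 : ℝ), v a ∈ Metric.ball (0 : Sobolev s) R :=
    hva (Metric.isOpen_ball.mem_nhds hu₀)
  have hSva : Tendsto (fun a => S (v a)) (𝓝[>] 0) (𝓝 (S u₀)) :=
    (hS.continuousAt (Metric.isOpen_ball.mem_nhds hu₀)).tendsto.comp hva
  have htime : Tendsto (fun a => (S u₀).toFun (t - a)) (𝓝[>] 0) (𝓝 ((S u₀).toFun t)) := by
    have h1 : Tendsto (fun a => t - a) (𝓝[>] (0 : ℝ)) (𝓝[Icc 0 T] t) := by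
      refine tendsto_nhdsWithin_iff.2 ⟨?_, ?_⟩
      · have h2 : Tendsto (fun a => t - a) (𝓝 (0 : ℝ)) (𝓝 (t - 0)) :=
          (continuous_const.sub continuous_id).tendsto 0
        rw [sub_zero] at h2
        exact h2.mono_left nhdsWithin_le_nhds
      · filter_upwards [hIoo] with a ha
        exact ⟨by linarith [ha.2], by linarith [ha.1, ht.2]⟩
    exact (hSc t ht).tendsto.comp h1
  have heq : ∀ᶠ a in 𝓝[>] (0 : ℝ), (S (v a)).toFun (t - a) = v t := by
    filter_upwards [hIoo, hball] with a ha hb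
    obtain ⟨w, hw⟩ := hv.exists_isMild hm ⟨ha.1, ha.2.trans_le ht.2⟩
    obtain ⟨w', hw'⟩ := hmild (v a) hb
    have h1 := IsMild.unique hm e.κ_nonneg e.two_κ_lt e.lt_κ_mul (by linarith [ha.1])
      (hw'.mono (T' := T - a) (by linarith [ha.1])) hw ae_eq_rfl (t - a)
      ⟨by linarith [ha.2], by linarith [ht.2]⟩
    simp only [add_sub_cancel] at h1
    exact Sobolev.ext_fourierFun h1
  have hlim : Tendsto (fun a => (S (v a)).toFun (t - a)) (𝓝[>] 0) (𝓝 ((S u₀).toFun t)) := by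
    have h1 : Tendsto (fun a => (S (v a) - S u₀).toFun (t - a)) (𝓝[>] 0) (𝓝 0) :=
      squeeze_zero_norm (fun a => norm_toFun_le _ _) (tendsto_iff_norm_sub_tendsto_zero.1 hSva)
    have h2 := h1.add htime
    simpa only [toFun_sub, sub_add_cancel, zero_add] using h2
  exact tendsto_nhds_unique (tendsto_const_nhds.congr' (heq.mono fun a ha => ha.symm)) hlim

end Solution

/-! ### Smoothing -/

section Smoothing

variable {p K s σ β κ κ' T : ℝ}

/-- The function `u` is continuous on `(0, T]` with values in `H ^ r`. -/
def HasRegularity (T r : ℝ) (u : ℝ → Sobolev s) : Prop :=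
  ContinuousOn (fun t => mkL2 fun ζ => (weight r ζ : ℂ) * (u t).fourierFun ζ) (Ioc 0 T) ∧
    ∀ t ∈ Ioc 0 T, MemLp (fun ζ => (weight r ζ : ℂ) * (u t).fourierFun ζ) 2 volume

theorem hasRegularity_of_local {r : ℝ} {u : ℝ → Sobolev s}
    (h : ∀ t₀ ∈ Ioc 0 T, ∃ a < t₀, ∃ W : ℝ → L2, ContinuousOn W (Ioc a T) ∧
      ∀ t ∈ Ioc a T, W t =ᵐ[volume] fun ζ => (weight r ζ : ℂ) * (u t).fourierFun ζ) :
    HasRegularity T r u := by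
  constructor
  · intro t₀ ht₀
    obtain ⟨a, ha, W, hW, hWu⟩ := h t₀ ht₀
    have h1 : ContinuousWithinAt W (Ioc 0 T) t₀ := by
      refine (hW t₀ ⟨ha, ht₀.2⟩).mono_of_mem_nhdsWithin ?_
      filter_upwards [eventually_mem_nhdsWithin,
        eventually_nhdsWithin_of_eventually_nhds (Ioi_mem_nhds ha)] with t h2 h3
      exact ⟨h3, h2.2⟩
    refine h1.congr_of_eventuallyEq ?_ (mkL2_eq_of_ae (hWu t₀ ⟨ha, ht₀.2⟩).symm)
    filter_upwards [eventually_mem_nhdsWithin,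
      eventually_nhdsWithin_of_eventually_nhds (Ioi_mem_nhds ha)] with t h2 h3
    exact mkL2_eq_of_ae (hWu t ⟨h3, h2.2⟩).symm
  · intro t ht
    obtain ⟨a, ha, W, -, hWu⟩ := h t ht
    exact (memLp_congr_ae (hWu t ⟨ha, ht.2⟩)).1 (Lp.memLp _)

theorem HasRegularity.mono {r r' : ℝ} {u : ℝ → Sobolev s} (h : HasRegularity T r u)
    (hr : r' ≤ r) : HasRegularity T r' u := by
  have hb : ∀ ζ, ‖(weight (r' - r) ζ : ℂ)‖ ≤ 1 := fun ζ => by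
    rw [norm_weight_ofReal]
    exact weight_le_one (by linarith) ζ
  refine hasRegularity_of_local fun t₀ ht₀ => ⟨0, ht₀.1, fun t => mulL2
    (fun ζ => (weight (r' - r) ζ : ℂ)) 1 (continuous_weight_ofReal _).aestronglyMeasurable hb
    (mkL2 fun ζ => (weight r ζ : ℂ) * (u t).fourierFun ζ), ?_, fun t ht => ?_⟩
  · exact (mulL2 _ _ _ _).continuous.comp_continuousOn h.1
  · filter_upwards [coeFn_mulL2 (continuous_weight_ofReal (r' - r)).aestronglyMeasurable hb
      (mkL2 fun ζ => (weight r ζ : ℂ) * (u t).fourierFun ζ), coeFn_mkL2 (h.2 t ht)] with ζ h1 h2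
    rw [h1, h2, ← mul_assoc, ← Complex.ofReal_mul, weight_mul, sub_add_cancel]

theorem fourier_injective_L2 {f g : L2} (h : (𝓕 f : L2) = 𝓕 g) : f = g := by
  have h1 := congrArg (fun x : L2 => (𝓕⁻ x : L2)) h
  simpa only [FourierTransform.fourierInv_fourier_eq] using h1

/-- The Duhamel formula, restarted at a positive time, gains a derivative. -/
theorem HasRegularity.succ {Φ : ℝ → ℝ} {η : ℝ} (hm : IsDissipative (evolutionSymbol η Φ) p K)
    (hp : 3 < p) (hT1 : T ≤ 1) {u₀ : Sobolev s} {u : ℝ → Sobolev s} (hu : IsSolution Φ η T u₀ u)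
    {r : ℝ} (hr : 1 ≤ r) (h : HasRegularity T r u) : HasRegularity T (r + 1) u := by
  refine hasRegularity_of_local fun t₀ ht₀ => ?_
  set a := t₀ / 2 with ha
  have ha0 : 0 < a := half_pos ht₀.1
  have hat : a < t₀ := half_lt_self ht₀.1
  have haT : a < T := hat.trans_le ht₀.2
  refine ⟨a, hat, ?_⟩
  set m := evolutionSymbol η Φ with hm_def
  set V : ℝ → L2 := fun t => mkL2 fun ζ => (weight r ζ : ℂ) * (u t).fourierFun ζ with hV
  have hVu : ∀ t ∈ Ioc 0 T, V t =ᵐ[volume] fun ζ => (weight r ζ : ℂ) * (u t).fourierFun ζ :=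
    fun t ht => coeFn_mkL2 (h.2 t ht)
  -- after the time `a`, the path with values in `H ^ r` is bounded
  obtain ⟨C, hC⟩ := (isCompact_Icc (a := a) (b := T)).exists_bound_of_continuousOn
    (h.1.mono fun t ht => ⟨ha0.trans_le ht.1, ht.2⟩)
  have hVa : Continuous fun t : Ioc (0 : ℝ) (T - a) => V (a + t) := by
    refine h.1.comp_continuous (by fun_prop) fun t => ?_
    exact ⟨by linarith [t.2.1], by linarith [t.2.2]⟩
  set y : Ioc (0 : ℝ) (T - a) →ᵇ L2 := BoundedContinuousFunction.ofNormedAddCommGroup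
    (fun t : Ioc (0 : ℝ) (T - a) => V (a + t)) hVa C
    fun t => hC _ ⟨by linarith [t.2.1], by linarith [t.2.2]⟩ with hy
  obtain ⟨w, hw⟩ := hu.exists_isMild hm ⟨ha0, haT⟩
  have hwy : ∀ᵐ τ ∂volume.restrict (Ioc 0 (T - a)), w τ = velocityPath r 0 hr y τ := by
    filter_upwards [hw.fourier_eq, ae_restrict_mem measurableSet_Ioc] with τ h1 hτ
    apply fourier_injective_L2
    apply Lp.ext
    rw [velocityPath, neg_zero, Real.rpow_zero, Complex.ofReal_one, one_smul,
      extendZero_of_mem y hτ]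
    filter_upwards [h1, fourier_velocity hr (y ⟨τ, hτ⟩),
      hVu (a + τ) ⟨by linarith [hτ.1], by linarith [hτ.2]⟩] with ζ e1 e2 e3
    have e4 : y ⟨τ, hτ⟩ = V (a + τ) := rfl
    have e5 : (weight (-r) ζ : ℂ) * (weight r ζ : ℂ) = 1 := by
      rw [← Complex.ofReal_mul, mul_comm, weight_mul_neg, Complex.ofReal_one]
    rw [e1, e2, e4, e3]
    linear_combination (-(dsym ζ * (u (a + τ)).fourierFun ζ)) * e5
  set ν := bilinBCF _ (weightedMul r hr) y y with hν
  have hn := isForcing_forcing (T := T - a) (2 * 0) (r - 1) ν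
  have hTa : T - a ≤ 1 := by linarith
  have hduh : ∀ t ∈ Icc 0 (T - a), ∀ ζ,
      duhamel m (quad w) t ζ = duhamel m (quadForcing r 0 ν) t ζ := by
    intro t ht ζ
    refine duhamel_congr ht ?_
    filter_upwards [hwy, ae_restrict_mem measurableSet_Ioc] with τ h1 h2
    rw [← quad_velocityPath hr y h2, quad, quad, h1]
  have hκ : (5 / 6 : ℝ) ∈ Ico (0 : ℝ) 1 := by norm_num
  have hgain : r + 1 - 5 / 6 * p - (r - 1) < -1 / 2 := by linarith
  have hp0 : p ≠ 0 := by linarith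
  have hone : 1 / p * p = 1 := by field_simp
  have hpp : 1 / p ∈ Icc (0 : ℝ) 1 :=
    ⟨by positivity, by rw [div_le_one (by linarith)]; linarith⟩
  have hmaps : ∀ t ∈ Ioc a T, t - a ∈ Ioc 0 (T - a) := fun t ht =>
    ⟨by linarith [ht.1], by linarith [ht.2]⟩
  refine ⟨fun t => (mkL2 fun ζ => (weight (1 / p * p) ζ : ℂ) *
      Complex.exp (((t - a : ℝ) : ℂ) * m ζ) * V a ζ) -
    mkL2 fun ζ => (weight (r + 1) ζ : ℂ) * duhamel m (quadForcing r 0 ν) (t - a) ζ,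
    ContinuousOn.sub ?_ ?_, fun t ht => ?_⟩
  · refine (continuousOn_weight_mul_exp hm hpp (V a)).comp (f := fun t : ℝ => t - a) (by fun_prop)
      fun t ht => ?_
    exact ⟨(hmaps t ht).1, (hmaps t ht).2.trans hTa⟩
  · exact (continuousOn_mkL2_weight_mul_duhamel hm hn hTa (by norm_num) (by norm_num) hκ
      hgain).comp (f := fun t : ℝ => t - a) (by fun_prop) hmaps
  · have h1 := hmaps t ht
    filter_upwards [Lp.coeFn_sub (mkL2 fun ζ => (weight (1 / p * p) ζ : ℂ) *
        Complex.exp (((t - a : ℝ) : ℂ) * m ζ) * V a ζ)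
        (mkL2 fun ζ => (weight (r + 1) ζ : ℂ) * duhamel m (quadForcing r 0 ν) (t - a) ζ),
      coeFn_mkL2 (memLp_weight_mul_exp hm hpp ⟨h1.1, h1.2.trans hTa⟩ (V a)).1,
      coeFn_mkL2 (memLp_weight_mul_duhamel hm hn hTa (by norm_num) hκ hgain ⟨h1.1.le, h1.2⟩),
      hVu a ⟨ha0, haT.le⟩, hw.duhamel_eq (t - a) ⟨h1.1.le, h1.2⟩] with ζ e1 e2 e3 e4 e5
    rw [add_sub_cancel] at e5
    have e6 : (weight (r + 1) ζ : ℂ) = (weight 1 ζ : ℂ) * (weight r ζ : ℂ) := by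
      rw [← Complex.ofReal_mul, weight_mul, add_comm]
    rw [e1, Pi.sub_apply, e2, e3, e4, e5, hduh _ ⟨h1.1.le, h1.2⟩, hone, e6]
    ring

theorem continuousIntoHInfty_of_hasRegularity {Φ : ℝ → ℝ} {η : ℝ}
    (hm : IsDissipative (evolutionSymbol η Φ) p K) (hp : 3 < p) (hT1 : T ≤ 1) {u₀ : Sobolev s}
    {u : ℝ → Sobolev s} (hu : IsSolution Φ η T u₀ u) {r₀ : ℝ} (hr₀ : 1 ≤ r₀)
    (h : HasRegularity T r₀ u) : ContinuousIntoHInfty T u := by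
  have hn : ∀ n : ℕ, HasRegularity T (r₀ + n) u := by
    intro n
    induction n with
    | zero => simpa using h
    | succ n ih =>
      have h1 := ih.succ hm hp hT1 hu (by linarith [(Nat.cast_nonneg n : (0 : ℝ) ≤ n)])
      rwa [Nat.cast_succ, ← add_assoc]
  intro r
  obtain ⟨n, hn'⟩ := exists_nat_ge (r - r₀)
  have hr : HasRegularity T r u := (hn n).mono (by linarith)
  refine ⟨fun t => (Sobolev.equivL2 r).symm (mkL2 fun ζ => (weight r ζ : ℂ) * (u t).fourierFun ζ),
    (Sobolev.equivL2 r).symm.continuous.comp_continuousOn hr.1, fun t ht => ?_⟩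
  apply toDistr_eq_of_fourierFun
  filter_upwards [coeFn_mkL2 (hr.2 t ht)] with ζ h1
  rw [fourierFun_equivL2_symm, h1, ← mul_assoc, ← Complex.ofReal_mul, mul_comm (weight (-r) ζ),
    weight_mul_neg, Complex.ofReal_one, one_mul]

theorem hasRegularity_of_rescaled {u : ℝ → Sobolev s} {y : Ioc (0 : ℝ) T →ᵇ L2}
    (hy : ∀ t : Ioc (0 : ℝ) T, y t =ᵐ[volume]
      fun ζ => (((t : ℝ) ^ β : ℝ) : ℂ) * (weight σ ζ : ℂ) * (u t).fourierFun ζ) :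
    HasRegularity T σ u := by
  refine hasRegularity_of_local fun t₀ ht₀ => ⟨0, ht₀.1,
    fun t => ((t ^ (-β) : ℝ) : ℂ) • extendZero y t, ?_, fun t ht => ?_⟩
  · have h1 : ContinuousOn (fun t : ℝ => ((t ^ (-β) : ℝ) : ℂ)) (Ioc 0 T) :=
      Complex.continuous_ofReal.comp_continuousOn
        (continuousOn_id.rpow_const fun t ht => Or.inl ht.1.ne')
    exact h1.smul (continuousOn_extendZero y)
  · beta_reduce
    rw [extendZero_of_mem y ht]
    filter_upwards [Lp.coeFn_smul ((t ^ (-β) : ℝ) : ℂ) (y ⟨t, ht⟩), hy ⟨t, ht⟩] with ζ h1 h2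
    have h4 : ((t ^ (-β) : ℝ) : ℂ) * ((t ^ β : ℝ) : ℂ) = 1 := by
      rw [← Complex.ofReal_mul, ← Real.rpow_add ht.1, neg_add_cancel, Real.rpow_zero,
        Complex.ofReal_one]
    rw [h1, Pi.smul_apply, h2, smul_eq_mul]
    linear_combination ((weight σ ζ : ℂ) * (u t).fourierFun ζ) * h4

end Smoothing

/-! ### Complex conjugation and real valued solutions -/

section Reflection

/-- The map `g ↦ conj (g (-ζ))` on `L ^ 2`: on the Fourier side, it is complex conjugation. -/
def reflect : L2 →L[ℝ] L2 :=
  (Complex.conjCLE : ℂ →L[ℝ] ℂ).compLpL 2 volume ∘L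
    (Lp.compMeasurePreservingₗᵢ ℝ _ (Measure.measurePreserving_neg volume)).toContinuousLinearMap

theorem measurePreserving_neg_real : MeasurePreserving (fun ζ : ℝ => -ζ) volume volume :=
  Measure.measurePreserving_neg volume

theorem coeFn_reflect (g : L2) : reflect g =ᵐ[volume] fun ζ => conj (g (-ζ)) := by
  have h1 := (Complex.conjCLE : ℂ →L[ℝ] ℂ).coeFn_compLpL (p := 2) (μ := volume)
    (Lp.compMeasurePreservingₗᵢ ℝ _ (Measure.measurePreserving_neg volume) g)
  have h2 := Lp.coeFn_compMeasurePreserving g (Measure.measurePreserving_neg (volume : Measure ℝ))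
  filter_upwards [h1, h2] with ζ e1 e2
  exact e1.trans (congrArg conj e2)

/-- The conjugate of a square integrable function, defined on the Fourier side. -/
def conjL2 : L2 →L[ℝ] L2 :=
  ((FourierTransform.fourierInvCLM ℂ L2).restrictScalars ℝ) ∘L reflect ∘L
    ((FourierTransform.fourierCLM ℂ L2).restrictScalars ℝ)

theorem conjL2_apply (f : L2) : conjL2 f = (𝓕⁻ (reflect (𝓕 f)) : L2) := rfl

theorem fourier_conjL2 (f : L2) : (𝓕 (conjL2 f) : L2) = reflect (𝓕 f) := by
  rw [conjL2_apply, FourierTransform.fourier_fourierInv_eq]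

theorem fourierMul_conjL2 (f g : L2) (ζ : ℝ) :
    fourierMul (conjL2 f) (conjL2 g) ζ = conj (fourierMul f g (-ζ)) := by
  have hf : f = 𝓕⁻ (𝓕 f) := (FourierTransform.fourierInv_fourier_eq f).symm
  have hg : g = 𝓕⁻ (𝓕 g) := (FourierTransform.fourierInv_fourier_eq g).symm
  have hr : fourierMul f g (-ζ) = ∫ z, (𝓕 f : L2) (-ζ - z) * (𝓕 g : L2) z := by
    conv_lhs => rw [hf, hg]
    exact fourierMul_fourierInv _ _ _
  rw [hr, conjL2_apply, conjL2_apply, fourierMul_fourierInv, ← integral_conj,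
    ← integral_neg_eq_self fun z => conj ((𝓕 f : L2) (-ζ - z) * (𝓕 g : L2) z)]
  refine integral_congr_ae ?_
  filter_upwards [coeFn_reflect (𝓕 g),
    (measurePreserving_const_sub ζ).quasiMeasurePreserving.ae (coeFn_reflect (𝓕 f))] with z h1 h2
  rw [h1, h2, map_mul]
  ring_nf

end Reflection

section Symmetry

variable {m : ℝ → ℂ} {T : ℝ} {c : ℝ → ℂ} {U : ℝ → ℝ → ℂ} {w : ℝ → L2}

theorem dsym_neg (ζ : ℝ) : dsym (-ζ) = conj (dsym ζ) := by
  rw [dsym, dsym, map_mul, Complex.conj_I, Complex.conj_ofReal]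
  push_cast
  ring

theorem evolutionSymbol_neg {Φ : ℝ → ℝ} (η : ℝ) (h : ∀ ξ, Φ (-ξ) = Φ ξ) (ζ : ℝ) :
    evolutionSymbol η Φ (-ζ) = conj (evolutionSymbol η Φ ζ) := by
  simp only [evolutionSymbol, map_add, map_neg, map_pow, Complex.conj_ofReal, dsym_neg]
  rw [mul_neg, h]

theorem duhamel_conj (hm : ∀ ζ, m (-ζ) = conj (m ζ)) (w : ℝ → L2) (t ζ : ℝ) :
    duhamel m (quad fun τ => conjL2 (w τ)) t ζ = conj (duhamel m (quad w) t (-ζ)) := by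
  rw [duhamel, duhamel, ← intervalIntegral.intervalIntegral_conj]
  refine intervalIntegral.integral_congr fun τ _ => ?_
  simp only [quad, map_mul, fourierMul_conjL2, ← Complex.exp_conj, hm, Complex.conj_conj,
    Complex.conj_ofReal]

/-- If `m (-ζ) = conj (m ζ)`, then the conjugate of a solution is a solution. -/
theorem IsMild.conj (hm : ∀ ζ, m (-ζ) = conj (m ζ)) (h : IsMild m T c U w) :
    IsMild m T (fun ζ => conj (c (-ζ))) (fun t ζ => conj (U t (-ζ))) fun t => conjL2 (w t) where
  stronglyMeasurable := conjL2.continuous.comp_stronglyMeasurable h.stronglyMeasurable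
  memLp := conjL2.comp_memLp' h.memLp
  fourier_eq := by
    filter_upwards [h.fourier_eq] with t ht
    rw [fourier_conjL2]
    filter_upwards [coeFn_reflect (𝓕 (w t)),
      measurePreserving_neg_real.quasiMeasurePreserving.ae ht] with ζ h1 h2
    rw [h1, h2, map_mul, dsym_neg, Complex.conj_conj]
  duhamel_eq t ht := by
    filter_upwards [measurePreserving_neg_real.quasiMeasurePreserving.ae (h.duhamel_eq t ht)]
      with ζ h1
    rw [h1, map_sub, map_mul, duhamel_conj hm, ← Complex.exp_conj, map_mul, hm, Complex.conj_conj,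
      Complex.conj_ofReal]

end Symmetry

section IsReal

/-- The conjugate of a Schwartz function. -/
def conjSchwartz (φ : 𝓢(ℝ, ℂ)) : 𝓢(ℝ, ℂ) :=
  SchwartzMap.postcompCLM (𝕜 := ℝ) (Complex.conjCLE : ℂ →L[ℝ] ℂ) φ

theorem conjSchwartz_apply (φ : 𝓢(ℝ, ℂ)) (x : ℝ) : conjSchwartz φ x = conj (φ x) := rfl

theorem fourierInv_conjSchwartz (φ : 𝓢(ℝ, ℂ)) (ζ : ℝ) :
    (𝓕⁻ (conjSchwartz φ)) ζ = conj ((𝓕⁻ φ) (-ζ)) := by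
  rw [SchwartzMap.fourierInv_coe, SchwartzMap.fourierInv_coe, Real.fourierInv_eq',
    Real.fourierInv_eq', ← integral_conj]
  congr 1
  ext x
  rw [conjSchwartz_apply, smul_eq_mul, smul_eq_mul, map_mul, ← Complex.exp_conj]
  simp [map_ofNat]

variable {s : ℝ}

theorem Sobolev.toDistr_conjSchwartz (f : Sobolev s) (φ : 𝓢(ℝ, ℂ)) :
    f.toDistr (conjSchwartz φ) = conj (∫ ζ, conj (f.fourierFun (-ζ)) * (𝓕⁻ φ) ζ) := by
  rw [Sobolev.toDistr_apply, ← integral_conj, ← integral_neg_eq_self]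
  congr 1
  ext ζ
  rw [fourierInv_conjSchwartz, neg_neg, map_mul, Complex.conj_conj]

/-- The test functions `φ + conj φ` and `i (φ - conj φ)` are real valued. -/
theorem isReal_iff_conjSchwartz (f : Sobolev s) :
    IsReal f ↔ ∀ φ, f.toDistr (conjSchwartz φ) = conj (f.toDistr φ) := by
  constructor
  · intro h φ
    have h1 := h (φ + conjSchwartz φ) fun x => by
      rw [add_apply, conjSchwartz_apply]
      simp
    have h2 := h (Complex.I • (φ - conjSchwartz φ)) fun x => by
      rw [smul_apply, sub_apply, conjSchwartz_apply]
      simp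
    rw [map_add, Complex.add_im] at h1
    rw [map_smul, map_sub, smul_eq_mul, Complex.I_mul_im, Complex.sub_re] at h2
    apply Complex.ext
    · rw [Complex.conj_re]
      linarith
    · rw [Complex.conj_im]
      linarith
  · intro h φ hφ
    have h1 : conjSchwartz φ = φ := by
      ext x
      exact Complex.conj_eq_iff_im.2 (hφ x)
    have h2 := h φ
    rw [h1] at h2
    exact Complex.conj_eq_iff_im.1 h2.symm

theorem isReal_iff (f : Sobolev s) :
    IsReal f ↔ (fun ζ => conj (f.fourierFun (-ζ))) =ᵐ[volume] f.fourierFun := by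
  rw [isReal_iff_conjSchwartz]
  constructor
  · intro h
    have hf := f.temperedIntegrable_fourierFun
    have hr : TemperedIntegrable fun ζ => conj (f.fourierFun (-ζ)) := by
      obtain ⟨M, hM⟩ := hf
      refine ⟨M, ?_⟩
      have h1 := (Complex.conjCLE : ℂ →L[ℝ] ℂ).integrable_comp hM.comp_neg
      refine h1.congr (Eventually.of_forall fun ζ => ?_)
      have h2 : weight (-M) (-ζ) = weight (-M) ζ := by simp [weight]
      simp [h2]
    have h0 := (hr.sub hf).ae_eq_zero fun ψ => by
      have h1 := h (𝓕 ψ)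
      rw [Sobolev.toDistr_conjSchwartz, Sobolev.toDistr_apply,
        FourierTransform.fourierInv_fourier_eq] at h1
      have h2 := (starRingEnd ℂ).injective h1
      simp only [sub_mul]
      rw [integral_sub (hr.integrable_mul_schwartz ψ) (hf.integrable_mul_schwartz ψ), h2, sub_self]
    filter_upwards [h0] with ζ hζ
    exact sub_eq_zero.1 hζ
  · intro h φ
    rw [Sobolev.toDistr_conjSchwartz, Sobolev.toDistr_apply]
    congr 1
    refine integral_congr_ae ?_
    filter_upwards [h] with ζ hζ
    rw [hζ]

/-- The conjugate of the solution solves the same problem, hence is equal to it. -/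
theorem IsMild.isReal {Φ : ℝ → ℝ} {η p K κ T : ℝ} (hm : IsDissipative (evolutionSymbol η Φ) p K)
    (hκ0 : 0 ≤ κ) (hκ1 : 2 * κ < 1) (hκ : 3 / 2 < κ * p) (hT1 : T ≤ 1)
    {u₀ : Sobolev s} {u : ℝ → Sobolev s} {w : ℝ → L2}
    (h : IsMild (evolutionSymbol η Φ) T u₀.fourierFun (fun t => (u t).fourierFun) w)
    (hΦ : ∀ ξ, Φ (-ξ) = Φ ξ) (hu₀ : IsReal u₀) : ∀ t ∈ Icc 0 T, IsReal (u t) := fun t ht =>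
  (isReal_iff _).2 (IsMild.unique hm hκ0 hκ1 hκ hT1 (h.conj (evolutionSymbol_neg η hΦ)) h
    ((isReal_iff _).1 hu₀) t ht)

end IsReal

end DissipativeKdV

end

theorem theorem1p2 (η p q C s : ℝ) (Φ Φ₁ : ℝ → ℝ) (hη : 0 < η) (hp : 3 < p)
    (hq : 0 ≤ q) (hqp : q < p) (hΦ₁_meas : Measurable Φ₁)
    (hΦ₁ : ∀ ξ : ℝ, |Φ₁ ξ| ≤ C * (1 + |ξ| ^ q))
    (hΦ : ∀ ξ : ℝ, Φ ξ = -|ξ| ^ p + Φ₁ ξ)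
    (hs : 1 - p / 2 < s) :
    ∀ R : ℝ, 0 < R → ∃ T : ℝ, 0 < T ∧ T ≤ 1 ∧
      ∃ S : DissipativeKdV.Sobolev s → DissipativeKdV.YSpace p s T,
        ContDiffOn ℂ ∞ S (Metric.ball 0 R) ∧
        ∀ u₀ ∈ Metric.ball (0 : DissipativeKdV.Sobolev s) R,
          DissipativeKdV.IsSolution Φ η T u₀ (S u₀).toFun ∧
          (∀ v : ℝ → DissipativeKdV.Sobolev s, DissipativeKdV.IsSolution Φ η T u₀ v →
            ∀ t ∈ Icc 0 T, v t = (S u₀).toFun t) ∧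
          DissipativeKdV.ContinuousIntoHInfty T (S u₀).toFun ∧
          ((∀ ξ : ℝ, Φ (-ξ) = Φ ξ) → DissipativeKdV.IsReal u₀ →
            ∀ t ∈ Icc 0 T, DissipativeKdV.IsReal ((S u₀).toFun t)) := by
  intro R hR
  obtain ⟨K, hm⟩ := DissipativeKdV.exists_isDissipative hη hp hq hqp hΦ₁_meas hΦ₁ hΦ
  obtain ⟨σ, β, κ, κ', e⟩ := DissipativeKdV.exists_isExponents hp hs
  obtain ⟨T, hT, hT1, S, hS, hfix⟩ := DissipativeKdV.exists_solutionMap hm e hR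
  have hmild : ∀ u₀ ∈ Metric.ball (0 : DissipativeKdV.Sobolev s) R, ∃ w,
      DissipativeKdV.IsMild (DissipativeKdV.evolutionSymbol η Φ) T u₀.fourierFun
        (fun t => ((S u₀).toFun t).fourierFun) w := fun u₀ hu₀ => by
    obtain ⟨y, hu, hy⟩ := hfix u₀ hu₀
    exact ⟨_, DissipativeKdV.isMild_of_duhamel e hT.le hu hy⟩
  refine ⟨T, hT, hT1, S, hS, fun u₀ hu₀ => ?_⟩
  obtain ⟨w, hw⟩ := hmild u₀ hu₀
  obtain ⟨y, -, hy⟩ := hfix u₀ hu₀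
  have hsol := hw.isSolution hm hT.le hT1 (DissipativeKdV.continuousOn_toFun (S u₀))
  exact ⟨hsol,
    fun v hv => DissipativeKdV.eq_of_isSolution hm e hT hT1 hS.continuousOn hmild hu₀ hv,
    DissipativeKdV.continuousIntoHInfty_of_hasRegularity hm hp hT1 hsol e.one_le_σ
      (DissipativeKdV.hasRegularity_of_rescaled hy),
    fun hΦe hreal => hw.isReal hm e.κ_nonneg e.two_κ_lt e.lt_κ_mul hT1 hΦe hreal⟩
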